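/- Let $\mathbb{R}_2^+=\{y\in\mathbb{R}^2: y_2\ge 0\}$. For $D\subseteq\mathbb{R}_2^+$ and $\omega:\mathbb{R}_2^+\to\mathbb{R}$ put $$[\omega]_{C_x^{1/2}(D)}=\sup_{p,q\in D,\ p_2=q_2,\ p\neq q}\frac{|\omega(p)-\omega(q)|}{|p_1-q_1|^{1/2}},\qquad [\omega]_{C_y^{1/2}(D)}=\sup_{p,q\in D,\ p_1=q_1,\ p\neq q}\frac{|\omega(p)-\omega(q)|}{|p_2-q_2|^{1/2}}$$ (a supremum over the empty set is $0$). Let $W$ be the extension of $\omega$ to $\mathbb{R}^2$ that is odd in the second variable: $W(y)=\omega(y)$ if $y_2\ge 0$ and $W(y)=-\omega(y_1,-y_2)$ if $y_2<0$. For $a>0$ let $Q_a(x)=[x_1-a,x_1+a]\times[x_2-a,x_2+a]$, and define $$u_y(x,a)=\frac1{2\pi}\,\mathrm{P.V.}\!\int_{Q_a(x)}\frac{(x_1-y_1)^2-(x_2-y_2)^2}{|x-y|^4}\,W(y)\,dy+\frac{\omega(x)}2,$$ $$v_x(x,a)=\frac1{2\pi}\,\mathrm{P.V.}\!\int_{Q_a(x)}\frac{(x_1-y_1)^2-(x_2-y_2)^2}{|x-y|^4}\,W(y)\,dy-\frac{\omega(x)}2,$$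 where $\mathrm{P.V.}\int_{Q_a(x)}=\lim_{\varepsilon\to0^+}\int_{Q_a(x)\setminus Q_\varepsilon(x)}$. **Lemma 3.3.** There are functions $C_1,C_2:(0,\infty)\to(0,\infty)$ with $\frac1\pi C_1(0.582)\le 2.53$ and $\frac1\pi C_2(0.582)\le 1.55$ such that the following holds. Let $x=(x_1,x_2)$ and $z=(z_1,x_2)$ be points of $\mathbb{R}_2^+$, let $a>0$ satisfy $a\ge 2|x-z|$, let $D\subseteq\mathbb{R}_2^+$ contain $(Q_a(x)\cup Q_a(z))\cap\mathbb{R}_2^+$, and let $\omega:\mathbb{R}_2^+\to\mathbb{R}$ satisfy $[\omega]_{C_x^{1/2}(D)}<\infty$ and $[\omega]_{C_y^{1/2}(D)}<\infty$. Then the principal values defining $u_y$ and $v_x$ at $(x,a)$ and $(z,a)$ exist and, if $x\ne z$, for every $\tau>0$ $$\frac{|v_x(x,a)-v_x(z,a)|}{|x-z|^{1/2}}\le\frac1\pi C_1(\tau)\max\!\big([\omega]_{C_x^{1/2}(D)},\ \tau^{-1}[\omega]_{C_y^{1/2}(D)}\big),$$ $$\frac{|u_y(x,a)-u_y(z,a)|}{|x-z|^{1/2}}\le\frac1\pi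 C_2(\tau)\max\!\big([\omega]_{C_x^{1/2}(D)},\ \tau^{-1}[\omega]_{C_y^{1/2}(D)}\big).$$ -/

import Mathlib

open Real Set Filter Topology MeasureTheory

noncomputable section

namespace SharpHolder

/-- The closed upper half plane `ℝ₂⁺`; points of the plane are pairs `(x₁, x₂)`. -/
def upperHalf : Set (ℝ × ℝ) := {y | 0 ≤ y.2}

/-- The extension of `ω`, given on the upper half plane, to the whole plane that is odd in the
second variable; values of `ω` below the boundary are not used. -/
def oddExt (ω : ℝ × ℝ → ℝ) (y : ℝ × ℝ) : ℝ :=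
  if 0 ≤ y.2 then ω y else -ω (y.1, -y.2)

/-- The closed square `[x₁ - a, x₁ + a] × [x₂ - a, x₂ + a]`. -/
def box (a : ℝ) (x : ℝ × ℝ) : Set (ℝ × ℝ) :=
  Icc (x.1 - a) (x.1 + a) ×ˢ Icc (x.2 - a) (x.2 + a)

/-- The partial Hölder seminorm of order `α` in the first variable on `D`,
with value `∞` if the supremum is infinite. The pairs `x = z` contribute `0`. -/
def holderX (α : ℝ) (ω : ℝ × ℝ → ℝ) (D : Set (ℝ × ℝ)) : ENNReal :=
  ⨆ x ∈ D, ⨆ z ∈ D, ⨆ _ : x.2 = z.2, ENNReal.ofReal (|ω x - ω z| / |x.1 - z.1| ^ α)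

/-- The partial Hölder seminorm of order `α` in the second variable on `D`. -/
def holderY (α : ℝ) (ω : ℝ × ℝ → ℝ) (D : Set (ℝ × ℝ)) : ENNReal :=
  ⨆ x ∈ D, ⨆ z ∈ D, ⨆ _ : x.1 = z.1, ENNReal.ofReal (|ω x - ω z| / |x.2 - z.2| ^ α)

/-- The integral of `f` over `Q` without the square of half side `ε` about `x`. -/
def truncIntegral (f : ℝ × ℝ → ℝ) (Q : Set (ℝ × ℝ)) (x : ℝ × ℝ) (ε : ℝ) : ℝ :=
  ∫ y in Q \ box ε x, f y

/-- The principal value at `x` of the integral of `f` over `Q` exists: every truncated integral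
converges absolutely and the truncated integrals have a finite limit. -/
def PVExists (f : ℝ × ℝ → ℝ) (Q : Set (ℝ × ℝ)) (x : ℝ × ℝ) : Prop :=
  (∀ ε > 0, IntegrableOn f (Q \ box ε x)) ∧
    ∃ I : ℝ, Tendsto (truncIntegral f Q x) (𝓝[>] 0) (𝓝 I)

/-- The principal value at `x` of the integral of `f` over `Q`
(meaningful when `PVExists f Q x`). -/
def pvIntegral (f : ℝ × ℝ → ℝ) (Q : Set (ℝ × ℝ)) (x : ℝ × ℝ) : ℝ :=
  limUnder (𝓝[>] 0) (truncIntegral f Q x)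

/-- The integrand `((x₁ - y₁)² - (x₂ - y₂)²) / |x - y|⁴ · W(y)`, with `|x - y|` the Euclidean
distance and `W` the odd extension of `ω`. -/
def integrand (ω : ℝ × ℝ → ℝ) (x y : ℝ × ℝ) : ℝ :=
  ((x.1 - y.1) ^ 2 - (x.2 - y.2) ^ 2) / ((x.1 - y.1) ^ 2 + (x.2 - y.2) ^ 2) ^ 2 * oddExt ω y

/-- The localized derivative `u_y(x, a)` of the velocity. -/
def locUy (ω : ℝ × ℝ → ℝ) (x : ℝ × ℝ) (a : ℝ) : ℝ :=
  1 / (2 * π) * pvIntegral (integrand ω x) (box a x) x + ω x / 2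

/-- The localized derivative `v_x(x, a)` of the velocity. -/
def locVx (ω : ℝ × ℝ → ℝ) (x : ℝ × ℝ) (a : ℝ) : ℝ :=
  1 / (2 * π) * pvIntegral (integrand ω x) (box a x) x - ω x / 2

end SharpHolder

end

/-! Translation and scaling reduce the claim to the points (1/2, b) and (-1/2, b) with b > 0, a ≥ 2,
horizontal Hölder constant 1 and vertical constant 0.582. Integrating the regularized kernel
vertically first, `IsHolderPair.regInt_eq` shows that the principal value is an iterated column
integral minus πω(x). This correction cancels the term ω/2 in u_y and doubles the term -ω/2 in v_x.
Hence the increment of u_y is `oddTotal`/π, and that of v_x is `oddTotal`/π minus the increment of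
ω.

To bound `oddTotal`, reflect s to -s. Only the odd part of ω in s survives; it is at most √(2s)/2 in
size, and the two kernels combine into `diffKer` on s > 0. On a fixed column `diffKer` is the
vertical derivative of `gap`, which rises to one peak and then decays to 0. The column integral is
therefore a transport problem: each height t below the peak is paired with the height T above it at
the same level of `gap` (`Unimodal.integral_le`), and only increments of the folded column from t to
T matter. They are paid by vertical Hölder continuity, sharpened by the factor `nest`
(`sqrt_sub_le_nest`), and by one jump of size at most √(2s) when the pair straddles the wall at
distance H = min b a, where the odd extension changes sign or the square ends (`foldCol_le`,
`col_add_saving_le`).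

Integrating the column costs over all s with Tonelli turns them into row integrals with elementary
primitives (`lintegral_row_nest`, `lintegral_wall`, `lintegral_colCost_le`). What is left is an
inequality in H alone: `totalCost H` ≤ 1.538π (`totalCost_le_all`), which gives the constant for
u_y.

For v_x the sum 1.538 + 1 slightly exceeds 2.53, and `IsHolderPair.oddTotal_sub_le` recovers the
difference. If the wall is near, the cost is at most 1.53π. If ω changes by at least -0.99 between
the two points, the sum is already small enough. Otherwise the columns near s = 1/2 start so low
that they cannot drop by the full allowance, and this saves 0.0264 (`col_add_gain_le`).

The Hölder bounds on D are used on the rectangle seen by the two squares, from which ω extends to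
the plane by clamping the coordinates. Other values of τ follow from 0.582 by enlarging the
constants by max(1, τ/0.582). -/

noncomputable section

namespace SharpHolder

/-! ### The difference kernel and its primitives. -/

/-- The product of the squared distances of `(s, t)` to `(±1/2, 0)`. -/
def quart (s t : ℝ) : ℝ := ((s - 1 / 2) ^ 2 + t ^ 2) * ((s + 1 / 2) ^ 2 + t ^ 2)

/-- The vertical primitive of the difference kernel `diffKer`. -/
def gap (s t : ℝ) : ℝ := 2 * s * t / quart s t

/-- The difference of the kernels centred at `(1/2, 0)` and `(-1/2, 0)`. -/
def diffKer (s t : ℝ) : ℝ :=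
  2 * s * ((s ^ 2 - 1 / 4 - t ^ 2) ^ 2 - t ^ 2 * (1 + 4 * t ^ 2)) / quart s t ^ 2

/-- The horizontal primitive of `-diffKer`. -/
def horPrim (t s : ℝ) : ℝ := (s ^ 2 - 1 / 4 - t ^ 2) / quart s t

/-- The single kernel `(s² - t²) / (s² + t²)²`. -/
def ker (s t : ℝ) : ℝ := (s ^ 2 - t ^ 2) / (s ^ 2 + t ^ 2) ^ 2

/-- With Y = s² - 1/4 + t² the denominator is Y² + t², which is why row integrals have elementary
primitives in Y. -/
lemma quart_eq (s t : ℝ) : quart s t = (s ^ 2 - 1 / 4 + t ^ 2) ^ 2 + t ^ 2 := by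
  unfold quart; ring

lemma quart_pos_of_ne {s t : ℝ} (ht : t ≠ 0) : 0 < quart s t := by
  unfold quart; positivity

lemma quart_pos_of_half {s t : ℝ} (hs : 0 < s) (hs' : s ≠ 1 / 2) : 0 < quart s t := by
  have h1 : s - 1 / 2 ≠ 0 := sub_ne_zero.2 hs'
  unfold quart; positivity

lemma quart_nonneg (s t : ℝ) : 0 ≤ quart s t := by unfold quart; positivity

lemma hasDerivAt_gap {s t : ℝ} (h : quart s t ≠ 0) :
    HasDerivAt (fun t => gap s t) (diffKer s t) t := by
  have h1 : HasDerivAt (fun t : ℝ => quart s t)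
      (2 * t * ((s + 1 / 2) ^ 2 + t ^ 2) + ((s - 1 / 2) ^ 2 + t ^ 2) * (2 * t)) t := by
    have h2 : HasDerivAt (fun t : ℝ => t ^ 2) (2 * t) t := by
      simpa using hasDerivAt_pow 2 t
    exact (h2.const_add _).mul (h2.const_add _)
  have h3 := ((hasDerivAt_id t).const_mul (2 * s)).div h1 h
  refine h3.congr_deriv ?_
  simp only [diffKer, id]
  congr 1
  unfold quart; ring

lemma hasDerivAt_horPrim {s t : ℝ} (h : quart s t ≠ 0) :
    HasDerivAt (horPrim t) (-diffKer s t) s := by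
  have h2 : HasDerivAt (fun s : ℝ => s ^ 2) (2 * s) s := by
    simpa using hasDerivAt_pow 2 s
  have h1 : HasDerivAt (fun s : ℝ => quart s t)
      (2 * (s ^ 2 - 1 / 4 + t ^ 2) * (2 * s)) s := by
    have h4 : HasDerivAt (fun s : ℝ => (s ^ 2 - 1 / 4 + t ^ 2) ^ 2 + t ^ 2)
        (2 * (s ^ 2 - 1 / 4 + t ^ 2) * (2 * s)) s := by
      refine ((((h2.sub_const (1 / 4)).add_const (t ^ 2)).pow 2).add_const (t ^ 2)).congr_deriv ?_
      simp
    refine h4.congr_of_eventuallyEq (Eventually.of_forall fun x => quart_eq x t)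
  have h3 := ((h2.sub_const (1 / 4)).sub_const (t ^ 2)).div h1 h
  refine h3.congr_deriv ?_
  simp only [diffKer]
  rw [neg_div' , div_left_inj' (pow_ne_zero 2 h)]
  rw [quart_eq]; ring

lemma diffKer_eq_ker {s t : ℝ} (h : quart s t ≠ 0) :
    diffKer s t = ker (s - 1 / 2) t - ker (s + 1 / 2) t := by
  have h1 : (s - 1 / 2) ^ 2 + t ^ 2 ≠ 0 := left_ne_zero_of_mul h
  have h2 : (s + 1 / 2) ^ 2 + t ^ 2 ≠ 0 := right_ne_zero_of_mul h
  unfold diffKer ker quart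
  rw [div_sub_div _ _ (pow_ne_zero 2 h1) (pow_ne_zero 2 h2), mul_pow]
  congr 1
  ring

lemma measurable_diffKer : Measurable (fun p : ℝ × ℝ => diffKer p.1 p.2) := by
  unfold diffKer quart; fun_prop

lemma measurable_gap : Measurable (fun p : ℝ × ℝ => gap p.1 p.2) := by
  unfold gap quart; fun_prop

lemma lintegral_Ioo_deriv {F f : ℝ → ℝ} {a b : ℝ} (hab : a ≤ b)
    (hF : ∀ x ∈ Icc a b, HasDerivAt F (f x) x) (hf : ContinuousOn f (Icc a b))
    (hpos : ∀ x ∈ Ioo a b, 0 ≤ f x) :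
    ∫⁻ x in Ioo a b, ENNReal.ofReal (f x) = ENNReal.ofReal (F b - F a) := by
  have hi : IntervalIntegrable f volume a b := by
    apply ContinuousOn.intervalIntegrable; rwa [uIcc_of_le hab]
  rw [← intervalIntegral.integral_eq_sub_of_hasDerivAt (by rwa [uIcc_of_le hab]) hi,
    intervalIntegral.integral_of_le hab, integral_Ioc_eq_integral_Ioo,
    ofReal_integral_eq_lintegral_ofReal]
  · exact ((intervalIntegrable_iff_integrableOn_Ioc_of_le hab).1 hi).mono_set Ioo_subset_Ioc_self
  · exact (ae_restrict_iff' measurableSet_Ioo).2 (Eventually.of_forall hpos)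

lemma lintegral_Ioi_deriv {F f : ℝ → ℝ} {a l : ℝ}
    (hF : ∀ x ∈ Ici a, HasDerivAt F (f x) x)
    (hpos : ∀ x ∈ Ioi a, 0 ≤ f x) (hl : Tendsto F atTop (𝓝 l)) :
    ∫⁻ x in Ioi a, ENNReal.ofReal (f x) = ENNReal.ofReal (l - F a) := by
  rw [← integral_Ioi_of_hasDerivAt_of_nonneg' hF hpos hl, ofReal_integral_eq_lintegral_ofReal]
  · exact integrableOn_Ioi_deriv_of_nonneg' hF hpos hl
  · exact (ae_restrict_iff' measurableSet_Ioi).2 (Eventually.of_forall hpos)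

/-! ### Sign pattern and masses of the rows of the difference kernel. -/

/-- The right end of the interval on which `diffKer · t` is negative. -/
def rightZero (t : ℝ) : ℝ := √(1 / 4 + t ^ 2 + t * √(1 + 4 * t ^ 2))

/-- The left end of the interval in `(0, ∞)` on which `diffKer · t` is negative. -/
def leftZero (t : ℝ) : ℝ := √(1 / 4 + t ^ 2 - t * √(1 + 4 * t ^ 2))

lemma sq_sqrt_w (t : ℝ) : √(1 + 4 * t ^ 2) ^ 2 = 1 + 4 * t ^ 2 := sq_sqrt (by positivity)

lemma rightZero_sq {t : ℝ} (ht : 0 < t) :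
    rightZero t ^ 2 = 1 / 4 + t ^ 2 + t * √(1 + 4 * t ^ 2) :=
  sq_sqrt (by positivity)

lemma leftZero_nonneg (t : ℝ) : 0 ≤ leftZero t := sqrt_nonneg _

lemma leftZero_lt_rightZero {t : ℝ} (ht : 0 < t) : leftZero t < rightZero t := by
  apply sqrt_lt_sqrt_iff_of_pos (by positivity) |>.2
  have : 0 < t * √(1 + 4 * t ^ 2) := by positivity
  linarith

/-- The numerator of `diffKer` is quadratic in s², and its roots are the radicands of `leftZero` and
`rightZero`; the kernel is negative exactly between them. -/
lemma diffKer_num (s t : ℝ) :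
    (s ^ 2 - 1 / 4 - t ^ 2) ^ 2 - t ^ 2 * (1 + 4 * t ^ 2) =
      (s ^ 2 - (1 / 4 + t ^ 2 - t * √(1 + 4 * t ^ 2))) *
        (s ^ 2 - (1 / 4 + t ^ 2 + t * √(1 + 4 * t ^ 2))) := by
  linear_combination t ^ 2 * sq_sqrt_w t

lemma diffKer_nonpos {s t : ℝ} (ht : 0 < t) (h1 : leftZero t ≤ s) (h2 : s ≤ rightZero t) :
    diffKer s t ≤ 0 := by
  have hs : 0 ≤ s := (leftZero_nonneg t).trans h1
  have h3 : s ^ 2 ≤ 1 / 4 + t ^ 2 + t * √(1 + 4 * t ^ 2) := by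
    rw [← rightZero_sq ht]; gcongr
  have h4 : 1 / 4 + t ^ 2 - t * √(1 + 4 * t ^ 2) ≤ s ^ 2 := (sqrt_le_left hs).1 h1
  unfold diffKer
  apply div_nonpos_of_nonpos_of_nonneg _ (by positivity)
  rw [diffKer_num]
  apply mul_nonpos_of_nonneg_of_nonpos (by positivity)
  exact mul_nonpos_of_nonneg_of_nonpos (by linarith) (by linarith)

lemma diffKer_nonneg_of_right {s t : ℝ} (ht : 0 < t) (h : rightZero t ≤ s) :
    0 ≤ diffKer s t := by
  have hs : 0 ≤ s := (sqrt_nonneg _).trans h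
  have h3 : 1 / 4 + t ^ 2 + t * √(1 + 4 * t ^ 2) ≤ s ^ 2 := by
    rw [← rightZero_sq ht]; exact pow_le_pow_left₀ (sqrt_nonneg _) h 2
  have h4 : 0 < t * √(1 + 4 * t ^ 2) := by positivity
  unfold diffKer
  apply div_nonneg _ (by positivity)
  rw [diffKer_num]
  exact mul_nonneg (by positivity) (mul_nonneg (by linarith) (by linarith))

lemma diffKer_nonneg_of_left {s t : ℝ} (ht : 0 < t) (hs : 0 < s) (h : s ≤ leftZero t) :
    0 ≤ diffKer s t := by
  have h3 : s ^ 2 ≤ 1 / 4 + t ^ 2 - t * √(1 + 4 * t ^ 2) := (le_sqrt' hs).1 h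
  have h4 : 0 < t * √(1 + 4 * t ^ 2) := by positivity
  unfold diffKer
  apply div_nonneg _ (by positivity)
  rw [diffKer_num]
  exact mul_nonneg (by positivity) (mul_nonneg_of_nonpos_of_nonpos (by linarith) (by linarith))

lemma continuous_diffKer_left {t : ℝ} (ht : 0 < t) : Continuous fun s => diffKer s t := by
  unfold diffKer
  refine Continuous.div (by fun_prop) (by unfold quart; fun_prop)
    fun s => pow_ne_zero 2 (quart_pos_of_ne ht.ne').ne'

/-- Integrating a function with the sign of `-diffKer · t` through its primitive. -/
lemma lintegral_row {F f g : ℝ → ℝ} {t : ℝ} (ht : 0 < t) (hF : ∀ s, HasDerivAt F (f s) s)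
    (hfg : ∀ s, f s = -diffKer s t * g s) (hg : ∀ s, 0 ≤ g s) (hc : Continuous f) :
    ∫⁻ s in Ioi 0, ENNReal.ofReal (f s) =
      ENNReal.ofReal (F (rightZero t) - F (leftZero t)) := by
  have h0 := leftZero_nonneg t
  have hlt := leftZero_lt_rightZero ht
  rw [← lintegral_Ioo_deriv hlt.le (fun x _ => hF x) hc.continuousOn]
  · symm
    rw [← lintegral_indicator measurableSet_Ioo, ← lintegral_indicator measurableSet_Ioi]
    congr 1
    ext s
    by_cases h1 : s ∈ Ioo (leftZero t) (rightZero t)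
    · have : s ∈ Ioi (0 : ℝ) := lt_of_le_of_lt h0 h1.1
      simp [h1, this]
    · rw [indicator_of_notMem h1]
      by_cases h2 : s ∈ Ioi (0 : ℝ)
      · rw [indicator_of_mem h2]
        symm
        apply ENNReal.ofReal_of_nonpos
        rw [hfg]
        apply mul_nonpos_of_nonpos_of_nonneg _ (hg s)
        rw [neg_nonpos]
        rcases le_or_gt s (leftZero t) with h3 | h3
        · exact diffKer_nonneg_of_left ht h2 h3
        · exact diffKer_nonneg_of_right ht (not_lt.1 fun h4 => h1 ⟨h3, h4⟩)
      · rw [indicator_of_notMem h2]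
  · intro s hs
    rw [hfg]
    exact mul_nonneg (neg_nonneg.2 (diffKer_nonpos ht hs.1.le hs.2.le)) (hg s)

lemma tendsto_horPrim {t : ℝ} : Tendsto (horPrim t) atTop (𝓝 0) := by
  have h1 : ∀ᶠ s : ℝ in atTop, ‖horPrim t s‖ ≤ 1 / s := by
    filter_upwards [eventually_gt_atTop (2 + t ^ 2)] with s hs
    have ht := sq_nonneg t
    have hs0 : 0 < s := by linarith
    have hx : 0 < s ^ 2 - 1 / 4 - t ^ 2 := by nlinarith
    have hq : 0 < quart s t := quart_pos_of_half hs0 (by linarith)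
    rw [horPrim, norm_div, norm_of_nonneg hx.le, norm_of_nonneg hq.le, div_le_div_iff₀ hq hs0,
      one_mul, quart_eq]
    have h2 : (s ^ 2 - 1 / 4 - t ^ 2) ≤ (s ^ 2 - 1 / 4 + t ^ 2) := by linarith
    have h3 : s ≤ (s ^ 2 - 1 / 4 + t ^ 2) := by nlinarith
    nlinarith [mul_le_mul h2 h3 hs0.le (by linarith)]
  exact squeeze_zero_norm' h1 (tendsto_const_nhds.div_atTop tendsto_id)

/-- The integral of the negative part of `diffKer · t` over `(0, ∞)`. -/
def rowNeg (t : ℝ) : ℝ := horPrim t (rightZero t) - horPrim t (leftZero t)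

lemma lintegral_rowNeg {t : ℝ} (ht : 0 < t) :
    ∫⁻ s in Ioi 0, ENNReal.ofReal (-diffKer s t) = ENNReal.ofReal (rowNeg t) :=
  lintegral_row (g := fun _ => 1) ht
    (fun _ => hasDerivAt_horPrim (quart_pos_of_ne ht.ne').ne') (by simp) (by simp)
    (continuous_diffKer_left ht).neg

/-- The signed mass of the row over (0, ∞) is `horPrim t 0` = -1/(1/4 + t²), so the positive part is
the negative part minus this amount. -/
lemma lintegral_rowPos_le {t : ℝ} (ht : 0 < t) :
    ∫⁻ s in Ioi 0, ENNReal.ofReal (diffKer s t) ≤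
      ENNReal.ofReal (rowNeg t - 1 / (1 / 4 + t ^ 2)) := by
  have h0 := leftZero_nonneg t
  have hd : ∀ s, HasDerivAt (fun s => -horPrim t s) (diffKer s t) s := fun s =>
    ((hasDerivAt_horPrim (quart_pos_of_ne ht.ne').ne').neg).congr_deriv (neg_neg _)
  have hlt := leftZero_lt_rightZero ht
  have h1 : ∫⁻ s in Ioo 0 (leftZero t), ENNReal.ofReal (diffKer s t) =
      ENNReal.ofReal (-horPrim t (leftZero t) - -horPrim t 0) :=
    lintegral_Ioo_deriv h0 (fun x _ => hd x) (continuous_diffKer_left ht).continuousOn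
      fun s hs => diffKer_nonneg_of_left ht hs.1 hs.2.le
  have h2 : ∫⁻ s in Ioi (rightZero t), ENNReal.ofReal (diffKer s t) =
      ENNReal.ofReal (0 - -horPrim t (rightZero t)) :=
    lintegral_Ioi_deriv (fun x _ => hd x) (fun s hs => diffKer_nonneg_of_right ht (le_of_lt hs))
      (by simpa using (tendsto_horPrim (t := t)).neg)
  have h3 : 0 ≤ -horPrim t (leftZero t) - -horPrim t 0 := by
    have := antitoneOn_of_deriv_nonpos (convex_Icc 0 (leftZero t)) (f := horPrim t)
      (fun x _ => (hasDerivAt_horPrim (quart_pos_of_ne ht.ne').ne').continuousAt.continuousWithinAt)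
      (fun x _ => (hasDerivAt_horPrim
        (quart_pos_of_ne ht.ne').ne').differentiableAt.differentiableWithinAt)
      (fun x hx => by
        rw [interior_Icc] at hx
        rw [(hasDerivAt_horPrim (quart_pos_of_ne ht.ne').ne').deriv]
        exact neg_nonpos.2 (diffKer_nonneg_of_left ht hx.1 hx.2.le))
      (left_mem_Icc.2 h0) (right_mem_Icc.2 h0) h0
    linarith
  have h4 : 0 ≤ 0 - -horPrim t (rightZero t) := by
    have hh : 0 ≤ rightZero t ^ 2 - 1 / 4 - t ^ 2 := by
      rw [rightZero_sq ht]
      have : 0 < t * √(1 + 4 * t ^ 2) := by positivity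
      linarith
    simp only [zero_sub, neg_neg]
    exact div_nonneg hh (quart_nonneg _ _)
  have h5 : rowNeg t - 1 / (1 / 4 + t ^ 2) =
      (-horPrim t (leftZero t) - -horPrim t 0) + (0 - -horPrim t (rightZero t)) := by
    have : horPrim t 0 = -(1 / (1 / 4 + t ^ 2)) := by
      unfold horPrim quart
      field_simp
      ring
    rw [this, rowNeg]; ring
  rw [h5, ENNReal.ofReal_add h3 h4, ← h1, ← h2,
    ← lintegral_indicator measurableSet_Ioo, ← lintegral_indicator measurableSet_Ioi,
    ← lintegral_indicator measurableSet_Ioi, ← lintegral_add_left]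
  · apply lintegral_mono
    intro s
    beta_reduce
    by_cases hs : s ∈ Ioi (0 : ℝ)
    · rw [indicator_of_mem hs]
      by_cases ha : s < leftZero t
      · rw [indicator_of_mem (show s ∈ Ioo 0 (leftZero t) from ⟨hs, ha⟩)]
        exact le_self_add
      by_cases hb : rightZero t < s
      · rw [indicator_of_mem (show s ∈ Ioi (rightZero t) from hb)]
        exact le_add_self
      · rw [ENNReal.ofReal_of_nonpos (diffKer_nonpos ht (not_lt.1 ha) (not_lt.1 hb))]
        exact zero_le
    · rw [indicator_of_notMem hs]; exact zero_le
  · exact ((continuous_diffKer_left ht).measurable.ennreal_ofReal).indicator measurableSet_Ioo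

lemma horPrim_rightZero {t : ℝ} (ht : 0 < t) :
    horPrim t (rightZero t) = (√(1 + 4 * t ^ 2) - 2 * t) / (2 * t) := by
  have hw := sq_sqrt_w t
  have hw0 : 0 < √(1 + 4 * t ^ 2) := by positivity
  have hq := (quart_pos_of_ne (s := rightZero t) ht.ne').ne'
  rw [horPrim, div_eq_div_iff hq (by positivity), quart_eq, rightZero_sq ht]
  generalize √(1 + 4 * t ^ 2) = w at *
  linear_combination (-2 * t ^ 2 * w - t ^ 2 * w + 2 * t ^ 2 * w - 2 * t ^ 3) * hw

/-- At t² = 1/12 one has 1/4 + t² = t√(1 + 4t²), so the left zero reaches s = 0. Below this height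
the row has two genuine sign changes, above it only one. -/
lemma horPrim_leftZero_of_small {t : ℝ} (ht : 0 < t) (h : 12 * t ^ 2 ≤ 1) :
    horPrim t (leftZero t) = -(√(1 + 4 * t ^ 2) + 2 * t) / (2 * t) := by
  have hw := sq_sqrt_w t
  have hw0 : 0 < √(1 + 4 * t ^ 2) := by positivity
  have hq := (quart_pos_of_ne (s := leftZero t) ht.ne').ne'
  have hs : leftZero t ^ 2 = 1 / 4 + t ^ 2 - t * √(1 + 4 * t ^ 2) := by
    apply sq_sqrt
    rw [sub_nonneg]
    apply abs_le_of_sq_le_sq' _ (by positivity) |>.2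
    rw [mul_pow, hw]
    nlinarith [mul_nonneg (sub_nonneg.2 h) (sq_nonneg t)]
  rw [horPrim, div_eq_div_iff hq (by positivity), quart_eq, hs]
  generalize √(1 + 4 * t ^ 2) = w at *
  linear_combination (2 * t ^ 2 * w + t ^ 2 * w - 2 * t ^ 2 * w - 2 * t ^ 3) * hw

lemma leftZero_of_large {t : ℝ} (ht : 0 < t) (h : 1 ≤ 12 * t ^ 2) : leftZero t = 0 := by
  apply sqrt_eq_zero_of_nonpos
  rw [sub_nonpos]
  apply abs_le_of_sq_le_sq' _ (by positivity) |>.2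
  rw [mul_pow, sq_sqrt_w]
  nlinarith [mul_nonneg (sub_nonneg.2 h) (sq_nonneg t)]

lemma horPrim_zero (t : ℝ) : horPrim t 0 = -(1 / (1 / 4 + t ^ 2)) := by
  unfold horPrim quart
  field_simp
  ring

lemma rowNeg_of_small {t : ℝ} (ht : 0 < t) (h : 12 * t ^ 2 ≤ 1) :
    rowNeg t = √(1 + 4 * t ^ 2) / t := by
  rw [rowNeg, horPrim_rightZero ht, horPrim_leftZero_of_small ht h]
  field_simp
  ring

lemma rowNeg_of_large {t : ℝ} (ht : 0 < t) (h : 1 ≤ 12 * t ^ 2) :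
    rowNeg t = (√(1 + 4 * t ^ 2) - 2 * t) / (2 * t) + 1 / (1 / 4 + t ^ 2) := by
  rw [rowNeg, horPrim_rightZero ht, leftZero_of_large ht h, horPrim_zero, sub_neg_eq_add]

/-! ### Rows weighted by the nesting factor. -/

/-- Primitive (in `Y = s² - 1/4 + t²`) of the square-weighted row density. -/
def weightPrim (t Y : ℝ) : ℝ :=
  (1 + t ^ 2) / 2 * (Y + Y ^ 2 - t ^ 2) / (Y ^ 2 + t ^ 2) +
    ((1 - t ^ 2) / 4 * Y * (Y ^ 2 - t ^ 2) + (t ^ 2 - 2) * t ^ 2 * Y ^ 2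
      - t ^ 2 * Y * (Y ^ 2 - t ^ 2)) / (Y ^ 2 + t ^ 2) ^ 2
    - (1 + 3 * t ^ 2) / (4 * t) * arctan (Y / t)

lemma hasDerivAt_weightPrim {t : ℝ} (ht : 0 < t) (Y : ℝ) :
    HasDerivAt (weightPrim t) ((t ^ 2 * (1 + 4 * t ^ 2) - (Y - 2 * t ^ 2) ^ 2) * (Y - t ^ 2) ^ 2 /
      (Y ^ 2 + t ^ 2) ^ 3) Y := by
  have h2 : HasDerivAt (fun Y : ℝ => Y ^ 2) (2 * Y) Y := by simpa using hasDerivAt_pow 2 Y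
  have hY := hasDerivAt_id' Y
  have hQ : Y ^ 2 + t ^ 2 ≠ 0 := by positivity
  have hQd := h2.add_const (t ^ 2)
  have a1 := (((hY.add h2).sub_const (t ^ 2)).const_mul ((1 + t ^ 2) / 2)).div hQd hQ
  have a2 := ((((hY.const_mul ((1 - t ^ 2) / 4)).mul (h2.sub_const (t ^ 2))).add
    (h2.const_mul ((t ^ 2 - 2) * t ^ 2))).sub ((hY.const_mul (t ^ 2)).mul
      (h2.sub_const (t ^ 2)))).div (hQd.pow 2) (pow_ne_zero 2 hQ)
  have a3 := ((hY.div_const t).arctan).const_mul ((1 + 3 * t ^ 2) / (4 * t))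
  refine (((a1.add a2).sub a3).congr_deriv ?_).congr_of_eventuallyEq
    (Eventually.of_forall fun x => ?_)
  · have h5 : 1 + (Y / t) ^ 2 = (Y ^ 2 + t ^ 2) / t ^ 2 := by field_simp; ring
    rw [h5]
    simp only [Pi.add_apply, Pi.mul_apply, Pi.sub_apply, Pi.pow_apply]
    field_simp
    ring
  · simp only [weightPrim, Pi.add_apply, Pi.mul_apply, Pi.sub_apply, Pi.div_apply, Pi.pow_apply]

/-- The ratio `√((T - t) / T)` for nested points of the column `s` is at most this. -/
def nest (s t : ℝ) : ℝ := √(1 - (s ^ 2 - 1 / 4) ^ 2 / quart s t)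

lemma nest_sq_arg_nonneg (s : ℝ) {t : ℝ} (ht : 0 < t) :
    0 ≤ 1 - (s ^ 2 - 1 / 4) ^ 2 / quart s t := by
  rw [sub_nonneg, div_le_one (quart_pos_of_ne ht.ne')]
  unfold quart
  nlinarith [sq_nonneg (s * t), sq_nonneg t, sq_nonneg (t ^ 2), sq_nonneg s]

/-- AM-GM replaces the square root by a tangent line with free parameter c; the weight becomes
rational and the weighted row integrable in closed form. -/
lemma nest_le {s t : ℝ} (ht : 0 < t) {c : ℝ} (hc : 0 < c) :
    nest s t ≤ c / 2 + (1 - (s ^ 2 - 1 / 4) ^ 2 / quart s t) / (2 * c) := by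
  have h := nest_sq_arg_nonneg s ht
  set u := 1 - (s ^ 2 - 1 / 4) ^ 2 / quart s t with hu
  have h1 : nest s t ^ 2 = u := sq_sqrt h
  have h2 : c / 2 + u / (2 * c) - nest s t = (c - nest s t) ^ 2 / (2 * c) := by
    rw [← h1]; field_simp; ring
  have h3 : 0 ≤ (c - nest s t) ^ 2 / (2 * c) := by positivity
  linarith

/-- Integrating the tangent-line majorant gives (c/2 + 1/(2c)) `rowNeg t` minus 1/(2c) times the
increment of `weightPrim`. The hypothesis is precisely the condition that this is at most c `rowNeg
t`. -/
lemma lintegral_row_nest_le {t c : ℝ} (ht : 0 < t) (hc : 0 < c)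
    (h : (1 - c ^ 2) * rowNeg t ≤ weightPrim t (rightZero t ^ 2 - 1 / 4 + t ^ 2) -
      weightPrim t (leftZero t ^ 2 - 1 / 4 + t ^ 2)) :
    ∫⁻ s in Ioi 0, ENNReal.ofReal (-diffKer s t * nest s t) ≤ ENNReal.ofReal (c * rowNeg t) := by
  set g : ℝ → ℝ := fun s => c / 2 + (1 - (s ^ 2 - 1 / 4) ^ 2 / quart s t) / (2 * c) with hg
  have hq : ∀ s, quart s t ≠ 0 := fun s => (quart_pos_of_ne ht.ne').ne'
  have hg0 : ∀ s, 0 ≤ g s := fun s => (sqrt_nonneg _).trans (nest_le ht hc)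
  have h1 : ∫⁻ s in Ioi 0, ENNReal.ofReal (-diffKer s t * nest s t) ≤
      ∫⁻ s in Ioi 0, ENNReal.ofReal (-diffKer s t * g s) := by
    apply lintegral_mono
    intro s
    rcases le_or_gt 0 (-diffKer s t) with h2 | h2
    · exact ENNReal.ofReal_le_ofReal (mul_le_mul_of_nonneg_left (nest_le ht hc) h2)
    · beta_reduce
      rw [ENNReal.ofReal_of_nonpos (mul_nonpos_of_nonpos_of_nonneg h2.le
        (show 0 ≤ nest s t from sqrt_nonneg _))]
      exact zero_le
  refine h1.trans ?_
  have hd : ∀ s, HasDerivAt (fun s => (c / 2 + 1 / (2 * c)) * horPrim t s -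
      1 / (2 * c) * weightPrim t (s ^ 2 - 1 / 4 + t ^ 2)) (-diffKer s t * g s) s := by
    intro s
    have h2 : HasDerivAt (fun s : ℝ => s ^ 2 - 1 / 4 + t ^ 2) (2 * s) s := by
      have h3 : HasDerivAt (fun s : ℝ => s ^ 2) (2 * s) s := by simpa using hasDerivAt_pow 2 s
      exact (h3.sub_const _).add_const _
    have h3 := (hasDerivAt_weightPrim ht (s ^ 2 - 1 / 4 + t ^ 2)).comp s h2
    refine (((hasDerivAt_horPrim (hq s)).const_mul (c / 2 + 1 / (2 * c))).sub
      (h3.const_mul (1 / (2 * c)))).congr_deriv ?_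
    have hq' := hq s
    simp only [hg, diffKer]
    rw [quart_eq] at *
    field_simp
    ring
  rw [lintegral_row ht hd (g := g) (fun s => rfl) hg0]
  · apply ENNReal.ofReal_le_ofReal
    have h4 : rowNeg t = horPrim t (rightZero t) - horPrim t (leftZero t) := rfl
    have h5 : c * rowNeg t - ((c / 2 + 1 / (2 * c)) * horPrim t (rightZero t) -
        1 / (2 * c) * weightPrim t (rightZero t ^ 2 - 1 / 4 + t ^ 2) -
        ((c / 2 + 1 / (2 * c)) * horPrim t (leftZero t) -
        1 / (2 * c) * weightPrim t (leftZero t ^ 2 - 1 / 4 + t ^ 2))) =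
        (weightPrim t (rightZero t ^ 2 - 1 / 4 + t ^ 2) -
      weightPrim t (leftZero t ^ 2 - 1 / 4 + t ^ 2) - (1 - c ^ 2) * rowNeg t) / (2 * c) := by
      rw [h4]; field_simp; ring
    have h6 : 0 ≤ (weightPrim t (rightZero t ^ 2 - 1 / 4 + t ^ 2) -
      weightPrim t (leftZero t ^ 2 - 1 / 4 + t ^ 2) - (1 - c ^ 2) * rowNeg t) / (2 * c) :=
      div_nonneg (by linarith) (by positivity)
    linarith
  · refine ((continuous_diffKer_left ht).neg).mul ?_
    simp only [hg]
    refine Continuous.add (by fun_prop) (Continuous.div_const ?_ _)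
    exact continuous_const.sub (Continuous.div (by fun_prop) (by unfold quart; fun_prop) hq)

/-- Rational parametrization of the hyperbola w² - (2t)² = 1 by z = w - 2t; it removes the square
root from all row quantities. -/
lemma exists_half_angle {t : ℝ} (ht : 0 < t) : ∃ z : ℝ, 0 < z ∧ z < 1 ∧
    t = (1 - z ^ 2) / (4 * z) ∧ √(1 + 4 * t ^ 2) = (1 + z ^ 2) / (2 * z) := by
  have hw := sq_sqrt_w t
  have h1 : 2 * t < √(1 + 4 * t ^ 2) := by
    apply lt_sqrt_of_sq_lt; nlinarith
  have h2 : √(1 + 4 * t ^ 2) < 1 + 2 * t := by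
    rw [sqrt_lt' (by positivity)]; nlinarith
  refine ⟨√(1 + 4 * t ^ 2) - 2 * t, by linarith, by linarith, ?_, ?_⟩
  · rw [eq_div_iff (by linarith)]; linear_combination hw
  · rw [eq_div_iff (by linarith)]; linear_combination hw

/-- The constant 0.945 is nearly the best possible here: as t tends to 0 the criterion becomes c² ≥
1/2 + π/8, so c must exceed about 0.9448. -/
lemma lintegral_row_nest_small {t : ℝ} (ht : 0 < t) (h : 12 * t ^ 2 ≤ 1) :
    ∫⁻ s in Ioi 0, ENNReal.ofReal (-diffKer s t * nest s t) ≤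
      ENNReal.ofReal (0.945 * rowNeg t) := by
  apply lintegral_row_nest_le ht (by norm_num)
  have hs : leftZero t ^ 2 = 1 / 4 + t ^ 2 - t * √(1 + 4 * t ^ 2) := by
    apply sq_sqrt
    rw [sub_nonneg]
    apply abs_le_of_sq_le_sq' _ (by positivity) |>.2
    rw [mul_pow, sq_sqrt_w]
    nlinarith [mul_nonneg (sub_nonneg.2 h) (sq_nonneg t)]
  rw [rowNeg_of_small ht h, rightZero_sq ht, hs]
  have hkey : (1 + 3 * t ^ 2) * (π / 4) ≤ (1 + t ^ 2 - 2 * (1 - 0.945 ^ 2)) * √(1 + 4 * t ^ 2) := by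
    have h1 : (1 + 3 * t ^ 2) * (π / 4) ≤ (1 + 3 * t ^ 2) * 0.7854 := by
      gcongr; linarith [pi_lt_d4]
    refine h1.trans (abs_le_of_sq_le_sq' ?_ ?_).2
    · rw [mul_pow, mul_pow, sq_sqrt_w]
      have hx := sq_nonneg t
      generalize t ^ 2 = x at *
      nlinarith [mul_nonneg hx hx, mul_nonneg hx (mul_nonneg hx hx)]
    · have := sq_nonneg t
      exact mul_nonneg (by norm_num; linarith) (sqrt_nonneg _)
  obtain ⟨z, hz, hz1, htz, hwz⟩ := exists_half_angle ht
  have e1 : (1 / 4 + t ^ 2 + t * √(1 + 4 * t ^ 2) - 1 / 4 + t ^ 2) = t / z := by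
    rw [hwz, htz]; field_simp; ring
  have e2 : (1 / 4 + t ^ 2 - t * √(1 + 4 * t ^ 2) - 1 / 4 + t ^ 2) = -(t * z) := by
    rw [hwz, htz]; field_simp; ring
  -- In the variable Y the two zeros are t/z and -tz, whose arctangent terms differ by a right
  -- angle.
  have e3 : arctan (t / z / t) - arctan (-(t * z) / t) = π / 2 := by
    have : t / z / t = z⁻¹ := by field_simp
    rw [this, neg_div, mul_div_cancel_left₀ _ ht.ne', arctan_neg, arctan_inv_of_pos hz]; ring
  have e4 : weightPrim t (t / z) - weightPrim t (-(t * z)) =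
      ((1 + t ^ 2) * √(1 + 4 * t ^ 2) - (1 + 3 * t ^ 2) * (π / 4)) / (2 * t) := by
    have e5 : (1 + 3 * t ^ 2) / (4 * t) * arctan (t / z / t) -
      (1 + 3 * t ^ 2) / (4 * t) * arctan (-(t * z) / t) = (1 + 3 * t ^ 2) / (4 * t) * (π / 2) := by
      rw [← e3]; ring
    have e6 : (1 + t ^ 2) / 2 * (t / z + (t / z) ^ 2 - t ^ 2) / ((t / z) ^ 2 + t ^ 2) +
        ((1 - t ^ 2) / 4 * (t / z) * ((t / z) ^ 2 - t ^ 2) + (t ^ 2 - 2) * t ^ 2 * (t / z) ^ 2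
        - t ^ 2 * (t / z) * ((t / z) ^ 2 - t ^ 2)) / ((t / z) ^ 2 + t ^ 2) ^ 2 -
        ((1 + t ^ 2) / 2 * (-(t * z) + (-(t * z)) ^ 2 - t ^ 2) / ((-(t * z)) ^ 2 + t ^ 2) +
        ((1 - t ^ 2) / 4 * (-(t * z)) * ((-(t * z)) ^ 2 - t ^ 2)
          + (t ^ 2 - 2) * t ^ 2 * (-(t * z)) ^ 2
        - t ^ 2 * (-(t * z)) * ((-(t * z)) ^ 2 - t ^ 2)) / ((-(t * z)) ^ 2 + t ^ 2) ^ 2) =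
        (1 + t ^ 2) * √(1 + 4 * t ^ 2) / (2 * t) := by
      have hz2 : (1 - z ^ 2) ≠ 0 := by nlinarith
      have d1 : (t / z) ^ 2 + t ^ 2 = t ^ 2 * (1 + z ^ 2) / z ^ 2 := by field_simp
      have d2 : (-(t * z)) ^ 2 + t ^ 2 = t ^ 2 * (1 + z ^ 2) := by ring
      rw [d1, d2, hwz]
      have hzp : 1 + z ^ 2 ≠ 0 := by positivity
      have h4 : 4 * z * t = 1 - z ^ 2 := by rw [htz]; field_simp
      field_simp
      rw [htz]
      field_simp
      ring
    unfold weightPrim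
    linear_combination e6 - e5
  rw [e1, e2, e4, ← sub_nonneg]
  have : ((1 + t ^ 2) * √(1 + 4 * t ^ 2) - (1 + 3 * t ^ 2) * (π / 4)) / (2 * t) -
      (1 - 0.945 ^ 2) * (√(1 + 4 * t ^ 2) / t) = ((1 + t ^ 2 - 2 * (1 - 0.945 ^ 2)) * √(1 + 4 * t ^ 2)
        - (1 + 3 * t ^ 2) * (π / 4)) / (2 * t) := by
    field_simp; ring
  rw [this]
  exact div_nonneg (by linarith) (by positivity)

/-- The alternating series is cut after a positive term; the error has derivative x¹⁰/(1 + x²) ≥ 0.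
-/
lemma arctan_le_poly {z : ℝ} (hz : 0 ≤ z) :
    arctan z ≤ z - z ^ 3 / 3 + z ^ 5 / 5 - z ^ 7 / 7 + z ^ 9 / 9 := by
  have hd : ∀ x : ℝ, HasDerivAt
      (fun z : ℝ => z - z ^ 3 / 3 + z ^ 5 / 5 - z ^ 7 / 7 + z ^ 9 / 9 - arctan z)
      (x ^ 10 / (1 + x ^ 2)) x := by
    intro x
    have hp : ∀ n : ℕ, HasDerivAt (fun z : ℝ => z ^ n) (n * x ^ (n - 1)) x := fun n =>
      hasDerivAt_pow n x
    refine ((((((hasDerivAt_id' x).sub ((hp 3).div_const 3)).add ((hp 5).div_const 5)).sub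
      ((hp 7).div_const 7)).add ((hp 9).div_const 9)).sub (hasDerivAt_arctan x)).congr_deriv ?_
    push_cast
    field_simp
    ring
  have hm : Monotone (fun z : ℝ => z - z ^ 3 / 3 + z ^ 5 / 5 - z ^ 7 / 7 + z ^ 9 / 9 - arctan z) :=
    monotone_of_hasDerivAt_nonneg hd fun x => by positivity
  have := hm hz
  simp only [arctan_zero] at this
  norm_num at this
  linarith

/-- The argument is the cotangent of 4 arctan z. With 3z² ≤ 1 and the bounds on arctan z, the
complementary angle stays in the range of arctan. -/
lemma arctan_quadruple {z : ℝ} (hz : 0 < z) (h : 3 * z ^ 2 ≤ 1) :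
    arctan (((1 - z ^ 2) / (4 * z)) - z / (1 - z ^ 2)) = π / 2 - 4 * arctan z := by
  have hz1 : z < 1 := by nlinarith
  have h2 : 2 * arctan z = arctan (2 * z / (1 - z ^ 2)) :=
    two_mul_arctan (by linarith) hz1
  have h0 : 0 < arctan z := arctan_pos.2 hz
  have h4 : arctan z < π / 4 := by
    rw [← arctan_one]; exact arctan_strictMono hz1
  symm
  have ht : tan (2 * arctan z) = 2 * z / (1 - z ^ 2) := by rw [h2, tan_arctan]
  have hne : 1 - z ^ 2 ≠ 0 := by nlinarith
  have h5 : tan (π / 2 - 4 * arctan z) = (1 - z ^ 2) / (4 * z) - z / (1 - z ^ 2) := by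
    rw [tan_pi_div_two_sub, show 4 * arctan z = 2 * (2 * arctan z) by ring, tan_two_mul, ht]
    field_simp
    ring
  rw [← h5, arctan_tan (by linarith) (by linarith)]

/-- The function of `x = z²` appearing when comparing the weighted row mass with `rowNeg`. -/
lemma nest_poly_nonneg {x : ℝ} (hx : 0 ≤ x) (h : 3 * x ≤ 1) :
    0 ≤ 190071/500000 - 280509/25000 * x + 356220323/3500000 * x ^ 2 - 38298387/250000 * x ^ 3
      - 213235241/10500000 * x ^ 4 - 20960333/1750000 * x ^ 5 - 11995917/3500000 * x ^ 6
      - 2297/840 * x ^ 7 - 1523/560 * x ^ 8 - 129/80 * x ^ 9 - 169/336 * x ^ 10 - 1/16 * x ^ 11 := by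
  -- Since 3x ≤ 1, all powers beyond the fourth can be absorbed into a single term -25x⁴; the
  -- resulting quartic is then checked on both sides of x = 3/25.
  have hp : ∀ n : ℕ, x ^ (n + 4) ≤ x ^ 4 * (1 / 3) ^ n := fun n => by
    rw [add_comm, pow_add]
    exact mul_le_mul_of_nonneg_left (pow_le_pow_left₀ hx (by linarith) n) (by positivity)
  have h5 := hp 1; have h6 := hp 2; have h7 := hp 3; have h8 := hp 4; have h9 := hp 5
  have h10 := hp 6; have h11 := hp 7
  norm_num at h5 h6 h7 h8 h9 h10 h11
  have key : 0 ≤ 190071/500000 - 280509/25000 * x + 356220323/3500000 * x ^ 2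
      - 38298387/250000 * x ^ 3 - 25 * x ^ 4 := by
    rcases le_total x (3 / 25) with h1 | h1
    · nlinarith [sq_nonneg (1 - 14.75 * x), mul_nonneg (sq_nonneg x) (sub_nonneg.2 h1),
        mul_nonneg (mul_nonneg (sq_nonneg x) hx) (sub_nonneg.2 h1)]
    · have h2 : 0 ≤ 1 / 3 - x := by linarith
      have h3 : 0 ≤ x - 3 / 25 := by linarith
      nlinarith [mul_nonneg h2 h3, mul_nonneg (mul_nonneg h2 h3) hx,
        mul_nonneg (mul_nonneg h2 h3) (sq_nonneg x)]
  nlinarith [pow_nonneg hx 4]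

/-- The left end of the negative interval is now s = 0, and the difference of arctangents is 3
arctan z. Bounding it by a polynomial leaves a rational inequality in z². -/
lemma lintegral_row_nest_large {t : ℝ} (ht : 0 < t) (h : 1 ≤ 12 * t ^ 2) :
    ∫⁻ s in Ioi 0, ENNReal.ofReal (-diffKer s t * nest s t) ≤
      ENNReal.ofReal (0.963 * rowNeg t) := by
  apply lintegral_row_nest_le ht (by norm_num)
  rw [rowNeg_of_large ht h, rightZero_sq ht, leftZero_of_large ht h]
  obtain ⟨z, hz, hz1, htz, hwz⟩ := exists_half_angle ht
  have hz3 : 3 * z ^ 2 ≤ 1 := by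
    have h1 : 12 * t ^ 2 - 1 = (1 - 3 * z ^ 2) * (3 - z ^ 2) / (4 * z ^ 2) := by
      rw [htz]; field_simp; ring
    have h2 : 0 < 3 - z ^ 2 := by nlinarith
    by_contra h4
    have : 12 * t ^ 2 - 1 < 0 := by
      rw [h1]; exact div_neg_of_neg_of_pos (mul_neg_of_neg_of_pos (by linarith) h2) (by positivity)
    linarith
  have hne : 0 < 1 - z ^ 2 := by nlinarith
  have e1 : (1 / 4 + t ^ 2 + t * √(1 + 4 * t ^ 2) - 1 / 4 + t ^ 2) = t / z := by
    rw [hwz, htz]; field_simp; ring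
  have e2 : (0 : ℝ) ^ 2 - 1 / 4 + t ^ 2 = t * (t - z / (1 - z ^ 2)) := by
    rw [htz]; field_simp; ring
  have e3 : arctan (t / z / t) - arctan (t * (t - z / (1 - z ^ 2)) / t) = 3 * arctan z := by
    have h1 : t / z / t = z⁻¹ := by field_simp
    rw [h1, mul_div_cancel_left₀ _ ht.ne', arctan_inv_of_pos hz]
    nth_rewrite 1 [htz]
    rw [arctan_quadruple hz hz3]; ring
  have e5 : (1 + 3 * t ^ 2) / (4 * t) * arctan (t / z / t) -
      (1 + 3 * t ^ 2) / (4 * t) * arctan (t * (t - z / (1 - z ^ 2)) / t) ≤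
      (1 + 3 * t ^ 2) / (4 * t) *
        (3 * (z - z ^ 3 / 3 + z ^ 5 / 5 - z ^ 7 / 7 + z ^ 9 / 9)) := by
    rw [← mul_sub, e3]
    have := arctan_le_poly hz.le
    gcongr
  -- The whole margin of the criterion as a rational function of z; 72631/1000000 is 1 - 0.963².
  have e6 : (1 + t ^ 2) / 2 * (t / z + (t / z) ^ 2 - t ^ 2) / ((t / z) ^ 2 + t ^ 2) +
        ((1 - t ^ 2) / 4 * (t / z) * ((t / z) ^ 2 - t ^ 2) + (t ^ 2 - 2) * t ^ 2 * (t / z) ^ 2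
        - t ^ 2 * (t / z) * ((t / z) ^ 2 - t ^ 2)) / ((t / z) ^ 2 + t ^ 2) ^ 2 -
      ((1 + t ^ 2) / 2 * (t * (t - z / (1 - z ^ 2)) + (t * (t - z / (1 - z ^ 2))) ^ 2 - t ^ 2) /
        ((t * (t - z / (1 - z ^ 2))) ^ 2 + t ^ 2) +
        ((1 - t ^ 2) / 4 * (t * (t - z / (1 - z ^ 2))) * ((t * (t - z / (1 - z ^ 2))) ^ 2 - t ^ 2)
          + (t ^ 2 - 2) * t ^ 2 * (t * (t - z / (1 - z ^ 2))) ^ 2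
        - t ^ 2 * (t * (t - z / (1 - z ^ 2))) * ((t * (t - z / (1 - z ^ 2))) ^ 2 - t ^ 2)) /
          ((t * (t - z / (1 - z ^ 2))) ^ 2 + t ^ 2) ^ 2) -
      (1 + 3 * t ^ 2) / (4 * t) * (3 * (z - z ^ 3 / 3 + z ^ 5 / 5 - z ^ 7 / 7 + z ^ 9 / 9)) -
      72631 / 1000000 * ((√(1 + 4 * t ^ 2) - 2 * t) / (2 * t) + 1 / (1 / 4 + t ^ 2)) =
      z ^ 2 * (190071/500000 - 280509/25000 * z ^ 2 + 356220323/3500000 * (z ^ 2) ^ 2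
      - 38298387/250000 * (z ^ 2) ^ 3
      - 213235241/10500000 * (z ^ 2) ^ 4 - 20960333/1750000 * (z ^ 2) ^ 5
      - 11995917/3500000 * (z ^ 2) ^ 6
      - 2297/840 * (z ^ 2) ^ 7 - 1523/560 * (z ^ 2) ^ 8 - 129/80 * (z ^ 2) ^ 9
      - 169/336 * (z ^ 2) ^ 10 - 1/16 * (z ^ 2) ^ 11) / ((1 - z ^ 2) * (1 + z ^ 2) ^ 6) := by
    have d1 : (t / z) ^ 2 + t ^ 2 = (1 - z ^ 2) ^ 2 * (1 + z ^ 2) / (16 * z ^ 4) := by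
      rw [htz]; field_simp; norm_num
    have d2 : (t * (t - z / (1 - z ^ 2))) ^ 2 + t ^ 2 = (1 + z ^ 2) ^ 4 / (256 * z ^ 4) := by
      rw [htz]; field_simp; ring
    have d3 : (1 / 4 + t ^ 2) = (1 + z ^ 2) ^ 2 / (16 * z ^ 2) := by
      rw [htz]; field_simp; ring
    rw [d1, d2, d3, hwz]
    have d4 : t - z / (1 - z ^ 2) = (1 - 6 * z ^ 2 + z ^ 4) / (4 * z * (1 - z ^ 2)) := by
      rw [htz]; field_simp; ring
    rw [d4, htz]
    have hzp : 1 + z ^ 2 ≠ 0 := by positivity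
    have hne' := hne.ne'
    field_simp
    ring
  rw [e1, e2]
  have e7 := nest_poly_nonneg (sq_nonneg z) hz3
  have e8 : 0 ≤ z ^ 2 * (190071/500000 - 280509/25000 * z ^ 2 + 356220323/3500000 * (z ^ 2) ^ 2
      - 38298387/250000 * (z ^ 2) ^ 3
      - 213235241/10500000 * (z ^ 2) ^ 4 - 20960333/1750000 * (z ^ 2) ^ 5
      - 11995917/3500000 * (z ^ 2) ^ 6
      - 2297/840 * (z ^ 2) ^ 7 - 1523/560 * (z ^ 2) ^ 8 - 129/80 * (z ^ 2) ^ 9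
      - 169/336 * (z ^ 2) ^ 10 - 1/16 * (z ^ 2) ^ 11) / ((1 - z ^ 2) * (1 + z ^ 2) ^ 6) :=
    div_nonneg (mul_nonneg (sq_nonneg z) e7) (mul_nonneg hne.le (by positivity))
  rw [← e6] at e8
  norm_num only [show (1 - 0.963 ^ 2 : ℝ) = 72631 / 1000000 by norm_num]
  unfold weightPrim
  linarith

/-! ### The cost of the jump at the wall. -/

/-- Primitive of `u² / ((u² - p u + c) (u² + p u + c))` when `p² + r² = 4 c`. -/
def quarticPrim (p r c u : ℝ) : ℝ :=
  1 / (4 * p) * log (1 - 2 * p * u / (u ^ 2 + p * u + c)) +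
    1 / (2 * r) * (arctan ((2 * u - p) / r) + arctan ((2 * u + p) / r))

lemma quad_pos {p r c : ℝ} (hr : 0 < r) (h : p ^ 2 + r ^ 2 = 4 * c) (u : ℝ) :
    0 < u ^ 2 + p * u + c := by
  nlinarith [sq_nonneg (u + p / 2), mul_pos hr hr]

lemma hasDerivAt_quarticPrim {p r c : ℝ} (hp : 0 < p) (hr : 0 < r) (h : p ^ 2 + r ^ 2 = 4 * c)
    (u : ℝ) : HasDerivAt (quarticPrim p r c)
      (u ^ 2 / ((u ^ 2 - p * u + c) * (u ^ 2 + p * u + c))) u := by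
  have q1 := quad_pos hr h u
  have q2 : 0 < u ^ 2 - p * u + c := by
    have := quad_pos (p := -p) hr (by rw [neg_sq]; exact h) u
    linarith
  have h2 : HasDerivAt (fun u : ℝ => u ^ 2) (2 * u) u := by simpa using hasDerivAt_pow 2 u
  have hu := hasDerivAt_id' u
  have hq := (h2.add (hu.const_mul p)).add_const c
  have hrat : 1 - 2 * p * u / (u ^ 2 + p * u + c) =
      (u ^ 2 - p * u + c) / (u ^ 2 + p * u + c) := by
    rw [eq_div_iff q1.ne', sub_mul, div_mul_cancel₀ _ q1.ne']; ring
  have hl := ((((hu.const_mul (2 * p)).div hq q1.ne').const_sub 1).log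
    (by simp only [Pi.add_apply, Pi.div_apply]; rw [hrat]; positivity)).const_mul (1 / (4 * p))
  have ha := ((((hu.const_mul 2).sub_const p).div_const r).arctan.add
    (((hu.const_mul 2).add_const p).div_const r).arctan).const_mul (1 / (2 * r))
  refine ((hl.add ha).congr_deriv ?_)
  simp only [Pi.add_apply, Pi.div_apply]
  have e1 : 1 + ((2 * u - p) / r) ^ 2 = 4 * (u ^ 2 - p * u + c) / r ^ 2 := by
    field_simp; linear_combination h
  have e2 : 1 + ((2 * u + p) / r) ^ 2 = 4 * (u ^ 2 + p * u + c) / r ^ 2 := by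
    field_simp; linear_combination h
  rw [e1, e2, hrat]
  clear hl ha hq e1 e2 hrat
  obtain ⟨a, ha⟩ : ∃ a, a = u ^ 2 - p * u + c := ⟨_, rfl⟩
  obtain ⟨b, hb⟩ : ∃ b, b = u ^ 2 + p * u + c := ⟨_, rfl⟩
  rw [← ha, ← hb]
  have q1' : b ≠ 0 := by rw [hb]; exact q1.ne'
  have q2' : a ≠ 0 := by rw [ha]; exact q2.ne'
  field_simp
  rw [ha, hb]
  ring

lemma tendsto_quarticPrim {p r c : ℝ} (hp : 0 < p) (hr : 0 < r) (h : p ^ 2 + r ^ 2 = 4 * c) :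
    Tendsto (quarticPrim p r c) atTop (𝓝 (π / (2 * r))) := by
  have h1 : Tendsto (fun u : ℝ => 2 * p * u / (u ^ 2 + p * u + c)) atTop (𝓝 0) := by
    have hb : ∀ᶠ u : ℝ in atTop, ‖2 * p * u / (u ^ 2 + p * u + c)‖ ≤ 2 * p / u := by
      filter_upwards [eventually_gt_atTop 0] with u hu
      have q1 := quad_pos hr h u
      have hc : 0 < c := by nlinarith [mul_pos hp hp, mul_pos hr hr]
      rw [norm_of_nonneg (by positivity), div_le_div_iff₀ q1 hu]
      nlinarith [mul_pos hp hu, mul_pos (mul_pos hp hu) (mul_pos hp hu), mul_pos hp hc]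
    exact squeeze_zero_norm' hb (tendsto_const_nhds.div_atTop tendsto_id)
  have h2 : Tendsto (fun u : ℝ => log (1 - 2 * p * u / (u ^ 2 + p * u + c))) atTop (𝓝 0) := by
    have := (h1.const_sub 1).log (by norm_num)
    simpa using this
  have ht : Tendsto arctan atTop (𝓝 (π / 2)) := tendsto_arctan_atTop.mono_right nhdsWithin_le_nhds
  have h3 : Tendsto (fun u : ℝ => (2 * u - p) / r) atTop atTop :=
    (tendsto_atTop_add_const_right _ (-p) (tendsto_id.const_mul_atTop two_pos)).atTop_div_const hr
  have h4 : Tendsto (fun u : ℝ => (2 * u + p) / r) atTop atTop :=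
    (tendsto_atTop_add_const_right _ p (tendsto_id.const_mul_atTop two_pos)).atTop_div_const hr
  have h5 := (h2.const_mul (1 / (4 * p))).add
    (((ht.comp h3).add (ht.comp h4)).const_mul (1 / (2 * r)))
  refine (h5.congr fun u => ?_).trans (le_of_eq ?_)
  · simp [quarticPrim, Function.comp]
  · congr 1; field_simp; ring

/-- By partial fractions `gap s H` is H times the difference of 1/((s ∓ 1/2)² + H²). After u = √s
both denominators split into real quadratics with the same c = √(1/4 + H²): the middle coefficients
are ±p for one and ±r for the other, where p² = 2c + 1 and r² = 2c - 1. The limits at infinity give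
π√2(p - r)/2, which equals the bound because (p - r)² = 4(c - H). -/
lemma lintegral_wall {H : ℝ} (hH : 0 < H) :
    ∫⁻ s in Ioi 0, ENNReal.ofReal (√(2 * s) * gap s H) ≤
      ENNReal.ofReal (π * √(2 * (√(1 / 4 + H ^ 2) - H))) := by
  set c := √(1 / 4 + H ^ 2) with hc
  have hc2 : c ^ 2 = 1 / 4 + H ^ 2 := sq_sqrt (by positivity)
  have hcH : H < c := by rw [hc]; apply lt_sqrt_of_sq_lt; linarith
  have hc1 : 1 / 2 < c := by rw [hc]; apply lt_sqrt_of_sq_lt; nlinarith [mul_pos hH hH]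
  set p := √(2 * c + 1) with hp
  set r := √(2 * c - 1) with hr
  have hp2 : p ^ 2 = 2 * c + 1 := sq_sqrt (by linarith)
  have hr2 : r ^ 2 = 2 * c - 1 := sq_sqrt (by linarith)
  have hp0 : 0 < p := sqrt_pos.2 (by linarith)
  have hr0 : 0 < r := sqrt_pos.2 (by linarith)
  have hpr : p * r = 2 * H := by
    rw [hp, hr, ← sqrt_mul (by linarith), sqrt_eq_iff_eq_sq (by nlinarith) (by positivity)]
    nlinarith
  have hrp : r ≤ p := sqrt_le_sqrt (by linarith)
  have h1 : p ^ 2 + r ^ 2 = 4 * c := by linarith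
  have h2 : r ^ 2 + p ^ 2 = 4 * c := by linarith
  set F : ℝ → ℝ := fun s => 2 * √2 * H * (quarticPrim p r c (√s) - quarticPrim r p c (√s)) with hF
  have hd : ∀ s ∈ Ioi (0 : ℝ), HasDerivAt F (√(2 * s) * gap s H) s := by
    intro s hs
    have hs0 : 0 < s := hs
    have hsq : √s ^ 2 = s := sq_sqrt hs0.le
    have hs1 : 0 < √s := sqrt_pos.2 hs0
    have d1 := (((hasDerivAt_quarticPrim hp0 hr0 h1 (√s)).sub
      (hasDerivAt_quarticPrim hr0 hp0 h2 (√s))).comp s (hasDerivAt_sqrt hs0.ne')).const_mul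
        (2 * √2 * H)
    refine d1.congr_deriv ?_
    have e1 : (√s ^ 2 - p * √s + c) * (√s ^ 2 + p * √s + c) = (s - 1 / 2) ^ 2 + H ^ 2 := by
      rw [hsq]; linear_combination hc2 - s * hp2 - p ^ 2 * hsq
    have e2 : (√s ^ 2 - r * √s + c) * (√s ^ 2 + r * √s + c) = (s + 1 / 2) ^ 2 + H ^ 2 := by
      rw [hsq]; linear_combination hc2 - s * hr2 - r ^ 2 * hsq
    rw [e1, e2, sqrt_mul (by norm_num), gap, quart]
    have p1 : 0 < (s - 1 / 2) ^ 2 + H ^ 2 := by positivity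
    have p2 : 0 < (s + 1 / 2) ^ 2 + H ^ 2 := by positivity
    rw [hsq]
    field_simp
    rw [hsq]
    ring
  have hq : ∀ p r c : ℝ, 0 < p → 0 < r → p ^ 2 + r ^ 2 = 4 * c → Continuous (quarticPrim p r c) :=
    fun p r c a b d => continuous_iff_continuousAt.2 fun u =>
      (hasDerivAt_quarticPrim a b d u).continuousAt
  have hcont : ContinuousWithinAt F (Ici 0) 0 := by
    refine Continuous.continuousWithinAt ?_
    have e1 := hq p r c hp0 hr0 h1
    have e2 := hq r p c hr0 hp0 h2
    fun_prop
  have hpos : ∀ s ∈ Ioi (0 : ℝ), 0 ≤ √(2 * s) * gap s H := by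
    intro s hs
    have : (0 : ℝ) < s := hs
    exact mul_nonneg (sqrt_nonneg _) (div_nonneg (by positivity) (quart_nonneg _ _))
  have hlim : Tendsto F atTop (𝓝 (2 * √2 * H * (π / (2 * r) - π / (2 * p)))) := by
    refine Tendsto.const_mul _ ?_
    exact ((tendsto_quarticPrim hp0 hr0 h1).comp tendsto_sqrt_atTop).sub
      ((tendsto_quarticPrim hr0 hp0 h2).comp tendsto_sqrt_atTop)
  have hint := integral_Ioi_of_hasDerivAt_of_nonneg hcont hd hpos hlim
  have hF0 : F 0 = 0 := by
    simp only [hF, quarticPrim, sqrt_zero]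
    simp [neg_div, arctan_neg]
  rw [← ofReal_integral_eq_lintegral_ofReal (integrableOn_Ioi_deriv_of_nonneg hcont hd hpos hlim)
    ((ae_restrict_iff' measurableSet_Ioi).2 (Eventually.of_forall hpos)), hint, hF0]
  apply ENNReal.ofReal_le_ofReal
  have e3 : 2 * √2 * H * (π / (2 * r) - π / (2 * p)) = π * (√2 * (p - r) / 2) := by
    have : π / (2 * r) - π / (2 * p) = π * (p - r) / (2 * (p * r)) := by field_simp
    rw [this, hpr]; field_simp
  rw [sub_zero, e3]
  refine mul_le_mul_of_nonneg_left (le_sqrt_of_sq_le ?_) pi_pos.le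
  have : √2 ^ 2 = (2 : ℝ) := sq_sqrt (by norm_num)
  rw [div_pow, mul_pow, this]
  nlinarith

/-! ### Row masses integrated over large heights. -/

/-- The tangent of half the angle under which the unit segment is seen from height `t`. -/
def halfTan (t : ℝ) : ℝ := √(1 + 4 * t ^ 2) - 2 * t

lemma halfTan_spec {t : ℝ} (ht : 0 < t) : 0 < halfTan t ∧ halfTan t < 1 ∧
    t = (1 - halfTan t ^ 2) / (4 * halfTan t) ∧
    √(1 + 4 * t ^ 2) = (1 + halfTan t ^ 2) / (2 * halfTan t) := by
  obtain ⟨z, hz, hz1, htz, hwz⟩ := exists_half_angle ht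
  have : halfTan t = z := by
    have h1 : 2 * t = (1 - z ^ 2) / (2 * z) := by rw [htz]; field_simp; ring
    rw [halfTan, hwz, h1]; field_simp; ring
  rw [this]; exact ⟨hz, hz1, htz, hwz⟩

lemma halfTan_sq_le {t : ℝ} (ht : 0 < t) (h : 1 ≤ 12 * t ^ 2) : 3 * halfTan t ^ 2 ≤ 1 := by
  obtain ⟨hz, hz1, htz, -⟩ := halfTan_spec ht
  set z := halfTan t
  have h1 : 12 * t ^ 2 - 1 = (1 - 3 * z ^ 2) * (3 - z ^ 2) / (4 * z ^ 2) := by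
    rw [htz]; field_simp; ring
  have h2 : 0 < 3 - z ^ 2 := by nlinarith
  by_contra h4
  have : 12 * t ^ 2 - 1 < 0 := by
    rw [h1]; exact div_neg_of_neg_of_pos (mul_neg_of_neg_of_pos (by linarith) h2) (by positivity)
  linarith

lemma hasDerivAt_halfTan {t : ℝ} (ht : 0 < t) :
    HasDerivAt halfTan (-(4 * halfTan t ^ 2 / (1 + halfTan t ^ 2))) t := by
  obtain ⟨hz, hz1, htz, hwz⟩ := halfTan_spec ht
  have h2 : HasDerivAt (fun u : ℝ => u ^ 2) (2 * t) t := by simpa using hasDerivAt_pow 2 t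
  have h3 := (((h2.const_mul 4).const_add 1).sqrt (by positivity)).sub
    ((hasDerivAt_id' t).const_mul 2)
  refine h3.congr_deriv ?_
  rw [hwz]
  set z := halfTan t
  rw [htz]
  field_simp
  ring

lemma rowNeg_halfTan {t : ℝ} (ht : 0 < t) (h : 1 ≤ 12 * t ^ 2) :
    rowNeg t = 2 * halfTan t ^ 2 / (1 - halfTan t ^ 2) +
      16 * halfTan t ^ 2 / (1 + halfTan t ^ 2) ^ 2 := by
  obtain ⟨hz, hz1, htz, hwz⟩ := halfTan_spec ht
  rw [rowNeg_of_large ht h, hwz]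
  have h0 := halfTan_sq_le ht h
  set z := halfTan t
  have hne : 1 - z ^ 2 ≠ 0 := by nlinarith
  have d3 : (1 / 4 + t ^ 2) = (1 + z ^ 2) ^ 2 / (16 * z ^ 2) := by
    rw [htz]; field_simp; ring
  rw [d3, htz]
  field_simp
  ring

lemma inv_quarter_halfTan {t : ℝ} (ht : 0 < t) :
    1 / (1 / 4 + t ^ 2) = 16 * halfTan t ^ 2 / (1 + halfTan t ^ 2) ^ 2 := by
  obtain ⟨hz, hz1, htz, hwz⟩ := halfTan_spec ht
  set z := halfTan t
  have d3 : (1 / 4 + t ^ 2) = (1 + z ^ 2) ^ 2 / (16 * z ^ 2) := by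
    rw [htz]; field_simp; ring
  rw [d3, one_div_div]

lemma continuousOn_halfTan : Continuous halfTan := by unfold halfTan; fun_prop

lemma tendsto_halfTan : Tendsto halfTan atTop (𝓝 0) := by
  have h1 : ∀ᶠ t : ℝ in atTop, ‖halfTan t‖ ≤ 1 / t := by
    filter_upwards [eventually_gt_atTop 0] with t ht
    obtain ⟨hz, hz1, htz, -⟩ := halfTan_spec ht
    rw [norm_of_nonneg hz.le, le_div_iff₀ ht]
    nth_rewrite 2 [htz]
    field_simp
    nlinarith
  exact squeeze_zero_norm' h1 (tendsto_const_nhds.div_atTop tendsto_id)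

/-- Upper estimate of `∫ₜ^∞ (2 rowNeg - 1/(1/4 + T²)) dT` in terms of `z = halfTan t`. -/
def tailPoly (z : ℝ) : ℝ :=
  5 * z - 2 / 3 * z ^ 3 + 6 / 5 * z ^ 5 - 2 / 7 * z ^ 7 + 53 / 72 * z ^ 9 - 9 / 44 * z ^ 11 +
    9 / 104 * z ^ 13

/-- Upper estimate of `∫ √T rowNeg dT` in terms of `y = √(halfTan t)`. -/
def bulkPoly (y : ℝ) : ℝ := 9 / 2 * y - 21 / 20 * y ^ 5 + 95 / 144 * y ^ 9 - 97 / 325 * y ^ 13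

lemma hasDerivAt_tailPoly (z : ℝ) : HasDerivAt tailPoly
    ((5 - 2 * z ^ 2 + z ^ 4) * (1 + z ^ 4 + 9 / 8 * z ^ 8)) z := by
  have hp : ∀ n : ℕ, HasDerivAt (fun z : ℝ => z ^ n) (n * z ^ (n - 1)) z := fun n =>
    hasDerivAt_pow n z
  refine ((((((((hasDerivAt_id' z).const_mul 5).sub ((hp 3).const_mul (2 / 3))).add
    ((hp 5).const_mul (6 / 5))).sub ((hp 7).const_mul (2 / 7))).add
    ((hp 9).const_mul (53 / 72))).sub ((hp 11).const_mul (9 / 44))).add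
    ((hp 13).const_mul (9 / 104))).congr_deriv ?_
  push_cast
  ring

lemma hasDerivAt_bulkPoly (y : ℝ) : HasDerivAt bulkPoly
    (9 / 2 - 21 / 4 * y ^ 4 + 95 / 16 * y ^ 8 - 97 / 25 * y ^ 12) y := by
  have hp : ∀ n : ℕ, HasDerivAt (fun z : ℝ => z ^ n) (n * y ^ (n - 1)) y := fun n =>
    hasDerivAt_pow n y
  refine (((((hasDerivAt_id' y).const_mul (9 / 2)).sub ((hp 5).const_mul (21 / 20))).add
    ((hp 9).const_mul (95 / 144))).sub ((hp 13).const_mul (97 / 325))).congr_deriv ?_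
  push_cast
  ring

/-- The total row mass beyond: twice the negative part minus the mass of the row. -/
def rowAll (t : ℝ) : ℝ := 2 * rowNeg t - 1 / (1 / 4 + t ^ 2)

/-- With q = z² and z = `halfTan t` as variable, the integrand becomes (5 - 2q + q²)/(1 - q²). Since
q ≤ 1/3, the factor 1/(1 - q²) is at most 1 + q² + (9/8)q⁴, and `tailPoly` is the primitive of the
product. -/
lemma lintegral_rowAll_large {H : ℝ} (hH : 0 < H) (h : 1 ≤ 12 * H ^ 2) :
    ∫⁻ t in Ioi H, ENNReal.ofReal (rowAll t) ≤ ENNReal.ofReal (tailPoly (halfTan H)) := by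
  set f : ℝ → ℝ := fun t => (5 - 2 * halfTan t ^ 2 + halfTan t ^ 4) *
    (1 + halfTan t ^ 4 + 9 / 8 * halfTan t ^ 8) * (4 * halfTan t ^ 2 / (1 + halfTan t ^ 2)) with hf
  have hd : ∀ t ∈ Ici H, HasDerivAt (fun t => -tailPoly (halfTan t)) (f t) t := by
    intro t ht
    have ht0 : 0 < t := lt_of_lt_of_le hH ht
    refine ((hasDerivAt_tailPoly (halfTan t)).comp t (hasDerivAt_halfTan ht0)).neg.congr_deriv ?_
    simp only [hf]; ring
  have h12 : ∀ t ∈ Ioi H, 1 ≤ 12 * t ^ 2 := fun t ht => by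
    have : H < t := ht
    nlinarith
  have hfr : ∀ t ∈ Ioi H, 0 ≤ f t ∧ rowAll t ≤ f t := by
    intro t ht
    have ht0 : 0 < t := lt_trans hH ht
    have hz3 := halfTan_sq_le ht0 (h12 t ht)
    obtain ⟨hz, hz1, -, -⟩ := halfTan_spec ht0
    rw [rowAll, rowNeg_halfTan ht0 (h12 t ht), inv_quarter_halfTan ht0]
    simp only [hf]
    set z := halfTan t
    have hq : 0 ≤ z ^ 2 := sq_nonneg z
    have e4 : z ^ 4 = (z ^ 2) ^ 2 := by ring
    have e8 : z ^ 8 = (z ^ 2) ^ 4 := by ring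
    rw [e4, e8]
    generalize z ^ 2 = q at *
    have h5 : 0 < 5 - 2 * q + q ^ 2 := by nlinarith
    refine ⟨by positivity, ?_⟩
    have hne : 0 < 1 - q := by linarith
    have e : (5 - 2 * q + q ^ 2) * (1 + q ^ 2 + 9 / 8 * q ^ 4) * (4 * q / (1 + q)) -
        (2 * (2 * q / (1 - q) + 16 * q / (1 + q) ^ 2) - 16 * q / (1 + q) ^ 2) =
        4 * q * (5 - 2 * q + q ^ 2) * (q ^ 4 * (1 - 9 * q ^ 2) / 8) / ((1 - q) * (1 + q) ^ 2) := by
      field_simp; ring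
    have h9 : 0 ≤ 1 - 9 * q ^ 2 := by nlinarith
    have : 0 ≤ 4 * q * (5 - 2 * q + q ^ 2) * (q ^ 4 * (1 - 9 * q ^ 2) / 8) /
        ((1 - q) * (1 + q) ^ 2) := by positivity
    linarith
  have hl : Tendsto (fun t => -tailPoly (halfTan t)) atTop (𝓝 0) := by
    have h1 : Tendsto tailPoly (𝓝 0) (𝓝 (tailPoly 0)) :=
      (hasDerivAt_tailPoly 0).continuousAt.tendsto
    have h2 := (h1.comp tendsto_halfTan).neg
    simpa [tailPoly, Function.comp_def] using h2
  have h1 := lintegral_Ioi_deriv hd (fun t ht => (hfr t ht).1) hl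
  rw [zero_sub, neg_neg] at h1
  rw [← h1]
  exact setLIntegral_mono' measurableSet_Ioi fun t ht => ENNReal.ofReal_le_ofReal (hfr t ht).2

lemma lintegral_Ioo_deriv_of_continuousOn {F f : ℝ → ℝ} {a b : ℝ} (hab : a ≤ b)
    (hc : ContinuousOn F (Icc a b)) (hF : ∀ x ∈ Ioo a b, HasDerivAt F (f x) x)
    (hpos : ∀ x ∈ Ioo a b, 0 ≤ f x) :
    ∫⁻ x in Ioo a b, ENNReal.ofReal (f x) = ENNReal.ofReal (F b - F a) := by
  have hi := intervalIntegral.integrableOn_deriv_of_nonneg hc hF hpos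
  rw [← intervalIntegral.integral_eq_sub_of_hasDerivAt_of_le hab hc hF
    ((intervalIntegrable_iff_integrableOn_Ioc_of_le hab).2 hi),
    intervalIntegral.integral_of_le hab, integral_Ioc_eq_integral_Ioo,
    ofReal_integral_eq_lintegral_ofReal]
  · exact hi.mono_set Ioo_subset_Ioc_self
  · exact (ae_restrict_iff' measurableSet_Ioo).2 (Eventually.of_forall hpos)

/-- The cubic majorizes (3 - q)²/(2(1 + q)√(1 - q)), which is √t `rowNeg t` dt in the variable y
with q = y⁴. Its coefficients are those of Taylor up to q²; that of q³ is raised to -97/25 so that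
the bound holds up to q = 1/3. -/
lemma bulk_poly_ineq {q : ℝ} (hq : 0 ≤ q) (h : 3 * q ≤ 1) :
    (3 - q) ^ 2 ≤ 2 * (1 + q) * √(1 - q) * (9 / 2 - 21 / 4 * q + 95 / 16 * q ^ 2 - 97 / 25 * q ^ 3)
    := by
  have hS : √(1 - q) ^ 2 = 1 - q := sq_sqrt (by linarith)
  have hS0 : 0 ≤ √(1 - q) := sqrt_nonneg _
  have h1 : 0 ≤ 9 / 2 - 21 / 4 * q + 95 / 16 * q ^ 2 - 97 / 25 * q ^ 3 := by nlinarith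
  refine (le_abs_self _).trans (abs_le_of_sq_le_sq ?_ (by positivity))
  have h2 : (2 * (1 + q) * √(1 - q) * (9 / 2 - 21 / 4 * q + 95 / 16 * q ^ 2 - 97 / 25 * q ^ 3)) ^ 2
      = 4 * (1 + q) ^ 2 * (1 - q) * (9 / 2 - 21 / 4 * q + 95 / 16 * q ^ 2 - 97 / 25 * q ^ 3) ^ 2 := by
    rw [mul_pow, mul_pow, hS]; ring
  have h3 : 0 ≤ q ^ 3 * ((10989/200) - (353727/1600) * q + (295569/1600) * q ^ 2 -
      (1560121/40000) * q ^ 3 - (2378321/40000) * q ^ 4 + (155103/1250) * q ^ 5 -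
      (37636/625) * q ^ 6) := by
    refine mul_nonneg (by positivity) ?_
    have hq4 : q ^ 4 ≤ 1 / 81 := by
      calc q ^ 4 ≤ (1 / 3) ^ 4 := pow_le_pow_left₀ hq (by linarith) 4
        _ = 1 / 81 := by norm_num
    have hP : 0 ≤ (200176409/3645000) * q ^ 0 + (-547480253/9720000) * q ^ 1 + (12761743/810000) * q ^ 2 + (1784741/216000) * q ^ 3 + (-390037/11250) * q ^ 4 + (37636/1875) * q ^ 5 := by
      nlinarith [sq_nonneg q, pow_nonneg hq 3, pow_nonneg hq 5]
    nlinarith [mul_nonneg (sub_nonneg.2 h) hP]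
  rw [h2]
  nlinarith [h3]

lemma lintegral_bulk_large {a b : ℝ} (ha : 0 < a) (hab : a ≤ b) (h : 1 ≤ 12 * a ^ 2) :
    ∫⁻ t in Ioo a b, ENNReal.ofReal (√t * rowNeg t) ≤
      ENNReal.ofReal (bulkPoly (√(halfTan a)) - bulkPoly (√(halfTan b))) := by
  set y : ℝ → ℝ := fun t => √(halfTan t) with hy
  set f : ℝ → ℝ := fun t => (9 / 2 - 21 / 4 * y t ^ 4 + 95 / 16 * y t ^ 8 - 97 / 25 * y t ^ 12) *
    (2 * y t ^ 3 / (1 + y t ^ 4)) with hf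
  have hd : ∀ t ∈ Icc a b, HasDerivAt (fun t => -bulkPoly (y t)) (f t) t := by
    intro t ht
    have ht0 : 0 < t := lt_of_lt_of_le ha ht.1
    obtain ⟨hz, hz1, -, -⟩ := halfTan_spec ht0
    have hyd := (hasDerivAt_halfTan ht0).sqrt hz.ne'
    refine ((hasDerivAt_bulkPoly (y t)).comp t hyd).neg.congr_deriv ?_
    have hyz : halfTan t = y t ^ 2 := (sq_sqrt hz.le).symm
    have hy0 : 0 < y t := sqrt_pos.2 hz
    simp only [hf]
    have : √(halfTan t) = y t := rfl
    rw [this, hyz]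
    field_simp
    ring
  have hfr : ∀ t ∈ Ioo a b, √t * rowNeg t ≤ f t := by
    intro t ht
    have ht0 : 0 < t := lt_trans ha ht.1
    have h12 : 1 ≤ 12 * t ^ 2 := by nlinarith [ht.1]
    have hz3 := halfTan_sq_le ht0 h12
    obtain ⟨hz, hz1, htz, -⟩ := halfTan_spec ht0
    have hyz : halfTan t = y t ^ 2 := (sq_sqrt hz.le).symm
    have hy0 : 0 < y t := sqrt_pos.2 hz
    have hq : √t = √(1 - y t ^ 4) / (2 * y t) := by
      have h2 : (2 * y t) = √(4 * y t ^ 2) := by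
        rw [show 4 * y t ^ 2 = (2 * y t) ^ 2 by ring, sqrt_sq (by positivity)]
      rw [h2, ← sqrt_div' _ (by positivity)]
      congr 1
      rw [hyz] at htz
      refine htz.trans ?_
      ring
    rw [rowNeg_halfTan ht0 h12, hq, hyz]
    have hq3 : 3 * y t ^ 4 ≤ 1 := by
      rw [hyz] at hz3; linarith [show (y t ^ 2) ^ 2 = y t ^ 4 by ring]
    have key := bulk_poly_ineq (pow_nonneg hy0.le 4) hq3
    simp only [hf]
    set Y := y t
    have hS : √(1 - Y ^ 4) ^ 2 = 1 - Y ^ 4 := sq_sqrt (by linarith)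
    have hS0 : 0 < √(1 - Y ^ 4) := sqrt_pos.2 (by linarith)
    set S := √(1 - Y ^ 4)
    have hne : 0 < 1 - (Y ^ 2) ^ 2 := by linarith [show (Y ^ 2) ^ 2 = Y ^ 4 by ring]
    have e : S / (2 * Y) * (2 * (Y ^ 2) ^ 2 / (1 - (Y ^ 2) ^ 2) +
        16 * (Y ^ 2) ^ 2 / (1 + (Y ^ 2) ^ 2) ^ 2) = Y ^ 3 * (3 - Y ^ 4) ^ 2 / (S * (1 + Y ^ 4) ^ 2) := by
      have e1 : 1 - (Y ^ 2) ^ 2 = S ^ 2 := by rw [hS]; ring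
      rw [e1]
      field_simp
      rw [hS]
      ring
    have e2 : (9 / 2 - 21 / 4 * Y ^ 4 + 95 / 16 * Y ^ 8 - 97 / 25 * Y ^ 12) *
        (2 * Y ^ 3 / (1 + Y ^ 4)) = Y ^ 3 * (2 * (1 + Y ^ 4) * S *
        (9 / 2 - 21 / 4 * Y ^ 4 + 95 / 16 * (Y ^ 4) ^ 2 - 97 / 25 * (Y ^ 4) ^ 3)) /
          (S * (1 + Y ^ 4) ^ 2) := by
      field_simp
    rw [e, e2]
    gcongr
  have hcd : ContinuousOn f (Icc a b) := by
    have hyc : Continuous y := by simp only [hy]; exact continuousOn_halfTan.sqrt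
    simp only [hf]
    refine ContinuousOn.mul (by fun_prop) (ContinuousOn.div (by fun_prop) (by fun_prop) ?_)
    intro t _
    positivity
  have hpos : ∀ t ∈ Ioo a b, 0 ≤ f t := by
    intro t ht
    refine le_trans ?_ (hfr t ht)
    have ht0 : 0 < t := lt_trans ha ht.1
    have h12 : 1 ≤ 12 * t ^ 2 := by nlinarith [ht.1]
    have hz3 := halfTan_sq_le ht0 h12
    rw [rowNeg_halfTan ht0 h12]
    have hne : 0 < 1 - halfTan t ^ 2 := by linarith
    positivity
  have h1 := lintegral_Ioo_deriv hab hd hcd hpos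
  rw [show -bulkPoly (y b) - -bulkPoly (y a) = bulkPoly (y a) - bulkPoly (y b) by ring] at h1
  rw [← h1]
  exact setLIntegral_mono' measurableSet_Ioo fun t ht => ENNReal.ofReal_le_ofReal (hfr t ht)

/-! ### Height integrals across the critical height. -/

/-- The height at which the unit segment is seen under the angle `2π/3`. -/
def critHeight : ℝ := √3 / 6

lemma critHeight_sq : critHeight ^ 2 = 1 / 12 := by
  rw [critHeight, div_pow, sq_sqrt (by norm_num)]; norm_num

lemma critHeight_pos : 0 < critHeight := by unfold critHeight; positivity

lemma critHeight_bounds : 0.288675 < critHeight ∧ critHeight < 0.288676 := by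
  have h := critHeight_sq
  have h0 := critHeight_pos
  constructor <;> nlinarith

lemma halfTan_critHeight : halfTan critHeight = 2 * critHeight := by
  have h : √(1 + 4 * critHeight ^ 2) = 4 * critHeight := by
    rw [show 1 + 4 * critHeight ^ 2 = (4 * critHeight) ^ 2 by
      rw [mul_pow, critHeight_sq]; norm_num]
    exact sqrt_sq (by linarith [critHeight_pos])
  rw [halfTan, h]; ring

lemma le_critHeight_iff {t : ℝ} (ht : 0 < t) : t ≤ critHeight ↔ 12 * t ^ 2 ≤ 1 := by
  have h := critHeight_sq
  have h0 := critHeight_pos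
  constructor
  · intro h1; nlinarith
  · intro h1; nlinarith

lemma critHeight_le_iff {t : ℝ} (ht : 0 < t) : critHeight ≤ t ↔ 1 ≤ 12 * t ^ 2 := by
  have h := critHeight_sq
  have h0 := critHeight_pos
  constructor
  · intro h1; nlinarith
  · intro h1; nlinarith

lemma rowNeg_nonneg {t : ℝ} (ht : 0 < t) : 0 ≤ rowNeg t := by
  rcases le_total t critHeight with h | h
  · rw [rowNeg_of_small ht ((le_critHeight_iff ht).1 h)]; positivity
  · have h1 := (critHeight_le_iff ht).1 h
    have h2 := halfTan_sq_le ht h1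
    rw [rowNeg_halfTan ht h1]
    have : 0 < 1 - halfTan t ^ 2 := by linarith
    positivity

lemma sqrt_le_one_add (t : ℝ) : √(1 + 4 * t ^ 2) ≤ 1 + 2 * t ^ 2 := by
  apply sqrt_le_iff.2
  constructor
  · positivity
  · nlinarith [sq_nonneg (t ^ 2)]

/-- The bound for `∫ D⁻ nest ds` in the row of height `t`. -/
def nestBound (t : ℝ) : ℝ := if t ≤ critHeight then 0.945 * rowNeg t else 0.963 * rowNeg t

lemma nestBound_le {t : ℝ} (ht : 0 < t) : nestBound t ≤ 0.963 * rowNeg t := by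
  have := rowNeg_nonneg ht
  unfold nestBound; split_ifs <;> linarith

lemma lintegral_row_nest {t : ℝ} (ht : 0 < t) :
    ∫⁻ s in Ioi 0, ENNReal.ofReal (-diffKer s t * nest s t) ≤ ENNReal.ofReal (nestBound t) := by
  unfold nestBound
  split_ifs with h
  · exact lintegral_row_nest_small ht ((le_critHeight_iff ht).1 h)
  · exact lintegral_row_nest_large ht ((critHeight_le_iff ht).1 (not_le.1 h).le)

/-- `T² rowNeg T` is nondecreasing. -/
lemma sq_mul_rowNeg_mono {a b : ℝ} (ha : 0 < a) (hab : a ≤ b) :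
    a ^ 2 * rowNeg a ≤ b ^ 2 * rowNeg b := by
  have hsmall : ∀ {a b : ℝ}, 0 < a → a ≤ b → b ≤ critHeight →
      a ^ 2 * rowNeg a ≤ b ^ 2 * rowNeg b := by
    intro a b ha hab hb
    have hb0 := ha.trans_le hab
    rw [rowNeg_of_small ha ((le_critHeight_iff ha).1 (hab.trans hb)),
      rowNeg_of_small hb0 ((le_critHeight_iff hb0).1 hb)]
    have e : ∀ t : ℝ, 0 < t → t ^ 2 * (√(1 + 4 * t ^ 2) / t) = t * √(1 + 4 * t ^ 2) := by
      intro t ht; field_simp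
    rw [e a ha, e b hb0]
    gcongr
  have hlarge : ∀ {a b : ℝ}, 0 < a → a ≤ b → critHeight ≤ a →
      a ^ 2 * rowNeg a ≤ b ^ 2 * rowNeg b := by
    intro a b ha hab hb
    have hb0 := ha.trans_le hab
    have h1 := (critHeight_le_iff ha).1 hb
    have h2 := (critHeight_le_iff hb0).1 (hb.trans hab)
    have e : ∀ t : ℝ, 0 < t → 1 ≤ 12 * t ^ 2 → t ^ 2 * rowNeg t =
        (1 - halfTan t ^ 2) / 8 + ((1 - halfTan t ^ 2) / (1 + halfTan t ^ 2)) ^ 2 := by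
      intro t ht h
      obtain ⟨hz, hz1, htz, -⟩ := halfTan_spec ht
      have h3 := halfTan_sq_le ht h
      rw [rowNeg_halfTan ht h]
      set z := halfTan t
      have hne : 1 - z ^ 2 ≠ 0 := by nlinarith
      rw [htz]
      field_simp
      ring
    have hq : halfTan b ^ 2 ≤ halfTan a ^ 2 := by
      obtain ⟨hz, hz1, htz, -⟩ := halfTan_spec ha
      obtain ⟨hz', hz1', htz', -⟩ := halfTan_spec hb0
      have : halfTan b ≤ halfTan a := by
        by_contra! hlt
        have : b < a := by
          rw [htz, htz', div_lt_div_iff₀ (by positivity) (by positivity)]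
          nlinarith [mul_pos hz hz']
        linarith
      gcongr
    have h3 := halfTan_sq_le ha h1
    have h4 : 0 ≤ 1 - halfTan a ^ 2 := by linarith
    rw [e a ha h1, e b hb0 h2]
    have h4' : 0 ≤ 1 - halfTan b ^ 2 := by linarith
    have : (1 - halfTan a ^ 2) / (1 + halfTan a ^ 2) ≤
        (1 - halfTan b ^ 2) / (1 + halfTan b ^ 2) := by gcongr
    have h5 : 0 ≤ (1 - halfTan a ^ 2) / (1 + halfTan a ^ 2) := by positivity
    gcongr
  rcases le_total b critHeight with h | h
  · exact hsmall ha hab h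
  · rcases le_total a critHeight with h' | h'
    · exact (hsmall ha h' le_rfl).trans (hlarge critHeight_pos h le_rfl)
    · exact hlarge ha hab h'

lemma setLIntegral_Ioo_add_Ioo_le (f : ℝ → ENNReal) {a b c : ℝ} :
    ∫⁻ t in Ioo a c, f t ≤ (∫⁻ t in Ioo a b, f t) + ∫⁻ t in Ioo b c, f t := by
  have h : Ioo a c ⊆ (Ioo a b ∪ Ioo b c) ∪ {b} := by
    intro x hx
    rcases lt_trichotomy x b with h | h | h
    · exact Or.inl (Or.inl ⟨hx.1, h⟩)
    · exact Or.inr h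
    · exact Or.inl (Or.inr ⟨h, hx.2⟩)
  calc ∫⁻ t in Ioo a c, f t ≤ ∫⁻ t in (Ioo a b ∪ Ioo b c) ∪ {b}, f t :=
        lintegral_mono_set h
    _ ≤ (∫⁻ t in Ioo a b ∪ Ioo b c, f t) + ∫⁻ t in {b}, f t := lintegral_union_le _ _ _
    _ ≤ _ := by
        rw [setLIntegral_measure_zero {b} f (by simp), add_zero]
        exact lintegral_union_le _ _ _

lemma setLIntegral_Ioi_le (f : ℝ → ENNReal) {a b : ℝ} :
    ∫⁻ t in Ioi a, f t ≤ (∫⁻ t in Ioo a b, f t) + ∫⁻ t in Ioi b, f t := by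
  have h : Ioi a ⊆ (Ioo a b ∪ Ioi b) ∪ {b} := by
    intro x hx
    rcases lt_trichotomy x b with h | h | h
    · exact Or.inl (Or.inl ⟨hx, h⟩)
    · exact Or.inr h
    · exact Or.inl (Or.inr h)
  calc ∫⁻ t in Ioi a, f t ≤ ∫⁻ t in (Ioo a b ∪ Ioi b) ∪ {b}, f t :=
        lintegral_mono_set h
    _ ≤ (∫⁻ t in Ioo a b ∪ Ioi b, f t) + ∫⁻ t in {b}, f t := lintegral_union_le _ _ _
    _ ≤ _ := by
        rw [setLIntegral_measure_zero {b} f (by simp), add_zero]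
        exact lintegral_union_le _ _ _

lemma lintegral_bulk_small {H : ℝ} (hH : 0 < H) (h : H ≤ critHeight) :
    ∫⁻ t in Ioo 0 H, ENNReal.ofReal (√t * nestBound t) ≤
      ENNReal.ofReal (0.945 * (2 * √H * (1 + 2 / 5 * H ^ 2))) := by
  have hF : ∀ t ∈ Ioo 0 H, HasDerivAt (fun t : ℝ => 0.945 * (2 * √t * (1 + 2 / 5 * t ^ 2)))
      (√t * (0.945 * ((1 + 2 * t ^ 2) / t))) t := by
    intro t ht
    have ht0 : 0 < t := ht.1
    have h2 : HasDerivAt (fun u : ℝ => u ^ 2) (2 * t) t := by simpa using hasDerivAt_pow 2 t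
    have h3 := ((((hasDerivAt_id' t).sqrt ht0.ne').const_mul 2).mul
      ((h2.const_mul (2 / 5)).const_add 1)).const_mul 0.945
    refine h3.congr_deriv ?_
    have hs : t = √t ^ 2 := (sq_sqrt ht0.le).symm
    have hs0 : 0 < √t := sqrt_pos.2 ht0
    set v := √t
    rw [hs]
    field_simp
    ring
  have h1 := lintegral_Ioo_deriv_of_continuousOn hH.le (by fun_prop) hF
    (fun t ht => by have : 0 < t := ht.1; positivity)
  simp only [sqrt_zero, mul_zero, zero_mul, sub_zero] at h1
  rw [← h1]
  refine setLIntegral_mono' measurableSet_Ioo fun t ht => ENNReal.ofReal_le_ofReal ?_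
  have ht0 : 0 < t := ht.1
  have htc : t ≤ critHeight := ht.2.le.trans h
  rw [nestBound, if_pos htc, rowNeg_of_small ht0 ((le_critHeight_iff ht0).1 htc)]
  have := sqrt_le_one_add t
  gcongr

lemma bulkPoly_sub_nonneg {H : ℝ} (h : critHeight ≤ H) :
    0 ≤ bulkPoly (√(2 * critHeight)) - bulkPoly (√(halfTan H)) := by
  have hc := critHeight_pos
  have hH := hc.trans_le h
  have hmon : MonotoneOn bulkPoly (Icc 0 (√(2 * critHeight))) := by
    refine monotoneOn_of_deriv_nonneg (convex_Icc _ _) (by unfold bulkPoly; fun_prop)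
      (by unfold bulkPoly; fun_prop) ?_
    intro y hy
    rw [interior_Icc] at hy
    rw [(hasDerivAt_bulkPoly y).deriv]
    have h4 : y ^ 4 ≤ 1 / 3 := by
      calc y ^ 4 ≤ √(2 * critHeight) ^ 4 := pow_le_pow_left₀ hy.1.le hy.2.le 4
        _ = 4 * critHeight ^ 2 := by
          rw [show √(2 * critHeight) ^ 4 = (√(2 * critHeight) ^ 2) ^ 2 by ring,
            sq_sqrt (by positivity)]; ring
        _ = 1 / 3 := by rw [critHeight_sq]; norm_num
    have h0 : 0 ≤ y ^ 4 := by positivity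
    rw [show y ^ 8 = (y ^ 4) ^ 2 by ring, show y ^ 12 = (y ^ 4) ^ 3 by ring]
    generalize y ^ 4 = q at *
    nlinarith
  have hle : √(halfTan H) ≤ √(2 * critHeight) := by
    apply sqrt_le_sqrt
    have h3 := halfTan_sq_le hH ((critHeight_le_iff hH).1 h)
    have := critHeight_sq
    obtain ⟨hz, -⟩ := halfTan_spec hH
    nlinarith
  linarith [hmon ⟨sqrt_nonneg _, hle⟩ ⟨sqrt_nonneg _, le_rfl⟩ hle]

lemma lintegral_bulk_nestBound_large {H : ℝ} (h : critHeight ≤ H) :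
    ∫⁻ t in Ioo 0 H, ENNReal.ofReal (√t * nestBound t) ≤
      ENNReal.ofReal (0.945 * (2 * √critHeight * (1 + 1 / 30)) +
        0.963 * (bulkPoly (√(2 * critHeight)) - bulkPoly (√(halfTan H)))) := by
  have hc := critHeight_pos
  have h1 := lintegral_bulk_small hc le_rfl
  have h2 := lintegral_bulk_large hc h ((critHeight_le_iff hc).1 le_rfl)
  rw [critHeight_sq] at h1
  rw [halfTan_critHeight] at h2
  have h3 : ∫⁻ t in Ioo critHeight H, ENNReal.ofReal (√t * nestBound t) ≤
      ENNReal.ofReal 0.963 * ∫⁻ t in Ioo critHeight H, ENNReal.ofReal (√t * rowNeg t) := by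
    rw [← lintegral_const_mul' _ _ (by finiteness)]
    refine setLIntegral_mono' measurableSet_Ioo fun t ht => ?_
    rw [← ENNReal.ofReal_mul (by norm_num)]
    refine ENNReal.ofReal_le_ofReal ?_
    have := nestBound_le (hc.trans ht.1)
    have h0 := sqrt_nonneg t
    nlinarith
  have hmono := bulkPoly_sub_nonneg h
  calc _ ≤ _ := setLIntegral_Ioo_add_Ioo_le _ (b := critHeight)
    _ ≤ _ := add_le_add h1 (h3.trans (mul_le_mul_right h2 _))
    _ = _ := by
      rw [← ENNReal.ofReal_mul (by norm_num), ← ENNReal.ofReal_add (by positivity)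
        (by positivity)]
      norm_num

/-- Below the critical height the main term is 2/t, whose primitive is a logarithm. It is majorized
by (√t/√H + √H/√t)/t, with equality at t = H, so that after multiplication by √(2H) the bound is a
polynomial in √H. -/
lemma lintegral_rowAll_small {H : ℝ} (hH : 0 < H) (h : H ≤ critHeight) :
    ∫⁻ t in Ioi H, ENNReal.ofReal (rowAll t) ≤
      ENNReal.ofReal (2 * (critHeight - H) / (√critHeight * √H) +
        (2 * critHeight ^ 2 - 4 * critHeight + 16 / 3 * critHeight ^ 3 -
          (2 * H ^ 2 - 4 * H + 16 / 3 * H ^ 3)) + tailPoly (2 * critHeight)) := by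
  have hc := critHeight_pos
  have h2 := lintegral_rowAll_large hc ((critHeight_le_iff hc).1 le_rfl)
  rw [halfTan_critHeight] at h2
  have hs0 : 0 < √H := sqrt_pos.2 hH
  have hsH : √H ^ 2 = H := sq_sqrt hH.le
  set F : ℝ → ℝ := fun t => 2 * (√t / √H - √H / √t) + (2 * t ^ 2 - 4 * t + 16 / 3 * t ^ 3) with hFd
  set f : ℝ → ℝ := fun t => (√t / √H + √H / √t) / t + (4 * t - 4 + 16 * t ^ 2) with hfd
  have hF : ∀ t ∈ Icc H critHeight, HasDerivAt F (f t) t := by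
    intro t ht
    have ht0 : 0 < t := hH.trans_le ht.1
    have hst : 0 < √t := sqrt_pos.2 ht0
    have hs := (hasDerivAt_id' t).sqrt ht0.ne'
    have hp : ∀ n : ℕ, HasDerivAt (fun z : ℝ => z ^ n) (n * t ^ (n - 1)) t := fun n =>
      hasDerivAt_pow n t
    have h3 := (((hs.div_const √H).sub ((hasDerivAt_const t √H).div hs hst.ne')).const_mul 2).add
      ((((hp 2).const_mul 2).sub ((hasDerivAt_id' t).const_mul 4)).add ((hp 3).const_mul (16 / 3)))
    refine h3.congr_deriv ?_
    have hs : t = √t ^ 2 := (sq_sqrt ht0.le).symm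
    simp only [hfd]
    push_cast
    generalize √t = v at *
    generalize √H = r at *
    subst hs
    field_simp
    ring
  have hfr : ∀ t ∈ Ioo H critHeight, rowAll t ≤ f t ∧ 0 ≤ f t := by
    intro t ht
    have ht0 : 0 < t := hH.trans ht.1
    have h12 := (le_critHeight_iff ht0).1 ht.2.le
    have hst : 0 < √t := sqrt_pos.2 ht0
    have h3 : 2 ≤ √t / √H + √H / √t := by
      have e : √t / √H + √H / √t - 2 = (√t - √H) ^ 2 / (√t * √H) := by
        field_simp; ring
      have : 0 ≤ (√t - √H) ^ 2 / (√t * √H) := by positivity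
      linarith
    have h4 : 2 / t ≤ (√t / √H + √H / √t) / t := by gcongr
    have h5 := sqrt_le_one_add t
    have h6 : √(1 + 4 * t ^ 2) / t ≤ (1 + 2 * t ^ 2) / t := by gcongr
    have h7 : 2 * ((1 + 2 * t ^ 2) / t) = 2 / t + 4 * t := by field_simp; ring
    have h8 : 4 - 16 * t ^ 2 ≤ 1 / (1 / 4 + t ^ 2) := by
      rw [le_div_iff₀ (by positivity)]; nlinarith [sq_nonneg (t ^ 2)]
    have h9 : (1 : ℝ) / (1 / 4 + t ^ 2) ≤ 4 := by
      rw [div_le_iff₀ (by positivity)]; nlinarith [sq_nonneg t]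
    rw [rowAll, rowNeg_of_small ht0 h12]
    simp only [hfd]
    refine ⟨by linarith, ?_⟩
    have : (2 : ℝ) ≤ 2 / t := by
      rw [le_div_iff₀ ht0]; nlinarith
    have h10 : 2 / t ≥ 4 := by
      rw [ge_iff_le, le_div_iff₀ ht0]; nlinarith
    nlinarith [sq_nonneg t]
  have hcont : ContinuousOn f (Icc H critHeight) := by
    have : ∀ t ∈ Icc H critHeight, t ≠ 0 := fun t ht => (hH.trans_le ht.1).ne'
    have h' : ∀ t ∈ Icc H critHeight, √t ≠ 0 := fun t ht =>
      (sqrt_pos.2 (hH.trans_le ht.1)).ne'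
    simp only [hfd]
    fun_prop (disch := assumption)
  have h1 := lintegral_Ioo_deriv h hF hcont (fun t ht => (hfr t ht).2)
  have h3 : ∫⁻ t in Ioo H critHeight, ENNReal.ofReal (rowAll t) ≤
      ENNReal.ofReal (F critHeight - F H) := by
    rw [← h1]
    exact setLIntegral_mono' measurableSet_Ioo fun t ht => ENNReal.ofReal_le_ofReal (hfr t ht).1
  have hsc : √critHeight ^ 2 = critHeight := sq_sqrt hc.le
  have hsc0 : 0 < √critHeight := sqrt_pos.2 hc
  have hFv : F critHeight - F H = 2 * (critHeight - H) / (√critHeight * √H) +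
        (2 * critHeight ^ 2 - 4 * critHeight + 16 / 3 * critHeight ^ 3 -
          (2 * H ^ 2 - 4 * H + 16 / 3 * H ^ 3)) := by
    have : 2 * (√critHeight / √H - √H / √critHeight) =
        2 * (critHeight - H) / (√critHeight * √H) := by
      rw [← sub_eq_zero]
      field_simp
      rw [hsc, hsH]; ring
    simp only [hFd]
    rw [this, div_self hs0.ne']; ring
  have hF0 : 0 ≤ F critHeight - F H := by
    have hm : MonotoneOn F (Icc H critHeight) := by
      refine monotoneOn_of_deriv_nonneg (convex_Icc _ _)
        (fun t ht => (hF t ht).continuousAt.continuousWithinAt) ?_ ?_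
      · intro t ht
        rw [interior_Icc] at ht
        exact (hF t ⟨ht.1.le, ht.2.le⟩).differentiableAt.differentiableWithinAt
      · intro t ht
        rw [interior_Icc] at ht
        rw [(hF t ⟨ht.1.le, ht.2.le⟩).deriv]
        exact (hfr t ht).2
    linarith [hm ⟨le_rfl, h⟩ ⟨h, le_rfl⟩ h]
  calc _ ≤ _ := setLIntegral_Ioi_le _ (b := critHeight)
    _ ≤ _ := add_le_add h3 h2
    _ = _ := by
      rw [← ENNReal.ofReal_add hF0, hFv]
      have : (2 * critHeight) ^ 2 ≤ 1 / 3 := by rw [mul_pow, critHeight_sq]; norm_num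
      have hcb := critHeight_bounds
      unfold tailPoly
      have h0 : 0 ≤ 2 * critHeight := by linarith
      generalize 2 * critHeight = z at *
      have e : 5 * z - 2 / 3 * z ^ 3 + 6 / 5 * z ^ 5 - 2 / 7 * z ^ 7 + 53 / 72 * z ^ 9 -
        9 / 44 * z ^ 11 + 9 / 104 * z ^ 13 = z * ((5 - 2 / 3 * z ^ 2) +
          z ^ 4 * (6 / 5 - 2 / 7 * z ^ 2) + z ^ 8 * (53 / 72 - 9 / 44 * z ^ 2) +
            9 / 104 * z ^ 12) := by ring
      rw [e]
      have h1 : 0 ≤ 5 - 2 / 3 * z ^ 2 := by linarith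
      have h2 : 0 ≤ 6 / 5 - 2 / 7 * z ^ 2 := by linarith
      have h3 : 0 ≤ 53 / 72 - 9 / 44 * z ^ 2 := by linarith
      positivity

/-! ### The cost beyond the wall, and the total. -/

/-- An upper bound for the positive part of the row of height `t`. -/
def rowPos (t : ℝ) : ℝ := rowNeg t - 1 / (1 / 4 + t ^ 2)

lemma rowPos_nonneg {t : ℝ} (ht : 0 < t) : 0 ≤ rowPos t := by
  unfold rowPos
  rcases le_total t critHeight with h | h
  · rw [rowNeg_of_small ht ((le_critHeight_iff ht).1 h), sub_nonneg,
      div_le_div_iff₀ (by positivity) ht]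
    have h1 : 1 ≤ √(1 + 4 * t ^ 2) := by
      rw [one_le_sqrt]; nlinarith [sq_nonneg t]
    nlinarith [sq_nonneg (2 * t - 1), sq_nonneg t]
  · rw [rowNeg_of_large ht ((critHeight_le_iff ht).1 h)]
    obtain ⟨hz, -⟩ := halfTan_spec ht
    have : 0 ≤ (√(1 + 4 * t ^ 2) - 2 * t) / (2 * t) := div_nonneg hz.le (by positivity)
    linarith

/-- The gain from capping the vertical increments on `(H, 2H)`. -/
def capGain (H : ℝ) : ℝ := (1.463 * √2 - 1.926) * (√H * (H * rowNeg H))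

lemma lintegral_capGain {H : ℝ} (hH : 0 < H) :
    ∫⁻ t in Ioo H (2 * H), ENNReal.ofReal ((√(2 * H) - 0.963 * √t) * (H ^ 2 * rowNeg H / t ^ 2)) =
      ENNReal.ofReal (capGain H) := by
  have hR := rowNeg_nonneg hH
  have hs : ∀ t, H ≤ t → √t ≠ 0 := fun t ht => (sqrt_pos.2 (hH.trans_le ht)).ne'
  have hF : ∀ t ∈ Icc H (2 * H), HasDerivAt
      (fun t => H ^ 2 * rowNeg H * (1.926 * (1 / √t) - √(2 * H) * (1 / t)))
      ((√(2 * H) - 0.963 * √t) * (H ^ 2 * rowNeg H / t ^ 2)) t := by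
    intro t ht
    have ht0 : 0 < t := hH.trans_le ht.1
    have hst : 0 < √t := sqrt_pos.2 ht0
    have h1 := (((((hasDerivAt_const t (1 : ℝ)).div ((hasDerivAt_id' t).sqrt ht0.ne')
      hst.ne').const_mul 1.926).sub (((hasDerivAt_const t (1 : ℝ)).div (hasDerivAt_id' t)
      ht0.ne').const_mul √(2 * H)))).const_mul (H ^ 2 * rowNeg H)
    refine h1.congr_deriv ?_
    have hs : t = √t ^ 2 := (sq_sqrt ht0.le).symm
    generalize √t = v at *
    subst hs
    field_simp
    ring
  have hc : ContinuousOn (fun t => (√(2 * H) - 0.963 * √t) * (H ^ 2 * rowNeg H / t ^ 2))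
      (Icc H (2 * H)) := by
    have : ∀ t ∈ Icc H (2 * H), t ^ 2 ≠ 0 := fun t ht => pow_ne_zero 2 (hH.trans_le ht.1).ne'
    fun_prop (disch := assumption)
  rw [lintegral_Ioo_deriv (by linarith) hF hc]
  · congr 1
    have h2 : √(2 * H) = √2 * √H := sqrt_mul (by norm_num) H
    have hs0 : 0 < √H := sqrt_pos.2 hH
    have hsH : √H ^ 2 = H := sq_sqrt hH.le
    have h22 : √2 ^ 2 = 2 := sq_sqrt (by norm_num)
    have h20 : 0 < √2 := by positivity
    have e1 : 1 / (√2 * √H) = √2 / (2 * √H) := by field_simp; rw [h22]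
    have e2 : H ^ 2 = √H ^ 2 * H := by rw [hsH]; ring
    have e3 : (1 : ℝ) / H = 1 / √H ^ 2 := by rw [hsH]
    have e4 : (1 : ℝ) / (2 * H) = 1 / (2 * √H ^ 2) := by rw [hsH]
    rw [capGain, h2, e1, e2, e3, e4]
    field_simp
    ring
  · intro t ht
    have ht0 : 0 < t := hH.trans ht.1
    have : √t ≤ √(2 * H) := sqrt_le_sqrt ht.2.le
    have h1 : 0 ≤ √(2 * H) - 0.963 * √t := by nlinarith [sqrt_nonneg t]
    positivity

/-- The part of the cost that comes from heights beyond `H`. -/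
def outerCost (H : ℝ) : ENNReal :=
  (∫⁻ t in Ioo H (2 * H), ENNReal.ofReal (√t * nestBound t)) +
    (ENNReal.ofReal √(2 * H) * (∫⁻ t in Ioi (2 * H), ENNReal.ofReal (rowNeg t)) +
      ENNReal.ofReal √(2 * H) * ∫⁻ t in Ioi H, ENNReal.ofReal (rowPos t))

/-- Charging √(2H) at every height above H would give the right side. On (H, 2H) the actual charge
for the negative part is only √t times the nested mass, and `capGain` is a lower bound for what this
saves. -/
lemma outerCost_add_le {H : ℝ} (hH : 0 < H) :
    outerCost H + ENNReal.ofReal (capGain H) ≤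
      ENNReal.ofReal √(2 * H) * ∫⁻ t in Ioi H, ENNReal.ofReal (rowAll t) := by
  set r := √(2 * H) with hr
  have hr0 : 0 ≤ r := sqrt_nonneg _
  have hfin : ENNReal.ofReal r ≠ ⊤ := by finiteness
  have h1 : ∀ t ∈ Ioi (2 * H), ENNReal.ofReal r * ENNReal.ofReal (rowNeg t) +
      ENNReal.ofReal r * ENNReal.ofReal (rowPos t) ≤ ENNReal.ofReal r * ENNReal.ofReal (rowAll t) := by
    intro t ht
    have ht0 : 0 < t := lt_trans (by positivity) (mem_Ioi.1 ht)
    rw [← mul_add, ← ENNReal.ofReal_add (rowNeg_nonneg ht0) (rowPos_nonneg ht0)]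
    gcongr
    rw [rowPos, rowAll]; linarith
  have h2 : ∀ t ∈ Ioo H (2 * H), ENNReal.ofReal (√t * nestBound t) +
      ENNReal.ofReal r * ENNReal.ofReal (rowPos t) +
      ENNReal.ofReal ((r - 0.963 * √t) * (H ^ 2 * rowNeg H / t ^ 2)) ≤
        ENNReal.ofReal r * ENNReal.ofReal (rowAll t) := by
    intro t ht
    have ht0 : 0 < t := hH.trans ht.1
    have hR := rowNeg_nonneg ht0
    have hP := rowPos_nonneg ht0
    have hRH := rowNeg_nonneg hH
    have hn := nestBound_le ht0
    have hn0 : 0 ≤ nestBound t := by unfold nestBound; split_ifs <;> positivity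
    have hst := sqrt_nonneg t
    have hle : √t ≤ r := sqrt_le_sqrt ht.2.le
    have h3 : 0 ≤ r - 0.963 * √t := by nlinarith
    rw [← ENNReal.ofReal_mul hr0, ← ENNReal.ofReal_mul hr0, ← ENNReal.ofReal_add (by positivity)
      (by positivity), ← ENNReal.ofReal_add (by positivity) (by positivity)]
    refine ENNReal.ofReal_le_ofReal ?_
    -- Monotonicity of t² `rowNeg t` replaces the row mass by a multiple of 1/t², so that the gain
    -- integrates explicitly.
    have h4 : H ^ 2 * rowNeg H / t ^ 2 ≤ rowNeg t := by
      rw [div_le_iff₀ (by positivity), mul_comm (rowNeg t)]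
      exact sq_mul_rowNeg_mono hH ht.1.le
    have h5 : (r - 0.963 * √t) * (H ^ 2 * rowNeg H / t ^ 2) ≤ (r - 0.963 * √t) * rowNeg t := by
      gcongr
    have h6 : √t * nestBound t ≤ √t * (0.963 * rowNeg t) := by gcongr
    have h7 : rowAll t = rowNeg t + rowPos t := by rw [rowPos, rowAll]; ring
    rw [h7]
    nlinarith
  have e1 : ENNReal.ofReal r * ∫⁻ t in Ioi H, ENNReal.ofReal (rowPos t) ≤
      (∫⁻ t in Ioo H (2 * H), ENNReal.ofReal r * ENNReal.ofReal (rowPos t)) +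
        ∫⁻ t in Ioi (2 * H), ENNReal.ofReal r * ENNReal.ofReal (rowPos t) := by
    rw [← lintegral_const_mul' _ _ hfin]
    exact setLIntegral_Ioi_le _
  have e2 : (∫⁻ t in Ioo H (2 * H), ENNReal.ofReal r * ENNReal.ofReal (rowAll t)) +
      (∫⁻ t in Ioi (2 * H), ENNReal.ofReal r * ENNReal.ofReal (rowAll t)) ≤
      ENNReal.ofReal r * ∫⁻ t in Ioi H, ENNReal.ofReal (rowAll t) := by
    rw [← lintegral_const_mul' _ _ hfin, ← lintegral_union measurableSet_Ioi]
    · refine lintegral_mono_set ?_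
      rintro x (hx | hx)
      · exact hx.1
      · exact lt_trans (by linarith) (mem_Ioi.1 hx)
    · rw [Set.disjoint_left]
      intro x hx hx'
      exact absurd hx.2 (not_lt.2 (le_of_lt hx'))
  have e3 := setLIntegral_mono' (μ := volume) measurableSet_Ioi h1
  have e4 := setLIntegral_mono' (μ := volume) measurableSet_Ioo h2
  have e5 := le_lintegral_add (μ := volume.restrict (Ioi (2 * H)))
    (fun t => ENNReal.ofReal r * ENNReal.ofReal (rowNeg t))
    (fun t => ENNReal.ofReal r * ENNReal.ofReal (rowPos t))
  have e6 := (add_le_add_left (le_lintegral_add (μ := volume.restrict (Ioo H (2 * H)))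
    (fun t => ENNReal.ofReal (√t * nestBound t))
    (fun t => ENNReal.ofReal r * ENNReal.ofReal (rowPos t))) _).trans
    (le_lintegral_add _ (fun t => ENNReal.ofReal ((r - 0.963 * √t) * (H ^ 2 * rowNeg H / t ^ 2))))
  rw [lintegral_capGain hH] at e6
  refine le_trans ?_ (e2.trans' (add_le_add (e6.trans e4) (e5.trans e3)))
  rw [outerCost, ← lintegral_const_mul' _ _ hfin]
  refine (add_le_add_left (add_le_add_right (add_le_add_right e1 _) _) _).trans (le_of_eq ?_)
  ring

/-- The total cost, integrated over all columns, for a wall at distance `H`. -/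
def totalCost (H : ℝ) : ENNReal :=
  ENNReal.ofReal (π * √(2 * (√(1 / 4 + H ^ 2) - H))) +
    ENNReal.ofReal 0.582 * (2 * (∫⁻ t in Ioo 0 H, ENNReal.ofReal (√t * nestBound t)) + outerCost H)

/-- The wall term is π√(`halfTan H`); the remaining integrals enter only through numerical bounds a,
j and o, so one statement serves both ranges of H. -/
lemma totalCost_le {H a j o : ℝ} (hH : 0 < H) (ha : 0 ≤ a) (ho : 0 ≤ o)
    (hA : ∫⁻ t in Ioo 0 H, ENNReal.ofReal (√t * nestBound t) ≤ ENNReal.ofReal a)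
    (hJ : ∫⁻ t in Ioi H, ENNReal.ofReal (rowAll t) ≤ ENNReal.ofReal j)
    (hO : √(2 * H) * j - capGain H ≤ o) :
    totalCost H ≤ ENNReal.ofReal (π * √(halfTan H) + 0.582 * (2 * a + o)) := by
  have h1 : 2 * (√(1 / 4 + H ^ 2) - H) = halfTan H := by
    rw [halfTan, show 1 + 4 * H ^ 2 = 2 ^ 2 * (1 / 4 + H ^ 2) by ring,
      sqrt_mul (by norm_num), sqrt_sq (by norm_num)]
    ring
  have hg : 0 ≤ capGain H := by
    have : 1.41 ≤ √2 := le_sqrt_of_sq_le (by norm_num)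
    have h3 : 0 ≤ 1.463 * √2 - 1.926 := by linarith
    have := rowNeg_nonneg hH
    unfold capGain
    positivity
  have h2 : outerCost H ≤ ENNReal.ofReal o := by
    refine le_trans ?_ (ENNReal.ofReal_le_ofReal hO)
    rw [ENNReal.ofReal_sub _ hg]
    refine ENNReal.le_sub_of_add_le_right (by finiteness) ?_
    refine (outerCost_add_le hH).trans ?_
    rw [ENNReal.ofReal_mul (sqrt_nonneg _)]
    gcongr
  rw [totalCost, h1, ENNReal.ofReal_add (by positivity) (by positivity),
    ENNReal.ofReal_mul (p := 0.582) (by norm_num), ENNReal.ofReal_add (by positivity) ho,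
    ENNReal.ofReal_mul (p := 2) (by norm_num), ENNReal.ofReal_ofNat]
  gcongr

/-! ### The one-variable inequality for the total cost. -/

lemma quadratic_tail_nonneg {v : ℝ} (hv : 0 ≤ v) (h : v ≤ 0.5373) :
    0 ≤ 2.538396 - 7.241772 * v + 6.365947 * v ^ 2 + 1.319724 * v ^ 3 - 2.566981 * v ^ 4 -
      2.327527 * v ^ 5 - 9.35509 * v ^ 6 - 3.3737 * v ^ 7 := by
  have h1 : 2.566981 + 2.327527 * v + 9.35509 * v ^ 2 + 3.3737 * v ^ 3 ≤ 7.05 := by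
    have h2 : v ^ 2 ≤ 0.5373 ^ 2 := pow_le_pow_left₀ hv h 2
    have h3 : v ^ 3 ≤ 0.5373 ^ 3 := pow_le_pow_left₀ hv h 3
    norm_num at h2 h3
    linarith
  have h2 : v ^ 4 * (2.566981 + 2.327527 * v + 9.35509 * v ^ 2 + 3.3737 * v ^ 3) ≤ v ^ 4 * 7.05 := by
    gcongr
  have h3 : v ^ 4 ≤ 0.28870 * v ^ 2 := by nlinarith [sq_nonneg v, mul_nonneg hv (sq_nonneg v)]
  nlinarith [pow_nonneg hv 3]

/-- The left side bounds (cost - 1.538π)/0.582 as a polynomial in v = √H. The number 0.5373 lies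
just above √`critHeight`, where the bound is tight. The polynomial of `quadratic_tail_nonneg` is, up
to sign, the quotient by v - 0.5373; the remainder is about -0.02. -/
lemma small_height_ineq {v : ℝ} (hv : 0 ≤ v) (h : v ≤ 0.5373) :
    -1.38440 + 6.4294 * v - 10.66219 * v ^ 2 + 5.65686 * v ^ 3 + 2.69897 * v ^ 4 -
      1.3164 * v ^ 5 + 2.69897 * v ^ 6 - 7.5424 * v ^ 7 - 3.3737 * v ^ 8 ≤ -0.01 := by
  have h1 := mul_nonneg (sub_nonneg.2 h) (quadratic_tail_nonneg hv h)
  have hk : ∀ n : ℕ, 0 ≤ v ^ n ∧ v ^ n ≤ 1 := fun n =>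
    ⟨pow_nonneg hv n, pow_le_one₀ hv (by linarith)⟩
  linarith only [h1, (hk 1).1, (hk 1).2, (hk 2).1, (hk 2).2, (hk 3).1, (hk 3).2, (hk 4).1, (hk 4).2, (hk 5).1, (hk 5).2, (hk 6).1, (hk 6).2, (hk 7).1, (hk 7).2, (hk 8).1, (hk 8).2]

/-- The same polynomial with 1.53 in place of 1.538, for H ≤ 1/10; 0.31623 is just above √(1/10). -/
lemma small_height_ineq' {v : ℝ} (hv : 0 ≤ v) (h : v ≤ 0.31623) :
    -1.3412 + 6.4294 * v - 10.66219 * v ^ 2 + 5.65686 * v ^ 3 + 2.69897 * v ^ 4 -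
      1.3164 * v ^ 5 + 2.69897 * v ^ 6 - 7.5424 * v ^ 7 - 3.3737 * v ^ 8 ≤ -0.01 := by
  have h3 : v ^ 3 ≤ 0.31623 * v ^ 2 := by nlinarith [sq_nonneg v]
  have h4 : v ^ 4 ≤ 0.1001 * v ^ 2 := by nlinarith [sq_nonneg v]
  have h6 : v ^ 6 ≤ 0.0101 * v ^ 2 := by nlinarith [sq_nonneg v, sq_nonneg (v ^ 2)]
  have h5 : 0 ≤ v ^ 5 := by positivity
  have h7 : 0 ≤ v ^ 7 := by positivity
  have h8 : 0 ≤ v ^ 8 := by positivity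
  nlinarith

/-- The right side is the fourth-order Taylor polynomial at 0; the difference of squares carries the
factor H⁵ with a positive cofactor in this range. -/
lemma sqrt_halfTan_le {H : ℝ} (hH : 0 < H) (h : H ≤ critHeight) :
    √(halfTan H) ≤ 1 - H + H ^ 2 / 2 + H ^ 3 / 2 - 5 / 8 * H ^ 4 := by
  have hc := critHeight_bounds
  have hH3 : H ≤ 0.2887 := by linarith
  have h12 := (le_critHeight_iff hH).1 h
  apply sqrt_le_iff.2
  have h3 : H ^ 3 ≤ 0.2887 * H ^ 2 := by nlinarith [sq_nonneg H]
  constructor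
  · nlinarith [pow_pos hH 3, sq_nonneg H]
  · have hw : √(1 + 4 * H ^ 2) ≤ 1 + 2 * H ^ 2 - 2 * H ^ 4 + 4 * H ^ 6 := by
      apply sqrt_le_iff.2
      constructor
      · nlinarith [sq_nonneg H, pow_pos hH 6]
      · have e : (1 + 2 * H ^ 2 - 2 * H ^ 4 + 4 * H ^ 6) ^ 2 - (1 + 4 * H ^ 2) =
          H ^ 8 * (20 - 16 * H ^ 2 + 16 * H ^ 4) := by ring
        have : 0 ≤ H ^ 8 * (20 - 16 * H ^ 2 + 16 * H ^ 4) :=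
          mul_nonneg (by positivity) (by nlinarith [sq_nonneg (H ^ 2)])
        linarith
    have e : (1 - H + H ^ 2 / 2 + H ^ 3 / 2 - 5 / 8 * H ^ 4) ^ 2 -
        (1 + 2 * H ^ 2 - 2 * H ^ 4 + 4 * H ^ 6 - 2 * H) =
        H ^ 5 * (7 / 4 - 35 / 8 * H - 5 / 8 * H ^ 2 + 25 / 64 * H ^ 3) := by ring
    have : 0 ≤ H ^ 5 * (7 / 4 - 35 / 8 * H - 5 / 8 * H ^ 2 + 25 / 64 * H ^ 3) :=
      mul_nonneg (by positivity) (by nlinarith [pow_pos hH 3])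
    unfold halfTan
    linarith

lemma tailPoly_critHeight : tailPoly (2 * critHeight) ≤ 2.83420 := by
  have h := critHeight_sq
  have hc := critHeight_bounds
  have e : tailPoly (2 * critHeight) = 2 * critHeight * (5 - 2 / 3 * (4 * critHeight ^ 2) +
    6 / 5 * (4 * critHeight ^ 2) ^ 2 - 2 / 7 * (4 * critHeight ^ 2) ^ 3 +
    53 / 72 * (4 * critHeight ^ 2) ^ 4 - 9 / 44 * (4 * critHeight ^ 2) ^ 5 +
    9 / 104 * (4 * critHeight ^ 2) ^ 6) := by unfold tailPoly; ring
  rw [e, h]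
  norm_num
  linarith

lemma totalCost_small {H e : ℝ} (hH : 0 < H) (h : H ≤ critHeight)
    (he : e = 1.538 ∨ e = 1.53 ∧ H ≤ 1 / 10) : totalCost H ≤ ENNReal.ofReal (e * π) := by
  have h12 := (le_critHeight_iff hH).1 h
  have hX := sqrt_halfTan_le hH h
  have hc := critHeight_bounds
  have hc0 := critHeight_pos
  have ht := tailPoly_critHeight
  have hv0 : 0 < √H := sqrt_pos.2 hH
  have hvH : √H ^ 2 = H := sq_sqrt hH.le
  have hu0 : 0 < √critHeight := sqrt_pos.2 hc0
  have hu : √critHeight ^ 2 = critHeight := sq_sqrt hc0.le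
  have hv : √H ≤ 0.5373 := by nlinarith
  have hub : √critHeight ≤ 0.537287 := by nlinarith
  have h2l : 1.4142135 ≤ √2 := le_sqrt_of_sq_le (by norm_num)
  have h2u : √2 ≤ 1.414214 := sqrt_le_iff.2 (by norm_num)
  have hg : 0.1429 * √H ≤ capGain H := by
    have hw : 1 ≤ H * rowNeg H := by
      rw [rowNeg_of_small hH h12, mul_div_cancel₀ _ hH.ne', one_le_sqrt]
      nlinarith [sq_nonneg H]
    calc 0.1429 * √H = 0.1429 * (√H * 1) := by ring
      _ ≤ (1.463 * √2 - 1.926) * (√H * (H * rowNeg H)) := by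
        have h3 : 0.1429 ≤ 1.463 * √2 - 1.926 := by linarith only [h2l]
        have h4 : 0 ≤ 1.463 * √2 - 1.926 := by linarith only [h2l]
        gcongr
  set v := √H with hvd
  have hpr : 2 * critHeight ^ 2 - 4 * critHeight + 16 / 3 * critHeight ^ 3 ≤ -0.85972 := by
    rw [show critHeight ^ 3 = critHeight * critHeight ^ 2 by ring, critHeight_sq]
    linarith
  have ho : 0 ≤ 1.51968 - 5.26427 * H + v * (1.41422 * (1.97450 + 4 * H - 2 * H ^ 2 -
      16 / 3 * H ^ 3) - 0.1429) := by
    have : 0 ≤ 1.51968 - 5.26427 * H := by linarith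
    have : 0 ≤ 1.41422 * (1.97450 + 4 * H - 2 * H ^ 2 - 16 / 3 * H ^ 3) - 0.1429 := by
      nlinarith [mul_pos hH hH]
    positivity
  refine (totalCost_le hH (by positivity) ho (lintegral_bulk_small hH h)
    (lintegral_rowAll_small hH h) ?_).trans ?_
  · rw [← hvd, sqrt_mul (by norm_num), ← hvd]
    have e1 : √2 * v * (2 * (critHeight - H) / (√critHeight * v)) =
        2 * √2 * √critHeight - 2 * √2 / √critHeight * H := by
      field_simp
      rw [hu]
    have e2 : 5.26427 ≤ 2 * √2 / √critHeight := by
      rw [le_div_iff₀ hu0]; nlinarith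
    have e3 : 2 * √2 * √critHeight ≤ 1.51968 := by nlinarith
    have e4 : 5.26427 * H ≤ 2 * √2 / √critHeight * H := by gcongr
    have e5 : √2 * v * ((2 * critHeight ^ 2 - 4 * critHeight + 16 / 3 * critHeight ^ 3 -
        (2 * H ^ 2 - 4 * H + 16 / 3 * H ^ 3)) + tailPoly (2 * critHeight)) ≤
        1.41422 * v * (1.97450 + 4 * H - 2 * H ^ 2 - 16 / 3 * H ^ 3) := by
      have : 0 ≤ 1.97450 + 4 * H - 2 * H ^ 2 - 16 / 3 * H ^ 3 := by
        nlinarith [mul_pos hH hH]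
      calc _ ≤ √2 * v * (1.97450 + 4 * H - 2 * H ^ 2 - 16 / 3 * H ^ 3) := by
            gcongr; linarith
        _ ≤ _ := by gcongr; linarith
    linarith
  · refine ENNReal.ofReal_le_ofReal ?_
    have hpi := pi_gt_d6
    have hX1 : 1 - H + H ^ 2 / 2 + H ^ 3 / 2 - 5 / 8 * H ^ 4 ≤ 1 := by
      nlinarith [pow_pos hH 4, pow_pos hH 3, pow_pos hH 2]
    have he1 : 1.53 ≤ e := by rcases he with rfl | ⟨rfl, -⟩ <;> norm_num
    have hpoly : 0.582 * (2 * (0.945 * (2 * v * (1 + 2 / 5 * H ^ 2))) + (1.51968 - 5.26427 * H +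
        v * (1.41422 * (1.97450 + 4 * H - 2 * H ^ 2 - 16 / 3 * H ^ 3) - 0.1429))) ≤
        3.141592 * (e - (1 - H + H ^ 2 / 2 + H ^ 3 / 2 - 5 / 8 * H ^ 4)) := by
      have h1 : (e = 1.538 → -1.38440 + 6.4294 * v - 10.66219 * v ^ 2 + 5.65686 * v ^ 3 +
          2.69897 * v ^ 4 - 1.3164 * v ^ 5 + 2.69897 * v ^ 6 - 7.5424 * v ^ 7 - 3.3737 * v ^ 8 ≤ -0.01) ∧
          (e = 1.53 → -1.3412 + 6.4294 * v - 10.66219 * v ^ 2 + 5.65686 * v ^ 3 +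
          2.69897 * v ^ 4 - 1.3164 * v ^ 5 + 2.69897 * v ^ 6 - 7.5424 * v ^ 7 -
          3.3737 * v ^ 8 ≤ -0.01) := by
        refine ⟨fun _ => small_height_ineq hv0.le hv, fun h' => small_height_ineq' hv0.le ?_⟩
        rcases he with rfl | ⟨rfl, h10⟩
        · norm_num at h'
        · nlinarith
      have hk : ∀ n : ℕ, 0 ≤ v ^ n ∧ v ^ n ≤ 1 := fun n =>
        ⟨pow_nonneg hv0.le n, pow_le_one₀ hv0.le (by linarith)⟩
      rw [← hvH]
      clear_value v
      rcases he with rfl | ⟨rfl, h10⟩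
      · have h2 := h1.1 rfl
        linarith only [h2, (hk 1).1, (hk 1).2, (hk 2).1, (hk 2).2, (hk 3).1, (hk 3).2, (hk 4).1,
          (hk 4).2, (hk 5).1, (hk 5).2, (hk 6).1, (hk 6).2, (hk 7).1, (hk 7).2, (hk 8).1, (hk 8).2]
      · have h2 := h1.2 rfl
        linarith only [h2, (hk 1).1, (hk 1).2, (hk 2).1, (hk 2).2, (hk 3).1, (hk 3).2, (hk 4).1,
          (hk 4).2, (hk 5).1, (hk 5).2, (hk 6).1, (hk 6).2, (hk 7).1, (hk 7).2, (hk 8).1, (hk 8).2]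
    have h4 : 3.141592 * (e - (1 - H + H ^ 2 / 2 + H ^ 3 / 2 - 5 / 8 * H ^ 4)) ≤
        π * (e - (1 - H + H ^ 2 / 2 + H ^ 3 / 2 - 5 / 8 * H ^ 4)) := by
      gcongr
      linarith
    have h5 : π * √(halfTan H) ≤ π * (1 - H + H ^ 2 / 2 + H ^ 3 / 2 - 5 / 8 * H ^ 4) := by
      gcongr
    linarith only [h4, h5, hpoly]

/-- Twice the bulk bound of `lintegral_bulk_nestBound_large` in the limit of infinite H, where there
is no wall. At the critical height y⁴ = 1/3. -/
lemma numeric_bulk : 1.89 * (2 * √critHeight * (1 + 1 / 30)) +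
    1.926 * bulkPoly (√(2 * critHeight)) ≤ 8.2638 := by
  have hc := critHeight_bounds
  have hc0 := critHeight_pos
  have hu0 : 0 < √critHeight := sqrt_pos.2 hc0
  have hu : √critHeight ^ 2 = critHeight := sq_sqrt hc0.le
  have hub : √critHeight ≤ 0.537287 := by nlinarith
  have hy0 : 0 < √(2 * critHeight) := by positivity
  have hy : √(2 * critHeight) ^ 2 = 2 * critHeight := sq_sqrt (by positivity)
  have hyb : √(2 * critHeight) ≤ 0.759837 := by nlinarith
  have e : bulkPoly (√(2 * critHeight)) = √(2 * critHeight) * (9 / 2 - 21 / 60 + 95 / 1296 -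
      97 / 8775) := by
    have h4 : √(2 * critHeight) ^ 4 = 1 / 3 := by
      rw [show √(2 * critHeight) ^ 4 = (√(2 * critHeight) ^ 2) ^ 2 by ring, hy, mul_pow,
        critHeight_sq]; norm_num
    rw [bulkPoly]
    generalize √(2 * critHeight) = y at *
    rw [show y ^ 5 = y * y ^ 4 by ring, show y ^ 9 = y * (y ^ 4) ^ 2 by ring,
      show y ^ 13 = y * (y ^ 4) ^ 3 by ring, h4]
    ring
  rw [e]
  generalize √(2 * critHeight) = y at *
  linarith only [hub, hyb]

/-- The number 5.397 is just below π/0.582: multiplied by 0.582 y, it offsets almost all of the wall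
term πy. -/
lemma large_height_poly {q : ℝ} (hq : 0 ≤ q) (h : 3 * q ≤ 1) :
    (1 - q / 2 - q ^ 2 / 8) * (0.707107 * (5 - 2 / 3 * q + 6 / 5 * q ^ 2 - 2 / 7 * q ^ 3 +
      53 / 72 * q ^ 4) - 0.1429 * (1 / 4 + 2 * (1 - q) * (1 - 2 * q + 3 * q ^ 2 - 4 * q ^ 3))) -
      1.926 * (9 / 2 - 21 / 20 * q + 95 / 144 * q ^ 2 - 97 / 325 * q ^ 3) ≤ -5.397 + 0.04 := by
  have h2 : q ^ 2 ≤ 1 / 3 * q := by nlinarith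
  have h3 : q ^ 3 ≤ 1 / 3 * q ^ 2 := by nlinarith [sq_nonneg q]
  have h4 : q ^ 4 ≤ 1 / 3 * q ^ 3 := by nlinarith [pow_nonneg hq 3]
  have h5 : q ^ 5 ≤ 1 / 3 * q ^ 4 := by nlinarith [pow_nonneg hq 4]
  have h6 : q ^ 6 ≤ 1 / 3 * q ^ 5 := by nlinarith [pow_nonneg hq 5]
  nlinarith [pow_nonneg hq 6, pow_nonneg hq 5, pow_nonneg hq 4, pow_nonneg hq 3]

/-- Replaces √2, √(1 - q) and 1/(1 + q)² by rational or polynomial bounds in the favourable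
direction, so that only a polynomial in q remains. -/
lemma large_outer_ineq {q S : ℝ} (hq0 : 0 < q) (hq3 : 3 * q ≤ 1) (hS0 : 0 < S)
    (hSle : S ≤ 1 - q / 2 - q ^ 2 / 8) :
    0 ≤ 0.707107 * (5 - 2 / 3 * q + 6 / 5 * q ^ 2 - 2 / 7 * q ^ 3 +
      53 / 72 * q ^ 4) - 0.1429 * (1 / 4 + 2 * (1 - q) * (1 - 2 * q + 3 * q ^ 2 - 4 * q ^ 3)) ∧
    S * (√2 / 2 * (5 - 2 / 3 * q + 6 / 5 * q ^ 2 - 2 / 7 * q ^ 3 + 53 / 72 * q ^ 4 -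
        9 / 44 * q ^ 5 + 9 / 104 * q ^ 6) -
          (1.463 * √2 - 1.926) * (1 / 4 + 2 * (1 - q) / (1 + q) ^ 2)) ≤
      (1 - q / 2 - q ^ 2 / 8) * (0.707107 * (5 - 2 / 3 * q + 6 / 5 * q ^ 2 - 2 / 7 * q ^ 3 +
      53 / 72 * q ^ 4) - 0.1429 * (1 / 4 + 2 * (1 - q) * (1 - 2 * q + 3 * q ^ 2 - 4 * q ^ 3))) := by
  have h2l : 1.4142135 ≤ √2 := le_sqrt_of_sq_le (by norm_num)
  have h2u : √2 ≤ 1.414214 := sqrt_le_iff.2 (by norm_num)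
  have q2 : q ^ 2 ≤ 1 / 3 * q := by nlinarith
  have q3 : q ^ 3 ≤ 1 / 3 * q ^ 2 := by nlinarith [sq_nonneg q]
  have q4 : q ^ 4 ≤ 1 / 3 * q ^ 3 := by nlinarith [pow_pos hq0 3]
  have p2 := pow_pos hq0 2
  have p3 := pow_pos hq0 3
  have p4 := pow_pos hq0 4
  have p5 := pow_pos hq0 5
  have hb0 : 0 ≤ 0.707107 * (5 - 2 / 3 * q + 6 / 5 * q ^ 2 - 2 / 7 * q ^ 3 +
      53 / 72 * q ^ 4) - 0.1429 * (1 / 4 + 2 * (1 - q) * (1 - 2 * q + 3 * q ^ 2 - 4 * q ^ 3)) := by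
    linarith
  refine ⟨hb0, ?_⟩
  have h1 : 1 - 2 * q + 3 * q ^ 2 - 4 * q ^ 3 ≤ 1 / (1 + q) ^ 2 := by
    rw [le_div_iff₀ (by positivity)]
    linarith
  have h4 : (2 * (1 - q)) * (1 - 2 * q + 3 * q ^ 2 - 4 * q ^ 3) ≤ (2 * (1 - q)) * (1 / (1 + q) ^ 2) :=
    mul_le_mul_of_nonneg_left h1 (by linarith)
  rw [mul_one_div] at h4
  have h5 : 0 ≤ 1 / 4 + 2 * (1 - q) / (1 + q) ^ 2 := by
    have : 0 ≤ 1 - q := by linarith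
    positivity
  have h6 : 0.1429 * (1 / 4 + 2 * (1 - q) / (1 + q) ^ 2) ≤
      (1.463 * √2 - 1.926) * (1 / 4 + 2 * (1 - q) / (1 + q) ^ 2) :=
    mul_le_mul_of_nonneg_right (by linarith only [h2l]) h5
  set c := 5 - 2 / 3 * q + 6 / 5 * q ^ 2 - 2 / 7 * q ^ 3 + 53 / 72 * q ^ 4 with hc
  have h8 : q ^ 6 ≤ q ^ 5 := by nlinarith
  have h10 : 0 ≤ c := by linarith
  have h7 : √2 / 2 * (c - 9 / 44 * q ^ 5 + 9 / 104 * q ^ 6) ≤ √2 / 2 * c :=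
    mul_le_mul_of_nonneg_left (by linarith) (by positivity)
  have h9 : √2 / 2 * c ≤ 0.707107 * c := mul_le_mul_of_nonneg_right (by linarith) h10
  refine le_trans (mul_le_mul_of_nonneg_left ?_ hS0.le) (mul_le_mul_of_nonneg_right hSle hb0)
  linarith

lemma totalCost_large {H : ℝ} (h : critHeight ≤ H) : totalCost H ≤ ENNReal.ofReal (1.538 * π) := by
  have hc0 := critHeight_pos
  have hc := critHeight_bounds
  have hH : 0 < H := hc0.trans_le h
  have h12 := (critHeight_le_iff hH).1 h
  have hz3 := halfTan_sq_le hH h12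
  obtain ⟨hz, hz1, htz, -⟩ := halfTan_spec hH
  have hR := rowNeg_halfTan hH h12
  set y := √(halfTan H) with hyd
  have hyz : halfTan H = y ^ 2 := (sq_sqrt hz.le).symm
  have hy0 : 0 < y := sqrt_pos.2 hz
  have hA := lintegral_bulk_nestBound_large h
  have hJ := lintegral_rowAll_large hH h12
  rw [← hyd] at hA
  rw [hyz] at hJ hz3 htz hR
  have hnum := numeric_bulk
  have hq3 : 3 * y ^ 4 ≤ 1 := by linarith [show (y ^ 2) ^ 2 = y ^ 4 by ring]
  have hq0 : 0 < y ^ 4 := by positivity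
  have hS : √(1 - y ^ 4) ^ 2 = 1 - y ^ 4 := sq_sqrt (by linarith)
  have hS0 : 0 < √(1 - y ^ 4) := sqrt_pos.2 (by linarith)
  have hSle : √(1 - y ^ 4) ≤ 1 - y ^ 4 / 2 - (y ^ 4) ^ 2 / 8 := by
    apply sqrt_le_iff.2
    constructor
    · nlinarith
    · nlinarith [pow_pos hq0 3, pow_pos hq0 4]
  set S := √(1 - y ^ 4)
  have h2l : 1.4142135 ≤ √2 := le_sqrt_of_sq_le (by norm_num)
  have h2u : √2 ≤ 1.414214 := sqrt_le_iff.2 (by norm_num)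
  have h22 : √2 ^ 2 = 2 := sq_sqrt (by norm_num)
  have hsH : √H = S / (2 * y) := by
    have h2 : (2 * y) = √(4 * y ^ 2) := by
      rw [show 4 * y ^ 2 = (2 * y) ^ 2 by ring, sqrt_sq (by positivity)]
    rw [h2, ← sqrt_div' _ (by positivity)]
    congr 1
    refine htz.trans ?_
    ring
  have hHS : H = S ^ 2 / (4 * y ^ 2) := by rw [hS]; refine htz.trans ?_; ring
  have hHR : √H * (H * rowNeg H) = y * (S * (1 / 4 + 2 * (1 - y ^ 4) / (1 + y ^ 4) ^ 2)) := by
    have e1 : 1 - (y ^ 2) ^ 2 = S ^ 2 := by rw [hS]; ring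
    rw [hR, hsH, e1, ← hS]
    nth_rewrite 1 [hHS]
    field_simp
    ring
  have h2H : √(2 * H) * tailPoly (y ^ 2) = y * (S * (√2 / 2 * (5 - 2 / 3 * y ^ 4 +
      6 / 5 * (y ^ 4) ^ 2 - 2 / 7 * (y ^ 4) ^ 3 + 53 / 72 * (y ^ 4) ^ 4 - 9 / 44 * (y ^ 4) ^ 5 +
      9 / 104 * (y ^ 4) ^ 6))) := by
    rw [sqrt_mul (by norm_num), hsH, tailPoly]
    field_simp
  set q := y ^ 4 with hqd
  set b := 0.707107 * (5 - 2 / 3 * q + 6 / 5 * q ^ 2 - 2 / 7 * q ^ 3 +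
      53 / 72 * q ^ 4) - 0.1429 * (1 / 4 + 2 * (1 - q) * (1 - 2 * q + 3 * q ^ 2 - 4 * q ^ 3)) with hb
  obtain ⟨hb0, hSb⟩ := large_outer_ineq hq0 hq3 hS0 hSle
  have hO : √(2 * H) * tailPoly (y ^ 2) - capGain H ≤
      y * ((1 - q / 2 - q ^ 2 / 8) * b) := by
    rw [h2H, capGain, hHR]
    calc _ = y * (S * (√2 / 2 * (5 - 2 / 3 * q + 6 / 5 * q ^ 2 - 2 / 7 * q ^ 3 + 53 / 72 * q ^ 4 -
        9 / 44 * q ^ 5 + 9 / 104 * q ^ 6) -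
          (1.463 * √2 - 1.926) * (1 / 4 + 2 * (1 - q) / (1 + q) ^ 2))) := by ring
      _ ≤ _ := mul_le_mul_of_nonneg_left hSb hy0.le
  have ho : 0 ≤ y * ((1 - q / 2 - q ^ 2 / 8) * b) :=
    mul_nonneg hy0.le (mul_nonneg (hS0.le.trans hSle) hb0)
  have ha : 0 ≤ 0.945 * (2 * √critHeight * (1 + 1 / 30)) +
        0.963 * (bulkPoly (√(2 * critHeight)) - bulkPoly y) := by
    have := bulkPoly_sub_nonneg h
    rw [← hyd] at this
    positivity
  refine (totalCost_le hH ha ho hA hJ hO).trans (ENNReal.ofReal_le_ofReal ?_)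
  rw [← hyd]
  have hpoly := large_height_poly hq0.le hq3
  rw [← hb] at hpoly
  have hbulk : bulkPoly y = y * (9 / 2 - 21 / 20 * q + 95 / 144 * q ^ 2 - 97 / 325 * q ^ 3) := by
    rw [bulkPoly, hqd]; ring
  -- The slack 0.582 · 0.04 · y is paid from the margin 1.538π - 0.582 · 8.2638, which suffices for
  -- y ≤ 0.77.
  have hy1 : y ≤ 0.77 := by
    by_contra! hlt
    have : 0.77 ^ 4 < y ^ 4 := by gcongr
    norm_num at this
    linarith
  have h1 : y * ((1 - q / 2 - q ^ 2 / 8) * b - 1.926 * (9 / 2 - 21 / 20 * q + 95 / 144 * q ^ 2 -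
    97 / 325 * q ^ 3)) ≤ y * (-5.397 + 0.04) := by gcongr
  have hpi := pi_gt_d6
  have h2 : 0.582 * (2 * (0.945 * (2 * √critHeight * (1 + 1 / 30)) +
        0.963 * (bulkPoly (√(2 * critHeight)) - bulkPoly y)) + y * ((1 - q / 2 - q ^ 2 / 8) * b)) ≤
      0.582 * (8.2638 + y * (-5.397 + 0.04)) := by
    rw [hbulk]; linarith
  have h3 : 3.141592 * (1.538 - y) ≤ π * (1.538 - y) := by
    gcongr
    linarith
  linarith

lemma totalCost_le_all {H : ℝ} (hH : 0 < H) : totalCost H ≤ ENNReal.ofReal (1.538 * π) := by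
  rcases le_total H critHeight with h | h
  · exact totalCost_small hH h (Or.inl rfl)
  · exact totalCost_large h

lemma totalCost_le_of_small {H : ℝ} (hH : 0 < H) (h : H ≤ 1 / 10) :
    totalCost H ≤ ENNReal.ofReal (1.53 * π) :=
  totalCost_small hH (by linarith [critHeight_bounds]) (Or.inr ⟨rfl, h⟩)

/-! ### Transport between the two branches of a unimodal function. -/

lemma ofReal_integral_le {X : Type*} [MeasurableSpace X] {μ : Measure X} {f : X → ℝ}
    (hf : Integrable f μ) : ENNReal.ofReal (∫ x, f x ∂μ) ≤ ∫⁻ x, ENNReal.ofReal (f x) ∂μ := by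
  rw [integral_eq_lintegral_pos_part_sub_lintegral_neg_part hf]
  exact (ENNReal.ofReal_le_ofReal (sub_le_self _ ENNReal.toReal_nonneg)).trans
    ENNReal.ofReal_toReal_le

/-- `G` rises from `0` on `[0, c]` and then decreases to `0`; its derivative is `D`. -/
structure Unimodal (G D : ℝ → ℝ) (c : ℝ) : Prop where
  pos : 0 < c
  deriv : ∀ t ∈ Ici (0 : ℝ), HasDerivAt G (D t) t
  zero : G 0 = 0
  incr : ∀ t ∈ Ioo 0 c, 0 < D t
  decr : ∀ t ∈ Ioi c, D t < 0
  lim : Tendsto G atTop (𝓝 0)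

namespace Unimodal

variable {G D : ℝ → ℝ} {c : ℝ}

lemma strictMonoOn (h : Unimodal G D c) : StrictMonoOn G (Icc 0 c) := by
  refine strictMonoOn_of_deriv_pos (convex_Icc _ _)
    (fun t ht => (h.deriv t ht.1).continuousAt.continuousWithinAt) fun t ht => ?_
  rw [interior_Icc] at ht
  rw [(h.deriv t ht.1.le).deriv]
  exact h.incr t ht

lemma strictAntiOn (h : Unimodal G D c) : StrictAntiOn G (Ici c) := by
  refine strictAntiOn_of_deriv_neg (convex_Ici _)
    (fun t ht => (h.deriv t (h.pos.le.trans ht)).continuousAt.continuousWithinAt) fun t ht => ?_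
  rw [interior_Ici] at ht
  rw [(h.deriv t (h.pos.trans ht).le).deriv]
  exact h.decr t ht

lemma pos_of_mem_Ici (h : Unimodal G D c) {t : ℝ} (ht : c ≤ t) : 0 < G t := by
  have h1 : G (t + 1) < G t := h.strictAntiOn ht (by simp only [mem_Ici]; linarith) (by linarith)
  have h2 : 0 ≤ G (t + 1) := by
    refine le_of_tendsto h.lim ?_
    filter_upwards [eventually_ge_atTop (t + 1)] with u hu
    exact h.strictAntiOn.antitoneOn (by simp only [mem_Ici]; linarith)
      (by simp only [mem_Ici]; linarith) hu
  linarith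

lemma image_left (h : Unimodal G D c) : G '' Ioo 0 c = Ioo 0 (G c) := by
  have hcont : ContinuousOn G (Icc 0 c) := fun t ht =>
    (h.deriv t ht.1).continuousAt.continuousWithinAt
  apply Subset.antisymm
  · rintro _ ⟨t, ht, rfl⟩
    have h1 := h.strictMonoOn ⟨le_rfl, h.pos.le⟩ ⟨ht.1.le, ht.2.le⟩ ht.1
    rw [h.zero] at h1
    exact ⟨h1, h.strictMonoOn ⟨ht.1.le, ht.2.le⟩ ⟨h.pos.le, le_rfl⟩ ht.2⟩
  · have := intermediate_value_Ioo h.pos.le hcont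
    rwa [h.zero] at this

lemma image_right (h : Unimodal G D c) : G '' Ioi c = Ioo 0 (G c) := by
  apply Subset.antisymm
  · rintro _ ⟨t, ht, rfl⟩
    exact ⟨h.pos_of_mem_Ici (le_of_lt ht), h.strictAntiOn (mem_Ici.2 le_rfl) (Ioi_subset_Ici_self ht) ht⟩
  · rintro g ⟨hg0, hg1⟩
    obtain ⟨T, hT1, hT2⟩ := ((h.lim.eventually (gt_mem_nhds hg0)).and
      (eventually_ge_atTop c)).exists
    have hcont : ContinuousOn G (Icc c T) := fun t ht =>
      (h.deriv t (h.pos.le.trans ht.1)).continuousAt.continuousWithinAt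
    obtain ⟨t, ht, rfl⟩ := intermediate_value_Ioo' hT2 hcont ⟨hT1, hg1⟩
    exact ⟨t, ht.1, rfl⟩

lemma setLIntegral_left (h : Unimodal G D c) (f : ℝ → ENNReal) :
    ∫⁻ g in Ioo 0 (G c), f g = ∫⁻ t in Ioo 0 c, ENNReal.ofReal (D t) * f (G t) := by
  rw [← h.image_left, lintegral_image_eq_lintegral_abs_deriv_mul measurableSet_Ioo
    (fun t ht => (h.deriv t ht.1.le).hasDerivWithinAt)
    (h.strictMonoOn.injOn.mono Ioo_subset_Icc_self)]
  refine setLIntegral_congr_fun measurableSet_Ioo fun t ht => ?_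
  simp only [abs_of_pos (h.incr t ht)]

lemma setLIntegral_right (h : Unimodal G D c) (f : ℝ → ENNReal) :
    ∫⁻ g in Ioo 0 (G c), f g = ∫⁻ t in Ioi c, ENNReal.ofReal (-D t) * f (G t) := by
  rw [← h.image_right, lintegral_image_eq_lintegral_abs_deriv_mul measurableSet_Ioi
    (fun t ht => (h.deriv t (h.pos.trans ht).le).hasDerivWithinAt)
    (h.strictAntiOn.injOn.mono Ioi_subset_Ici_self)]
  refine setLIntegral_congr_fun measurableSet_Ioi fun t ht => ?_
  simp only [abs_of_neg (h.decr t ht)]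

/-- In the level variable g = G(t) the factor D(t) dt is dg, and the levels in question lie in (0,
b]. This prices the jump at the wall. -/
lemma lintegral_sublevel (h : Unimodal G D c) {b : ℝ} (q : ℝ) (hq : 0 ≤ q) :
    ∫⁻ t in Ioo 0 c, ENNReal.ofReal (D t) * ENNReal.ofReal (if G t ≤ b then q else 0) ≤
      ENNReal.ofReal (q * b) := by
  rw [← h.setLIntegral_left (fun g => ENNReal.ofReal (if g ≤ b then q else 0))]
  calc ∫⁻ g in Ioo 0 (G c), ENNReal.ofReal (if g ≤ b then q else 0)
      ≤ ∫⁻ g in Ioo 0 (G c), (Ioc 0 b).indicator (fun _ => ENNReal.ofReal q) g := by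
        refine setLIntegral_mono' measurableSet_Ioo fun g hg => ?_
        by_cases hb : g ≤ b
        · rw [if_pos hb, Set.indicator_of_mem (show g ∈ Ioc 0 b from ⟨hg.1, hb⟩)]
        · simp [if_neg hb]
    _ ≤ ∫⁻ g, (Ioc 0 b).indicator (fun _ => ENNReal.ofReal q) g := setLIntegral_le_lintegral _ _
    _ = ENNReal.ofReal (q * b) := by
        rw [lintegral_indicator measurableSet_Ioc, setLIntegral_const, Real.volume_Ioc, sub_zero,
          ENNReal.ofReal_mul hq]

/-- The integral of `D * F` is bounded by pairing the points at which `G` takes equal values. -/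
lemma integral_le (h : Unimodal G D c) {F p q : ℝ → ℝ} (hFm : Measurable F) {C : ℝ}
    (hFb : ∀ t, |F t| ≤ C) (hq : Measurable q)
    (hpq : ∀ t T, 0 < t → t < c → c < T → G t = G T → F t ≤ F T + p T + q t) :
    ENNReal.ofReal (∫ t in Ioi 0, D t * F t) ≤
      (∫⁻ t in Ioi c, ENNReal.ofReal (-D t) * ENNReal.ofReal (p t)) +
        ∫⁻ t in Ioo 0 c, ENNReal.ofReal (D t) * ENNReal.ofReal (q t) := by
  set I := Ioo 0 (G c) with hI
  set α := Function.invFunOn G (Ioo 0 c) with hα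
  set β := Function.invFunOn G (Ioi c) with hβ
  have inj1 : InjOn G (Ioo 0 c) := h.strictMonoOn.injOn.mono Ioo_subset_Icc_self
  have inj2 : InjOn G (Ioi c) := h.strictAntiOn.injOn.mono Ioi_subset_Ici_self
  have hαG : ∀ t ∈ Ioo 0 c, α (G t) = t := inj1.leftInvOn_invFunOn
  have hβG : ∀ t ∈ Ioi c, β (G t) = t := inj2.leftInvOn_invFunOn
  have hαI : ∀ g ∈ I, α g ∈ Ioo 0 c ∧ G (α g) = g := by
    intro g hg
    rw [hI, ← h.image_left] at hg
    exact ⟨Function.invFunOn_mem hg, Function.invFunOn_eq hg⟩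
  have hβI : ∀ g ∈ I, β g ∈ Ioi c ∧ G (β g) = g := by
    intro g hg
    rw [hI, ← h.image_right] at hg
    exact ⟨Function.invFunOn_mem hg, Function.invFunOn_eq hg⟩
  have hαm : AEMeasurable α (volume.restrict I) := by
    refine aemeasurable_restrict_of_monotoneOn measurableSet_Ioo fun x hx y hy hxy => ?_
    by_contra! hlt
    have := h.strictMonoOn (Ioo_subset_Icc_self (hαI y hy).1) (Ioo_subset_Icc_self (hαI x hx).1) hlt
    rw [(hαI x hx).2, (hαI y hy).2] at this
    linarith
  have hβm : AEMeasurable β (volume.restrict I) := by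
    refine aemeasurable_restrict_of_antitoneOn measurableSet_Ioo fun x hx y hy hxy => ?_
    by_contra! hlt
    have := h.strictAntiOn (Ioi_subset_Ici_self (hβI x hx).1) (Ioi_subset_Ici_self (hβI y hy).1) hlt
    rw [(hβI x hx).2, (hβI y hy).2] at this
    linarith
  have hint : ∀ γ : ℝ → ℝ, AEMeasurable γ (volume.restrict I) →
      IntegrableOn (fun g => F (γ g)) I := by
    intro γ hγ
    refine Integrable.of_bound (hFm.comp_aemeasurable hγ).aestronglyMeasurable C ?_
    exact Eventually.of_forall fun g => hFb _
  have hd1 : ∀ t ∈ Ioo 0 c, HasDerivWithinAt G (D t) (Ioo 0 c) t := fun t ht =>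
    (h.deriv t ht.1.le).hasDerivWithinAt
  have hd2 : ∀ t ∈ Ioi c, HasDerivWithinAt G (D t) (Ioi c) t := fun t ht =>
    (h.deriv t (h.pos.trans ht).le).hasDerivWithinAt
  have hc1 : EqOn (fun t => |D t| • F (α (G t))) (fun t => D t * F t) (Ioo 0 c) := by
    intro t ht
    simp only [abs_of_pos (h.incr t ht), hαG t ht, smul_eq_mul]
  have hc2 : EqOn (fun t => |D t| • F (β (G t))) (fun t => -(D t * F t)) (Ioi c) := by
    intro t ht
    simp only [abs_of_neg (h.decr t ht), hβG t ht, smul_eq_mul]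
    ring
  have i1 : IntegrableOn (fun t => D t * F t) (Ioo 0 c) := by
    refine IntegrableOn.congr_fun ?_ hc1 measurableSet_Ioo
    rw [← integrableOn_image_iff_integrableOn_abs_deriv_smul measurableSet_Ioo hd1 inj1
      (fun g => F (α g)), h.image_left]
    exact hint α hαm
  have i2 : IntegrableOn (fun t => -(D t * F t)) (Ioi c) := by
    refine IntegrableOn.congr_fun ?_ hc2 measurableSet_Ioi
    rw [← integrableOn_image_iff_integrableOn_abs_deriv_smul measurableSet_Ioi hd2 inj2
      (fun g => F (β g)), h.image_right]
    exact hint β hβm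
  have e1 : ∫ t in Ioo 0 c, D t * F t = ∫ g in I, F (α g) := by
    rw [hI, ← h.image_left, integral_image_eq_integral_abs_deriv_smul measurableSet_Ioo hd1 inj1]
    exact (setIntegral_congr_fun measurableSet_Ioo hc1).symm
  have e2 : ∫ t in Ioi c, -(D t * F t) = ∫ g in I, F (β g) := by
    rw [hI, ← h.image_right, integral_image_eq_integral_abs_deriv_smul measurableSet_Ioi hd2 inj2]
    exact (setIntegral_congr_fun measurableSet_Ioi hc2).symm
  have i2' : IntegrableOn (fun t => D t * F t) (Ioi c) := by
    simpa using i2.neg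
  -- In the level variable the falling branch enters with the opposite sign, so the integral sees
  -- only differences of F at paired points.
  have e3 : ∫ t in Ioi 0, D t * F t = ∫ g in I, (F (α g) - F (β g)) := by
    rw [integral_sub (hint α hαm) (hint β hβm), ← e1, ← e2, ← Ioc_union_Ioi_eq_Ioi h.pos.le,
      setIntegral_union (Ioc_disjoint_Ioi le_rfl) measurableSet_Ioi
        ((integrableOn_Ioc_iff_integrableOn_Ioo enorm_ne_top).2 i1) i2', integral_Ioc_eq_integral_Ioo,
        integral_neg, sub_neg_eq_add]
  have e4 := ofReal_integral_le ((hint α hαm).sub (hint β hβm))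
  rw [e3]
  refine e4.trans ?_
  have e5 : ∫⁻ g in I, ENNReal.ofReal (F (α g) - F (β g)) ≤
      ∫⁻ g in I, (ENNReal.ofReal (p (β g)) + ENNReal.ofReal (q (α g))) := by
    refine setLIntegral_mono' measurableSet_Ioo fun g hg => ?_
    have h1 := hpq (α g) (β g) (hαI g hg).1.1 (hαI g hg).1.2 (hβI g hg).1
      ((hαI g hg).2.trans (hβI g hg).2.symm)
    refine le_trans (ENNReal.ofReal_le_ofReal ?_) ENNReal.ofReal_add_le
    linarith
  refine e5.trans (le_of_eq ?_)
  have hqα : AEMeasurable (fun g => ENNReal.ofReal (q (α g))) (volume.restrict I) :=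
    (hq.comp_aemeasurable hαm).ennreal_ofReal
  rw [lintegral_add_right' _ hqα]
  congr 1
  · rw [h.setLIntegral_right fun g => ENNReal.ofReal (p (β g))]
    refine setLIntegral_congr_fun measurableSet_Ioi fun t ht => ?_
    simp only [hβG t ht]
  · rw [h.setLIntegral_left fun g => ENNReal.ofReal (q (α g))]
    refine setLIntegral_congr_fun measurableSet_Ioo fun t ht => ?_
    simp only [hαG t ht]

end Unimodal

/-! ### Pairs of heights on the same level of `gap`. -/

/-- The height at which `gap s` is largest. -/
def peak (s : ℝ) : ℝ :=
  √((√((2 * s ^ 2 + 1 / 2) ^ 2 + 12 * (s ^ 2 - 1 / 4) ^ 2) - (2 * s ^ 2 + 1 / 2)) / 6)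

/-- With m = s² - 1/4 and n = 2s² + 1/2, the numerator of `diffKer` is 2s(m² - nt² - 3t⁴), which has
exactly one positive zero in t². -/
lemma unimodal_gap {s : ℝ} (hs : 0 < s) (hs' : s ≠ 1 / 2) :
    Unimodal (gap s) (diffKer s) (peak s) := by
  set n := 2 * s ^ 2 + 1 / 2 with hn
  set m := s ^ 2 - 1 / 4 with hm
  have hm0 : 0 < m ^ 2 := by
    have : m ≠ 0 := by
      intro h
      have : (s - 1 / 2) * (s + 1 / 2) = 0 := by rw [← h, hm]; ring
      rcases mul_eq_zero.1 this with h | h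
      · exact hs' (by linarith)
      · linarith
    positivity
  have hn0 : 0 < n := by positivity
  set r := √(n ^ 2 + 12 * m ^ 2) with hr
  have hr2 : r ^ 2 = n ^ 2 + 12 * m ^ 2 := sq_sqrt (by positivity)
  have hrn : n < r := by rw [hr]; apply lt_sqrt_of_sq_lt; linarith
  have hp0 : 0 < peak s := sqrt_pos.2 (by simp only [← hn, ← hm, ← hr]; linarith)
  have hp2 : peak s ^ 2 = (r - n) / 6 := sq_sqrt (by linarith)
  have hnum : ∀ t, (s ^ 2 - 1 / 4 - t ^ 2) ^ 2 - t ^ 2 * (1 + 4 * t ^ 2) =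
      (peak s ^ 2 - t ^ 2) * ((r + n) / 2 + 3 * t ^ 2) := by
    intro t
    rw [hp2]
    have : m ^ 2 = (r ^ 2 - n ^ 2) / 12 := by linarith
    linear_combination this
  have hq : ∀ t, 0 < quart s t := fun t => quart_pos_of_half hs hs'
  have hr0 : 0 < r := hn0.trans hrn
  refine ⟨hp0, fun t _ => hasDerivAt_gap (hq t).ne', by simp [gap], ?_, ?_, ?_⟩
  · intro t ht
    have h1 : t ^ 2 < peak s ^ 2 := pow_lt_pow_left₀ ht.2 ht.1.le (by norm_num)
    have h2 : 0 < peak s ^ 2 - t ^ 2 := by linarith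
    have := hq t
    rw [diffKer, hnum]
    positivity
  · intro t ht
    have h1 : peak s ^ 2 < t ^ 2 := pow_lt_pow_left₀ ht hp0.le (by norm_num)
    have h2 : 0 < t ^ 2 - peak s ^ 2 := by linarith
    have := hq t
    rw [diffKer, hnum, ← neg_pos]
    have e : -(2 * s * ((peak s ^ 2 - t ^ 2) * ((r + n) / 2 + 3 * t ^ 2)) / quart s t ^ 2) =
        2 * s * ((t ^ 2 - peak s ^ 2) * ((r + n) / 2 + 3 * t ^ 2)) / quart s t ^ 2 := by ring
    rw [e]
    positivity
  · have h1 : ∀ᶠ t : ℝ in atTop, ‖gap s t‖ ≤ 2 * s / t := by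
      filter_upwards [eventually_ge_atTop 1] with t ht
      have ht0 : 0 < t := by linarith
      have h2 : t ^ 2 ≤ quart s t := by rw [quart_eq]; nlinarith [sq_nonneg (s ^ 2 - 1 / 4 + t ^ 2)]
      have h3 := hq t
      rw [gap, norm_of_nonneg (by positivity), div_le_div_iff₀ h3 ht0]
      nlinarith
    exact squeeze_zero_norm' h1 (tendsto_const_nhds.div_atTop tendsto_id)

lemma nest_nonneg (s t : ℝ) : 0 ≤ nest s t := sqrt_nonneg _

lemma nest_le_one (s : ℝ) {t : ℝ} : nest s t ≤ 1 := by
  have : 0 ≤ (s ^ 2 - 1 / 4) ^ 2 / quart s t := div_nonneg (sq_nonneg _) (quart_nonneg s t)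
  exact sqrt_le_iff.2 ⟨zero_le_one, by linarith⟩

lemma mul_quart_of_gap_eq {s t T : ℝ} (hs : 0 < s) (hs' : s ≠ 1 / 2) (h : gap s t = gap s T) :
    t * quart s T = T * quart s t := by
  have h1 := quart_pos_of_half (t := t) hs hs'
  have h2 := quart_pos_of_half (t := T) hs hs'
  rw [gap, gap, div_eq_div_iff h1.ne' h2.ne'] at h
  have : 2 * s * (t * quart s T - T * quart s t) = 0 := by linarith
  rcases mul_eq_zero.1 this with h | h
  · linarith
  · linarith

/-- Equal levels mean t/T = `quart s t` / `quart s T`, and `quart s t` ≥ (s² - 1/4)². So t cannot be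
too small compared with T, which improves the trivial bound √(T - t) ≤ √T. -/
lemma sqrt_sub_le_nest {s t T : ℝ} (hs : 0 < s) (hs' : s ≠ 1 / 2) (ht : 0 < t) (hT : t < T)
    (h : gap s t = gap s T) : √(T - t) ≤ √T * nest s T := by
  have h0 := mul_quart_of_gap_eq hs hs' h
  have h2 := quart_pos_of_half (t := T) hs hs'
  have hT0 : 0 < T := ht.trans hT
  rw [nest, ← sqrt_mul hT0.le]
  apply sqrt_le_sqrt
  have h3 : (s ^ 2 - 1 / 4) ^ 2 ≤ quart s t := by
    have e : quart s t = (s ^ 2 - 1 / 4) ^ 2 + t ^ 2 * ((s - 1 / 2) ^ 2 + (s + 1 / 2) ^ 2) + t ^ 4 := by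
      unfold quart; ring
    rw [e]
    have : 0 ≤ t ^ 2 * ((s - 1 / 2) ^ 2 + (s + 1 / 2) ^ 2) := by positivity
    nlinarith [pow_pos ht 4]
  have h4 : t = T * (quart s t / quart s T) := by field_simp; linarith
  have h5 : (s ^ 2 - 1 / 4) ^ 2 / quart s T ≤ quart s t / quart s T := by gcongr
  nlinarith

/-- With A and B the squares of s ∓ 1/2, cancelling T - t in the equal-level equation gives tT(A + B
+ t² + tT + T²) = AB. Near s = 1/2 this forces the lower partner of a moderate T to be tiny. -/
lemma mul_le_of_gap_eq {s t T : ℝ} (hs : 0 < s) (hs' : s ≠ 1 / 2) (ht : 0 < t) (hT : t < T)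
    (h : gap s t = gap s T) : t * T ≤ (s - 1 / 2) ^ 2 := by
  have h0 := mul_quart_of_gap_eq hs hs' h
  have hT0 : 0 < T := ht.trans hT
  set A := (s - 1 / 2) ^ 2 with hA
  set B := (s + 1 / 2) ^ 2 with hB
  have hA0 : 0 ≤ A := sq_nonneg _
  have hB0 : 0 < B := by positivity
  have e : (T - t) * (t * T * (A + B + t ^ 2 + t * T + T ^ 2) - A * B) = 0 := by
    have h1 : t * ((A + T ^ 2) * (B + T ^ 2)) = T * ((A + t ^ 2) * (B + t ^ 2)) := h0
    linear_combination h1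
  have e2 : t * T * (A + B + t ^ 2 + t * T + T ^ 2) = A * B := by
    rcases mul_eq_zero.1 e with h | h
    · linarith
    · linarith
  have h3 : 0 < t * T := by positivity
  by_contra! hlt
  nlinarith [mul_pos h3 h3, mul_pos h3 (pow_pos ht 2), mul_pos h3 (pow_pos hT0 2),
    mul_nonneg h3.le hA0, mul_lt_mul_of_pos_right hlt hB0]

/-! ### The cost of a single column. -/

/-- A bounded and `1/2`-Hölder continuous function of one variable. -/
structure IsColumn (φ : ℝ → ℝ) (β τ : ℝ) : Prop where
  bound : ∀ y, |φ y| ≤ β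
  holder : ∀ y y', |φ y - φ y'| ≤ τ * √|y - y'|

/-- The odd extension from the half line `[0, ∞)`. -/
def oddCol (φ : ℝ → ℝ) (y : ℝ) : ℝ := if 0 ≤ y then φ y else -φ (-y)

/-- The odd extension of `φ`, cut off at distance `a` from `b` and folded at `b`. -/
def foldCol (φ : ℝ → ℝ) (b a t : ℝ) : ℝ := if t < a then oddCol φ (b + t) + oddCol φ (b - t) else 0

namespace IsColumn

variable {φ : ℝ → ℝ} {β τ : ℝ}

lemma bound_nonneg (h : IsColumn φ β τ) : 0 ≤ β := (abs_nonneg _).trans (h.bound 0)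

lemma le_bound (h : IsColumn φ β τ) (y : ℝ) : φ y ≤ β := (abs_le.1 (h.bound y)).2

lemma neg_le_bound (h : IsColumn φ β τ) (y : ℝ) : -β ≤ φ y := (abs_le.1 (h.bound y)).1

lemma sub_le (h : IsColumn φ β τ) (hτ : 0 ≤ τ) {y y' d : ℝ} (h1 : |y - y'| ≤ d) :
    φ y - φ y' ≤ τ * √d :=
  (le_abs_self _).trans ((h.holder y y').trans (by gcongr))

lemma continuous (h : IsColumn φ β τ) : Continuous φ := by
  rw [continuous_iff_continuousAt]
  intro y
  rw [ContinuousAt, tendsto_iff_norm_sub_tendsto_zero]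
  refine squeeze_zero (fun _ => norm_nonneg _) (fun y' => h.holder y' y) ?_
  have : Continuous fun y' : ℝ => τ * √|y' - y| := by fun_prop
  simpa using this.tendsto y

lemma abs_oddCol_le (h : IsColumn φ β τ) (y : ℝ) : |oddCol φ y| ≤ β := by
  unfold oddCol; split_ifs
  · exact h.bound _
  · rw [abs_neg]; exact h.bound _

lemma measurable_oddCol (h : IsColumn φ β τ) : Measurable (oddCol φ) :=
  Measurable.ite measurableSet_Ici h.continuous.measurable
    (h.continuous.measurable.comp measurable_neg).neg

lemma measurable_foldCol (h : IsColumn φ β τ) (b a : ℝ) : Measurable (foldCol φ b a) :=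
  Measurable.ite measurableSet_Iio
    ((h.measurable_oddCol.comp (measurable_const.add measurable_id)).add
      (h.measurable_oddCol.comp (measurable_const.sub measurable_id))) measurable_const

lemma abs_foldCol_le (h : IsColumn φ β τ) (b a t : ℝ) : |foldCol φ b a t| ≤ 2 * β := by
  have := h.bound_nonneg
  unfold foldCol; split_ifs
  · refine (abs_add_le _ _).trans ?_
    linarith [h.abs_oddCol_le (b + t), h.abs_oddCol_le (b - t)]
  · simpa using this

end IsColumn

/-- The allowed increment of a folded column down to the height `T`, per unit Hölder constant. -/
def incr (s H T : ℝ) : ℝ :=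
  if T < H then 2 * (√T * nest s T) else if T < 2 * H then √T * nest s T else √(2 * H)

lemma incr_nonneg (s H T : ℝ) : 0 ≤ incr s H T := by
  have := nest_nonneg s T
  unfold incr; split_ifs <;> positivity

/-- Below the wall both arms of the fold move by the nested Hölder amount. If the wall lies between
t and T, the jump is at most 2β, which covers the lower arm at an axis or the whole fold where the
square ends. Above an axis wall the fold is a difference of φ at two points 2b apart, hence at most
τ√(2b) in size. -/
lemma foldCol_le {φ : ℝ → ℝ} {β τ b a s t T : ℝ} (hφ : IsColumn φ β τ) (hτ : 0 ≤ τ) (hb : 0 < b)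
    (ht : 0 < t) (hT : t < T) (hn : √(T - t) ≤ √T * nest s T) :
    foldCol φ b a t ≤ foldCol φ b a T + τ * incr s (min b a) T +
      ((if t ≤ min b a ∧ min b a ≤ T then 2 * β else 0) +
        if min b a < t then τ * √(2 * min b a) else 0) := by
  have hT0 : 0 < T := ht.trans hT
  have hβ := hφ.bound_nonneg
  have hd : ∀ y y', |y - y'| ≤ T - t → φ y - φ y' ≤ τ * (√T * nest s T) := fun y y' h =>
    (hφ.sub_le hτ h).trans (by gcongr)
  have hinc := mul_nonneg hτ (incr_nonneg s (min b a) T)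
  have hub := hφ.le_bound
  have hlb := hφ.neg_le_bound
  rcases lt_or_ge T (min b a) with hTH | hTH
  · have hTb : T < b := hTH.trans_le (min_le_left _ _)
    have hTa : T < a := hTH.trans_le (min_le_right _ _)
    rw [if_neg (by intro h; linarith [h.2]), if_neg (by linarith), incr, if_pos hTH, foldCol,
      foldCol, if_pos hTa, if_pos (hT.trans hTa), oddCol, oddCol, oddCol, oddCol,
      if_pos (by linarith), if_pos (by linarith), if_pos (by linarith), if_pos (by linarith)]
    have h1 := hd (b + t) (b + T) (by rw [abs_le]; constructor <;> linarith)
    have h2 := hd (b - t) (b - T) (by rw [abs_le]; constructor <;> linarith)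
    linarith
  rcases le_or_gt t (min b a) with htH | htH
  · rw [if_pos ⟨htH, hTH⟩, if_neg (by linarith)]
    rcases le_or_gt a T with haT | haT
    · have h1 := (le_abs_self _).trans (hφ.abs_foldCol_le b a t)
      have h2 : foldCol φ b a T = 0 := if_neg (by linarith)
      rw [h2]; linarith
    · have hmin : min b a = b := by
        rcases min_choice b a with h | h
        · exact h
        · rw [h] at hTH; linarith
      rw [hmin] at hTH htH hinc ⊢
      have e1 : foldCol φ b a t = φ (b + t) + φ (b - t) := by
        rw [foldCol, if_pos (by linarith), oddCol, oddCol, if_pos (by linarith),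
          if_pos (by linarith)]
      have e2 : foldCol φ b a T = φ (b + T) + oddCol φ (b - T) := by
        rw [foldCol, if_pos haT]
        congr 1
        exact if_pos (by linarith)
      rw [e1, e2, incr, if_neg (by linarith)]
      split_ifs with h2
      · have h3 := hd (b + t) (b + T) (by rw [abs_le]; constructor <;> linarith)
        have h4 := (abs_le.1 (hφ.abs_oddCol_le (b - T))).1
        linarith [hub (b - t)]
      · have e3 : oddCol φ (b - T) = -φ (T - b) := by
          rw [oddCol, if_neg (by linarith), neg_sub]
        -- For T ≥ 2b it is cheaper to compare the two arms at T with each other: they sit at T - b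
        -- and T + b, at distance 2b however large T is.
        have h3 := hφ.sub_le hτ (y := T - b) (y' := b + T) (d := 2 * b)
          (by rw [abs_le]; constructor <;> linarith)
        rw [e3]
        linarith [hub (b + t), hub (b - t)]
  · rw [if_neg (by intro h; linarith [h.1]), if_pos htH]
    have hsq : 0 ≤ τ * √(2 * min b a) := by positivity
    rcases le_or_gt a t with hat | hat
    · have h1 : foldCol φ b a t = 0 := if_neg (by linarith)
      have h2 : foldCol φ b a T = 0 := if_neg (by linarith)
      rw [h1, h2]; linarith
    · have hmin : min b a = b := by
        rcases min_choice b a with h | h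
        · exact h
        · rw [h] at htH; linarith
      rw [hmin] at hTH htH hinc hsq ⊢
      have e1 : foldCol φ b a t = φ (b + t) - φ (t - b) := by
        rw [foldCol, if_pos hat, oddCol, oddCol, if_pos (by linarith), if_neg (by linarith), neg_sub]
        ring
      have h5 := hφ.sub_le hτ (y := b + t) (y' := t - b) (d := 2 * b)
          (by rw [abs_le]; constructor <;> linarith)
      rcases le_or_gt a T with haT | haT
      · have h2 : foldCol φ b a T = 0 := if_neg (by linarith)
        rw [e1, h2]; linarith
      · have e2 : foldCol φ b a T = φ (b + T) - φ (T - b) := by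
          rw [foldCol, if_pos haT, oddCol, oddCol, if_pos (by linarith), if_neg (by linarith),
            neg_sub]
          ring
        rw [e1, e2, incr, if_neg (by linarith)]
        split_ifs with h2
        · have h3 := hd (b + t) (b + T) (by rw [abs_le]; constructor <;> linarith)
          have h4 := hd (T - b) (t - b) (by rw [abs_le]; constructor <;> linarith)
          have h6 : √T * nest s T ≤ √(2 * b) := by
            calc √T * nest s T ≤ √T * 1 := by gcongr; exact nest_le_one s
              _ ≤ √(2 * b) := by rw [mul_one]; exact sqrt_le_sqrt h2.le
          have h7 : τ * (√T * nest s T) ≤ τ * √(2 * b) := by gcongr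
          linarith
        · have h3 := hφ.sub_le hτ (y := T - b) (y' := b + T) (d := 2 * b)
            (by rw [abs_le]; constructor <;> linarith)
          linarith

/-- The cost of the column at abscissa `s` for a wall at distance `H`. -/
def colCost (τ s H : ℝ) : ENNReal :=
  ENNReal.ofReal (√(2 * s) * gap s H) + ENNReal.ofReal τ *
    (2 * (∫⁻ t in Ioo 0 H, ENNReal.ofReal √t * ENNReal.ofReal (-diffKer s t * nest s t)) +
      ((∫⁻ t in Ioo H (2 * H), ENNReal.ofReal √t * ENNReal.ofReal (-diffKer s t * nest s t)) +
        (ENNReal.ofReal √(2 * H) * (∫⁻ t in Ioi (2 * H), ENNReal.ofReal (-diffKer s t)) +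
          ENNReal.ofReal √(2 * H) * ∫⁻ t in Ioi H, ENNReal.ofReal (diffKer s t))))

lemma lintegral_incr_le {τ s H : ℝ} (hτ : 0 ≤ τ) (hH : 0 < H) :
    ∫⁻ t in Ioi 0, ENNReal.ofReal (-diffKer s t) * ENNReal.ofReal (τ * incr s H t) ≤
      ENNReal.ofReal τ *
    (2 * (∫⁻ t in Ioo 0 H, ENNReal.ofReal √t * ENNReal.ofReal (-diffKer s t * nest s t)) +
      ((∫⁻ t in Ioo H (2 * H), ENNReal.ofReal √t * ENNReal.ofReal (-diffKer s t * nest s t)) +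
        ENNReal.ofReal √(2 * H) * (∫⁻ t in Ioi (2 * H), ENNReal.ofReal (-diffKer s t)))) := by
  have h1 := (setLIntegral_Ioi_le (fun t => ENNReal.ofReal (-diffKer s t) *
    ENNReal.ofReal (τ * incr s H t)) (a := 0) (b := H)).trans (add_le_add_right
      (setLIntegral_Ioi_le _ (a := H) (b := 2 * H)) _)
  refine h1.trans ?_
  rw [mul_add, mul_add]
  have hn := nest_nonneg s
  gcongr ?_ + (?_ + ?_)
  · rw [← mul_assoc, ← lintegral_const_mul' _ _ (by finiteness)]
    refine setLIntegral_mono' measurableSet_Ioo fun t ht => le_of_eq ?_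
    rw [incr, if_pos ht.2, ENNReal.ofReal_mul hτ, ENNReal.ofReal_mul (by norm_num),
      ENNReal.ofReal_mul (sqrt_nonneg t), ENNReal.ofReal_mul' (hn t), ENNReal.ofReal_ofNat]
    ring
  · rw [← lintegral_const_mul' _ _ (by finiteness)]
    refine setLIntegral_mono' measurableSet_Ioo fun t ht => le_of_eq ?_
    rw [incr, if_neg (not_lt.2 ht.1.le), if_pos ht.2, ENNReal.ofReal_mul hτ,
      ENNReal.ofReal_mul (sqrt_nonneg t), ENNReal.ofReal_mul' (hn t)]
    ring
  · rw [← lintegral_const_mul' _ _ (by finiteness), ← lintegral_const_mul' _ _ (by finiteness)]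
    refine setLIntegral_mono' measurableSet_Ioi fun t ht => le_of_eq ?_
    have ht' : 2 * H < t := ht
    rw [incr, if_neg (by linarith), if_neg (by linarith), ENNReal.ofReal_mul hτ]
    ring

lemma measurable_nest : Measurable (fun p : ℝ × ℝ => nest p.1 p.2) := by
  unfold nest quart; fun_prop

/-- The levels of all pairs straddling the wall lie below `gap s H`, so by
`Unimodal.lintegral_sublevel` the jumps cost at most √(2s) `gap s H` in total. -/
lemma gap_le_of_pair {s H t T : ℝ} (hs : 0 < s) (hs' : s ≠ 1 / 2) (ht : 0 < t)
    (htc : t < peak s) (hTc : peak s < T) (h : gap s t = gap s T) (h1 : t ≤ H) (h2 : H ≤ T) :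
    gap s t ≤ gap s H := by
  have hu := unimodal_gap hs hs'
  rcases le_total H (peak s) with hc | hc
  · exact hu.strictMonoOn.monotoneOn ⟨ht.le, htc.le⟩ ⟨ht.le.trans h1, hc⟩ h1
  · rw [h]
    exact hu.strictAntiOn.antitoneOn hc hTc.le h2

/-- The column functional is bounded by the cost of the column, even after adding what can be
saved on the negative part of the kernel. -/
lemma col_add_saving_le {φ : ℝ → ℝ} {β τ b a s : ℝ} {g : ℝ → ℝ} (hφ : IsColumn φ β τ)
    (hs : 0 < s) (hs' : s ≠ 1 / 2) (hβ : 2 * β ≤ √(2 * s)) (hτ : 0 ≤ τ) (hb : 0 < b) (ha : 0 < a)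
    (hg0 : ∀ t, 0 ≤ g t) (hgp : ∀ t, g t ≤ τ * incr s (min b a) t)
    (hg : ∀ t T, 0 < t → t < T → gap s t = gap s T → g T ≠ 0 →
      foldCol φ b a t ≤ foldCol φ b a T + (τ * incr s (min b a) T - g T) +
      ((if t ≤ min b a ∧ min b a ≤ T then √(2 * s) else 0) +
        if min b a < t then τ * √(2 * min b a) else 0)) :
    ENNReal.ofReal (∫ t in Ioi 0, diffKer s t * foldCol φ b a t) +
      (∫⁻ t in Ioi 0, ENNReal.ofReal (-diffKer s t) * ENNReal.ofReal (g t)) ≤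
        colCost τ s (min b a) := by
  set H := min b a with hHd
  have hH : 0 < H := lt_min hb ha
  have hu := unimodal_gap hs hs'
  have hβ0 := hφ.bound_nonneg
  set q1 : ℝ → ℝ := fun t => if gap s t ≤ gap s H then √(2 * s) else 0 with hq1
  set q2 : ℝ → ℝ := fun t => if H < t then τ * √(2 * H) else 0 with hq2
  have hgm : Measurable (gap s) := measurable_gap.comp (measurable_const.prodMk measurable_id)
  have hDm : Measurable (diffKer s) := measurable_diffKer.comp (measurable_const.prodMk measurable_id)
  have hm1 : Measurable q1 := Measurable.ite (hgm measurableSet_Iic) measurable_const measurable_const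
  have hm2 : Measurable q2 := Measurable.ite measurableSet_Ioi measurable_const measurable_const
  have hpair : ∀ t T, 0 < t → t < peak s → peak s < T → gap s t = gap s T →
      foldCol φ b a t ≤ foldCol φ b a T + (τ * incr s H T - g T) + (q1 t + q2 t) := by
    intro t T ht htc hTc h
    have hT : t < T := htc.trans hTc
    have key : foldCol φ b a t ≤ foldCol φ b a T + (τ * incr s H T - g T) +
      ((if t ≤ H ∧ H ≤ T then √(2 * s) else 0) + if H < t then τ * √(2 * H) else 0) := by
      by_cases h0 : g T = 0
      · rw [h0, sub_zero]
        refine (foldCol_le hφ hτ hb ht hT (sqrt_sub_le_nest hs hs' ht hT h)).trans ?_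
        simp only [← hHd]
        gcongr
        split_ifs <;> linarith
      · exact hg t T ht hT h h0
    refine key.trans ?_
    have : (if t ≤ H ∧ H ≤ T then √(2 * s) else 0) ≤ q1 t := by
      simp only [hq1]
      by_cases h1 : t ≤ H ∧ H ≤ T
      · rw [if_pos h1, if_pos (gap_le_of_pair hs hs' ht htc hTc h h1.1 h1.2)]
      · rw [if_neg h1]; split_ifs <;> positivity
    simp only [hq2]
    linarith
  have h1 := hu.integral_le (hφ.measurable_foldCol b a) (hφ.abs_foldCol_le b a) (hm1.add hm2) hpair
  have hneg : ∀ f : ℝ → ENNReal, ∫⁻ t in Ioo 0 (peak s), ENNReal.ofReal (-diffKer s t) * f t = 0 := by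
    intro f
    rw [setLIntegral_congr_fun measurableSet_Ioo (g := fun _ => 0), lintegral_zero]
    intro t ht
    simp only
    rw [ENNReal.ofReal_of_nonpos (by linarith [hu.incr t ht]), zero_mul]
  have h2 : (∫⁻ t in Ioi (peak s), ENNReal.ofReal (-diffKer s t) *
      ENNReal.ofReal (τ * incr s H t - g t)) +
      (∫⁻ t in Ioi 0, ENNReal.ofReal (-diffKer s t) * ENNReal.ofReal (g t)) ≤
      ∫⁻ t in Ioi 0, ENNReal.ofReal (-diffKer s t) * ENNReal.ofReal (τ * incr s H t) := by
    refine (add_le_add_right (setLIntegral_Ioi_le _ (b := peak s)) _).trans ?_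
    rw [hneg, zero_add]
    refine (le_lintegral_add _ _).trans ?_
    refine le_trans ?_ (lintegral_mono_set (Ioi_subset_Ioi hu.pos.le))
    refine lintegral_mono fun t => ?_
    rw [← mul_add, ← ENNReal.ofReal_add (sub_nonneg.2 (hgp t)) (hg0 t), sub_add_cancel]
  have h3 : ∫⁻ t in Ioo 0 (peak s), ENNReal.ofReal (diffKer s t) * ENNReal.ofReal (q1 t + q2 t) ≤
      ENNReal.ofReal (√(2 * s) * gap s H) + ENNReal.ofReal τ * (ENNReal.ofReal √(2 * H) *
        ∫⁻ t in Ioi H, ENNReal.ofReal (diffKer s t)) := by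
    calc _ ≤ ∫⁻ t in Ioo 0 (peak s), (ENNReal.ofReal (diffKer s t) * ENNReal.ofReal (q1 t) +
          ENNReal.ofReal (diffKer s t) * ENNReal.ofReal (q2 t)) := by
          refine lintegral_mono fun t => ?_
          rw [← mul_add]
          gcongr
          exact ENNReal.ofReal_add_le
      _ = (∫⁻ t in Ioo 0 (peak s), ENNReal.ofReal (diffKer s t) * ENNReal.ofReal (q1 t)) +
          ∫⁻ t in Ioo 0 (peak s), ENNReal.ofReal (diffKer s t) * ENNReal.ofReal (q2 t) :=
          lintegral_add_left (hDm.ennreal_ofReal.mul hm1.ennreal_ofReal) _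
      _ ≤ _ := by
          gcongr
          · exact hu.lintegral_sublevel _ (sqrt_nonneg _)
          · rw [← mul_assoc, ← ENNReal.ofReal_mul hτ, ← lintegral_const_mul' _ _ (by finiteness),
              ← lintegral_indicator measurableSet_Ioi]
            refine (setLIntegral_le_lintegral _ _).trans (lintegral_mono fun t => ?_)
            simp only [hq2]
            by_cases h : H < t
            · rw [if_pos h, Set.indicator_of_mem (show t ∈ Ioi H from h), mul_comm]
            · rw [if_neg h]; simp
  have h4 := lintegral_incr_le (s := s) hτ hH
  rw [colCost]
  calc _ ≤ _ := add_le_add_left h1 _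
    _ = ((∫⁻ t in Ioi (peak s), ENNReal.ofReal (-diffKer s t) *
      ENNReal.ofReal (τ * incr s H t - g t)) +
      (∫⁻ t in Ioi 0, ENNReal.ofReal (-diffKer s t) * ENNReal.ofReal (g t))) +
      ∫⁻ t in Ioo 0 (peak s), ENNReal.ofReal (diffKer s t) * ENNReal.ofReal (q1 t + q2 t) := by
        simp only [Pi.add_apply]; ring
    _ ≤ _ := add_le_add (h2.trans h4) h3
    _ = _ := by ring

lemma col_le {φ : ℝ → ℝ} {β τ b a s : ℝ} (hφ : IsColumn φ β τ)
    (hs : 0 < s) (hs' : s ≠ 1 / 2) (hβ : 2 * β ≤ √(2 * s)) (hτ : 0 ≤ τ) (hb : 0 < b) (ha : 0 < a) :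
    ENNReal.ofReal (∫ t in Ioi 0, diffKer s t * foldCol φ b a t) ≤ colCost τ s (min b a) := by
  have h := col_add_saving_le (g := fun _ => 0) hφ hs hs' hβ hτ hb ha (fun _ => le_rfl)
    (fun t => mul_nonneg hτ (incr_nonneg _ _ _)) (fun _ _ _ _ _ h => absurd rfl h)
  simpa using h

/-! ### Summing the column costs. -/

lemma lintegral_row_rowNeg_swap {S : Set ℝ} {k : ℝ × ℝ → ℝ} (hk : Measurable k) (c : ℝ → ENNReal)
    (hc : Measurable c) :
    ∫⁻ s in Ioi 0, ∫⁻ t in S, c t * ENNReal.ofReal (k (s, t)) =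
      ∫⁻ t in S, c t * ∫⁻ s in Ioi 0, ENNReal.ofReal (k (s, t)) := by
  rw [lintegral_lintegral_swap]
  · refine lintegral_congr fun t => ?_
    rw [lintegral_const_mul _ (by fun_prop)]
  · exact ((hc.comp measurable_snd).mul hk.ennreal_ofReal).aemeasurable

/-- Tonelli: exchanging columns and rows turns each term into a row mass that has been computed, and
the jump term into `lintegral_wall`. -/
lemma lintegral_colCost_le {H : ℝ} (hH : 0 < H) :
    ∫⁻ s in Ioi 0, colCost 0.582 s H ≤ totalCost H := by
  have hD := measurable_diffKer
  have hDn : Measurable (fun p : ℝ × ℝ => -diffKer p.1 p.2) := hD.neg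
  have hn : Measurable (fun p : ℝ × ℝ => -diffKer p.1 p.2 * nest p.1 p.2) :=
    hD.neg.mul measurable_nest
  have hsq : Measurable fun t : ℝ => ENNReal.ofReal √t := by fun_prop
  have hmeas : ∀ {S : Set ℝ} {k : ℝ × ℝ → ℝ} {c : ℝ → ENNReal}, Measurable k → Measurable c →
      Measurable fun s : ℝ => ∫⁻ t in S, c t * ENNReal.ofReal (k (s, t)) := by
    intro S k c hk hc
    have : Measurable fun p : ℝ × ℝ => c p.2 * ENNReal.ofReal (k p) :=
      (hc.comp measurable_snd).mul hk.ennreal_ofReal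
    exact this.lintegral_prod_right'
  have hmeas' : ∀ {S : Set ℝ} {k : ℝ × ℝ → ℝ}, Measurable k →
      Measurable fun s : ℝ => ∫⁻ t in S, ENNReal.ofReal (k (s, t)) := by
    intro S k hk
    exact hk.ennreal_ofReal.lintegral_prod_right'
  have hgap : Measurable fun s : ℝ => ENNReal.ofReal (√(2 * s) * gap s H) := by
    have : Measurable fun s : ℝ => gap s H :=
      measurable_gap.comp (measurable_id.prodMk measurable_const)
    fun_prop
  have e1 : ∀ {S : Set ℝ}, S ⊆ Ioi 0 → MeasurableSet S →
      ∫⁻ s in Ioi 0, ∫⁻ t in S, ENNReal.ofReal √t * ENNReal.ofReal (-diffKer s t * nest s t) ≤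
        ∫⁻ t in S, ENNReal.ofReal (√t * nestBound t) := by
    intro S hS hSm
    rw [lintegral_row_rowNeg_swap hn _ hsq]
    refine setLIntegral_mono' hSm fun t ht => ?_
    rw [ENNReal.ofReal_mul (sqrt_nonneg t)]
    gcongr
    exact lintegral_row_nest (hS ht)
  have e2 : ∫⁻ s in Ioi 0, ∫⁻ t in Ioi (2 * H), ENNReal.ofReal (-diffKer s t) ≤
      ∫⁻ t in Ioi (2 * H), ENNReal.ofReal (rowNeg t) := by
    rw [lintegral_lintegral_swap hD.neg.ennreal_ofReal.aemeasurable]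
    refine setLIntegral_mono' measurableSet_Ioi fun t ht => ?_
    exact (lintegral_rowNeg (lt_trans (by positivity) (mem_Ioi.1 ht))).le
  have e3 : ∫⁻ s in Ioi 0, ∫⁻ t in Ioi H, ENNReal.ofReal (diffKer s t) ≤
      ∫⁻ t in Ioi H, ENNReal.ofReal (rowPos t) := by
    rw [lintegral_lintegral_swap hD.ennreal_ofReal.aemeasurable]
    refine setLIntegral_mono' measurableSet_Ioi fun t ht => ?_
    exact lintegral_rowPos_le (hH.trans (mem_Ioi.1 ht))
  unfold colCost totalCost outerCost
  rw [lintegral_add_left hgap, lintegral_const_mul' _ _ (by finiteness),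
    lintegral_add_left ((hmeas hn hsq).const_mul 2), lintegral_add_left (hmeas hn hsq),
    lintegral_add_left ((hmeas' hDn).const_mul _),
    lintegral_const_mul' _ _ (by finiteness), lintegral_const_mul' _ _ (by finiteness),
    lintegral_const_mul' _ _ (by finiteness)]
  refine add_le_add (lintegral_wall hH) (mul_le_mul_right (add_le_add (mul_le_mul_right
    (e1 (fun t ht => ht.1) measurableSet_Ioo) _) (add_le_add
    (e1 (fun t ht => hH.trans ht.1) measurableSet_Ioo) (add_le_add (mul_le_mul_right e2 _)
    (mul_le_mul_right e3 _)))) _)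

/-! ### The saving for columns that start low. -/

lemma nest_ge_of_near {s T : ℝ} (h : |s - 1 / 2| ≤ 0.02) (hT : 1 / 4 < T) : 0.9966 ≤ nest s T := by
  obtain ⟨h1, h2⟩ := abs_le.1 h
  apply le_sqrt_of_sq_le
  have hm : (s ^ 2 - 1 / 4) ^ 2 ≤ 0.000417 := by
    have : |s ^ 2 - 1 / 4| ≤ 0.0204 := by
      rw [abs_le]; constructor <;> nlinarith
    calc (s ^ 2 - 1 / 4) ^ 2 = |s ^ 2 - 1 / 4| ^ 2 := (sq_abs _).symm
      _ ≤ 0.0204 ^ 2 := by gcongr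
      _ ≤ _ := by norm_num
  have hT2 : 0.0625 < T ^ 2 := by nlinarith
  have hq : 0.0639 ≤ quart s T := by
    rw [quart_eq]
    have : 0.042 ≤ s ^ 2 - 1 / 4 + T ^ 2 := by nlinarith
    nlinarith
  have : (s ^ 2 - 1 / 4) ^ 2 / quart s T ≤ 0.000417 / 0.0639 := by gcongr
  norm_num at this ⊢
  linarith

lemma foldCol_ge {φ : ℝ → ℝ} {β τ b a s : ℝ} (hφ : IsColumn φ β τ) (hβ : 2 * β ≤ √(2 * s)) (T : ℝ) :
    -√(2 * s) ≤ foldCol φ b a T :=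
  (neg_le_neg hβ).trans (abs_le.1 (hφ.abs_foldCol_le b a T)).1

/-- If the folded column is known to be small near its base, something is saved. -/
lemma col_add_gain_le {φ : ℝ → ℝ} {β b a s : ℝ} (hφ : IsColumn φ β 0.582)
    (hs : |s - 1 / 2| ≤ 0.02) (hs' : s ≠ 1 / 2) (hβ : 2 * β ≤ √(2 * s)) (hb : 1 / 10 ≤ b)
    (ha : 1 / 10 ≤ a) (hφb : φ b ≤ -0.495 + √|s - 1 / 2|) :
    ENNReal.ofReal (∫ t in Ioi 0, diffKer s t * foldCol φ b a t) + ENNReal.ofReal 0.66 ≤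
      colCost 0.582 s (min b a) := by
  obtain ⟨hs1, hs2⟩ := abs_le.1 hs
  have hs0 : 0 < s := by linarith
  set H := min b a with hHd
  have hH : 1 / 10 ≤ H := le_min hb ha
  -- On paired heights T in (1/4, 1) an amount 0.21 of the allowance is left unused. The kernel mass
  -- there is `gap s (1/4)` - `gap s 1` ≥ 3.18, and 0.21 · 3.18 > 0.66.
  set g : ℝ → ℝ := (Ioo (1 / 4) 1).indicator fun _ => 0.21 with hgd
  have hinc : ∀ T, 1 / 4 < T → 0.26 ≤ 0.582 * incr s H T := by
    intro T hT
    have hn := nest_ge_of_near hs hT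
    have hT1 : 0.5 ≤ √T := le_sqrt_of_sq_le (by norm_num; linarith)
    have h2 : 0.4983 ≤ √T * nest s T := by nlinarith
    unfold incr
    split_ifs
    · linarith
    · linarith
    · have : 0.447 ≤ √(2 * H) := le_sqrt_of_sq_le (by norm_num; linarith)
      linarith
  have hsq2 : √(2 * s) ≤ 1.0199 := sqrt_le_iff.2 ⟨by norm_num, by norm_num; linarith⟩
  have hsq3 : 0.97 ≤ √(2 * s) := le_sqrt_of_sq_le (by norm_num; linarith)
  have hsmall : √|s - 1 / 2| ≤ 0.14143 := sqrt_le_iff.2 ⟨by norm_num, by norm_num; linarith⟩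
  have key := col_add_saving_le (g := g) (b := b) (a := a) hφ hs0 hs' hβ (by norm_num)
    (by linarith) (by linarith)
    (fun t => indicator_nonneg (fun _ _ => by norm_num) t) ?_ ?_
  · refine le_trans ?_ key
    gcongr
    have h1 : ENNReal.ofReal (∫ t in Ioo (1 / 4) 1, -diffKer s t) ≤
        ∫⁻ t in Ioo (1 / 4) 1, ENNReal.ofReal (-diffKer s t) := by
      refine ofReal_integral_le ?_
      have hc : ContinuousOn (fun t => -diffKer s t) (Icc (1 / 4) 1) := by
        refine ContinuousOn.neg ?_
        unfold diffKer
        refine ContinuousOn.div (by fun_prop) (by unfold quart; fun_prop) fun t _ => ?_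
        exact pow_ne_zero 2 (quart_pos_of_half hs0 hs').ne'
      exact hc.integrableOn_Icc.mono_set Ioo_subset_Icc_self
    have h2 : ∫ t in Ioo (1 / 4) 1, -diffKer s t = gap s (1 / 4) - gap s 1 := by
      rw [integral_neg, ← integral_Ioc_eq_integral_Ioo,
        ← intervalIntegral.integral_of_le (by norm_num),
        intervalIntegral.integral_eq_sub_of_hasDerivAt
          (fun t _ => hasDerivAt_gap (quart_pos_of_half hs0 hs').ne')]
      · ring
      · refine ContinuousOn.intervalIntegrable ?_
        unfold diffKer
        refine ContinuousOn.div (by fun_prop) (by unfold quart; fun_prop) fun t _ => ?_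
        exact pow_ne_zero 2 (quart_pos_of_half hs0 hs').ne'
    have h3 : 0.66 / 0.21 ≤ gap s (1 / 4) - gap s 1 := by
      have e1 : 3.7 ≤ gap s (1 / 4) := by
        rw [gap, le_div_iff₀ (quart_pos_of_half hs0 hs')]
        unfold quart
        have : (s - 1 / 2) ^ 2 ≤ 0.0004 := by nlinarith
        have h5 : (s - 1 / 2) ^ 2 + (1 / 4) ^ 2 ≤ 0.0629 := by linarith
        have h6 : (s + 1 / 2) ^ 2 + (1 / 4) ^ 2 ≤ 2 * s + 0.0629 := by nlinarith
        calc _ ≤ 3.7 * (0.0629 * (2 * s + 0.0629)) := by gcongr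
          _ ≤ _ := by nlinarith
      have e2 : gap s 1 ≤ 0.52 := by
        rw [gap, div_le_iff₀ (quart_pos_of_half hs0 hs')]
        unfold quart
        nlinarith [sq_nonneg (s - 1 / 2)]
      have : (0.66 : ℝ) / 0.21 ≤ 3.7 - 0.52 := by norm_num
      linarith
    calc ENNReal.ofReal 0.66 ≤ ENNReal.ofReal (0.21 * (gap s (1 / 4) - gap s 1)) := by
          apply ENNReal.ofReal_le_ofReal
          rw [div_le_iff₀ (by norm_num)] at h3
          linarith
      _ = ENNReal.ofReal 0.21 * ENNReal.ofReal (gap s (1 / 4) - gap s 1) :=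
          ENNReal.ofReal_mul (by norm_num)
      _ ≤ ENNReal.ofReal 0.21 * ∫⁻ t in Ioo (1 / 4) 1, ENNReal.ofReal (-diffKer s t) := by
          gcongr; rwa [← h2]
      _ = ∫⁻ t in Ioo (1 / 4) 1, ENNReal.ofReal (-diffKer s t) * ENNReal.ofReal (g t) := by
          rw [← lintegral_const_mul' _ _ (by finiteness)]
          refine setLIntegral_congr_fun measurableSet_Ioo fun t ht => ?_
          simp only [hgd, Set.indicator_of_mem ht]
          ring
      _ ≤ _ := lintegral_mono_set fun t ht => lt_trans (by norm_num) ht.1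
  · intro T
    simp only [hgd, ← hHd]
    by_cases hT : T ∈ Ioo (1 / 4 : ℝ) 1
    · rw [Set.indicator_of_mem hT]; linarith [hinc T hT.1]
    · rw [Set.indicator_of_notMem hT]; have := incr_nonneg s H T; positivity
  · intro t T ht hT h hgT
    have hTm : T ∈ Ioo (1 / 4 : ℝ) 1 := by
      by_contra hT'; exact hgT (Set.indicator_of_notMem hT' _)
    have hgv : g T = 0.21 := Set.indicator_of_mem hTm _
    simp only [← hHd]
    have htT := mul_le_of_gap_eq hs0 hs' ht hT h
    -- From tT ≤ (s - 1/2)² ≤ 0.0004 and T > 1/4.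
    have ht2 : t ≤ 0.0016 := by
      have : (s - 1 / 2) ^ 2 ≤ 0.0004 := by nlinarith
      have := hTm.1
      nlinarith
    have hsqt : √t ≤ 0.04 := sqrt_le_iff.2 ⟨by norm_num, by norm_num; linarith⟩
    -- Twice -0.495 + 0.14143, plus 2 · 0.582 · 0.04 for moving from b to b ± t, is below -0.66.
    have hF : foldCol φ b a t ≤ -0.66 := by
      have e : foldCol φ b a t = φ (b + t) + φ (b - t) := by
        rw [foldCol, if_pos (by linarith), oddCol, oddCol, if_pos (by linarith),
          if_pos (by linarith)]
      have h1 := hφ.sub_le (by norm_num) (y := b + t) (y' := b) (d := t)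
        (by rw [add_sub_cancel_left, abs_of_pos ht])
      have h2 := hφ.sub_le (by norm_num) (y := b - t) (y' := b) (d := t)
        (by rw [sub_sub_cancel_left, abs_neg, abs_of_pos ht])
      rw [e]
      norm_num at *
      linarith
    have hFT := foldCol_ge (b := b) (a := a) hφ hβ T
    rw [if_neg (show ¬ H < t by linarith), hgv]
    -- The fold at T is at least -1.0199. Below the wall -1.0199 + 2 · 0.582 · 0.4983 - 0.21 still
    -- exceeds -0.66; beyond it the jump allowance √(2s) leaves ample room.
    rcases lt_or_ge T H with hTH | hTH
    · rw [if_neg (by intro h; linarith [h.2])]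
      have hn := nest_ge_of_near hs hTm.1
      have hT1 : 0.5 ≤ √T := le_sqrt_of_sq_le (by norm_num; linarith [hTm.1])
      have h2 : 0.4983 ≤ √T * nest s T := by nlinarith
      rw [incr, if_pos hTH]
      norm_num at *
      linarith
    · rw [if_pos ⟨by linarith, hTH⟩]
      have := hinc T hTm.1
      norm_num at *
      linarith

/-! ### Existence of the principal values. -/

/-- The square of half side `a` about the origin. -/
def sq (a : ℝ) : Set (ℝ × ℝ) := Icc (-a) a ×ˢ Icc (-a) a

lemma mem_sq {a : ℝ} {p : ℝ × ℝ} : p ∈ sq a ↔ |p.1| ≤ a ∧ |p.2| ≤ a := by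
  simp only [sq, mem_prod, mem_Icc, abs_le]

lemma measurableSet_sq (a : ℝ) : MeasurableSet (sq a) := measurableSet_Icc.prod measurableSet_Icc

lemma volume_sq_lt_top (a : ℝ) : volume (sq a) < ⊤ :=
  (isCompact_Icc.prod isCompact_Icc).measure_lt_top

lemma measurable_ker : Measurable fun p : ℝ × ℝ => ker p.1 p.2 := by
  unfold ker; fun_prop

lemma abs_ker_le (σ t : ℝ) : |ker σ t| ≤ 1 / (σ ^ 2 + t ^ 2) := by
  rw [ker, abs_div, abs_of_nonneg (sq_nonneg (σ ^ 2 + t ^ 2))]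
  rcases eq_or_ne (σ ^ 2 + t ^ 2) 0 with h | h
  · simp [h]
  · have h0 : 0 < σ ^ 2 + t ^ 2 := lt_of_le_of_ne (by positivity) h.symm
    rw [div_le_div_iff₀ (by positivity) h0]
    have : |σ ^ 2 - t ^ 2| ≤ σ ^ 2 + t ^ 2 := by
      rw [abs_le]; constructor <;> nlinarith [sq_nonneg σ, sq_nonneg t]
    nlinarith

lemma ker_swap (σ t : ℝ) : ker t σ = -ker σ t := by
  unfold ker; rw [add_comm, ← neg_div, neg_sub]

lemma ker_neg_left (σ t : ℝ) : ker (-σ) t = ker σ t := by unfold ker; simp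

lemma ker_neg_right (σ t : ℝ) : ker σ (-t) = ker σ t := by unfold ker; simp

lemma ker_mul {h : ℝ} (hh : h ≠ 0) (σ t : ℝ) : ker (h * σ) (h * t) = ker σ t / h ^ 2 := by
  unfold ker
  rcases eq_or_ne (σ ^ 2 + t ^ 2) 0 with h0 | h0
  · have : (h * σ) ^ 2 + (h * t) ^ 2 = 0 := by
      rw [mul_pow, mul_pow, ← mul_add, h0, mul_zero]
    simp [h0, this]
  · have : (h * σ) ^ 2 + (h * t) ^ 2 = h ^ 2 * (σ ^ 2 + t ^ 2) := by ring
    rw [this]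
    field_simp

lemma abs_ker_le_of_notMem {ε : ℝ} (hε : 0 < ε) {p : ℝ × ℝ} (hp : p ∉ sq ε) :
    |ker p.1 p.2| ≤ 1 / ε ^ 2 := by
  refine (abs_ker_le _ _).trans ?_
  have : ε ^ 2 ≤ p.1 ^ 2 + p.2 ^ 2 := by
    rw [mem_sq, not_and_or, not_le, not_le] at hp
    rw [← sq_abs p.1, ← sq_abs p.2]
    rcases hp with h | h
    · nlinarith [sq_nonneg |p.2|]
    · nlinarith [sq_nonneg |p.1|]
  gcongr

lemma integrableOn_ker_mul {V : ℝ × ℝ → ℝ} (hV : Measurable V) {a C ε : ℝ} (hε : 0 < ε)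
    (hC : ∀ p ∈ sq a, |V p| ≤ C) :
    IntegrableOn (fun p => ker p.1 p.2 * V p) (sq a \ sq ε) := by
  have hfin : volume (sq a \ sq ε) ≠ ⊤ :=
    ((measure_mono sdiff_subset).trans_lt (volume_sq_lt_top a)).ne
  refine Measure.integrableOn_of_bounded (M := 1 / ε ^ 2 * C) hfin
    (measurable_ker.mul hV).aestronglyMeasurable ?_
  refine (ae_restrict_iff' ((measurableSet_sq a).diff (measurableSet_sq ε))).2
    (Eventually.of_forall fun p hp => ?_)
  rw [norm_mul]
  exact mul_le_mul (abs_ker_le_of_notMem hε hp.2) (hC p hp.1) (abs_nonneg _) (by positivity)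

/-- Exchanging the coordinates preserves the region and changes the sign of the kernel. -/
lemma setIntegral_ker_eq_zero (a ε : ℝ) : ∫ p in sq a \ sq ε, ker p.1 p.2 = 0 := by
  have h1 : (Prod.swap : ℝ × ℝ → ℝ × ℝ) ⁻¹' (sq a \ sq ε) = sq a \ sq ε := by
    ext p
    simp only [mem_preimage, Set.mem_sdiff, mem_sq, Prod.fst_swap, Prod.snd_swap]
    tauto
  have h2 := (Measure.measurePreserving_swap (μ := (volume : Measure ℝ))
    (ν := (volume : Measure ℝ))).setIntegral_preimage_emb
    (MeasurableEquiv.prodComm (α := ℝ) (β := ℝ)).measurableEmbedding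
    (fun p => ker p.1 p.2) (sq a \ sq ε)
  rw [h1] at h2
  simp only [Prod.fst_swap, Prod.snd_swap] at h2
  have h3 : ∫ p in sq a \ sq ε, ker p.2 p.1 = -∫ p in sq a \ sq ε, ker p.1 p.2 := by
    rw [← integral_neg]
    exact integral_congr_ae (Eventually.of_forall fun p => ker_swap _ _)
  have h4 : ∫ p in sq a \ sq ε, ker p.2 p.1 = ∫ p in sq a \ sq ε, ker p.1 p.2 := h2
  linarith

lemma integrableOn_abs_rpow (a : ℝ) {r : ℝ} (hr : -1 < r) :
    IntegrableOn (fun x : ℝ => |x| ^ r) (Icc (-a) a) := by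
  rcases lt_or_ge a 0 with ha | ha
  · rw [Icc_eq_empty (by linarith)]; exact integrableOn_empty
  have h1 : IntervalIntegrable (fun x : ℝ => |x| ^ r) volume 0 a := by
    rw [intervalIntegrable_iff_integrableOn_Ioc_of_le ha]
    refine ((intervalIntegrable_iff_integrableOn_Ioc_of_le ha).1
      (intervalIntegral.intervalIntegrable_rpow' hr)).congr_fun (fun x hx => ?_) measurableSet_Ioc
    simp only [abs_of_pos hx.1]
  have h2 : IntervalIntegrable (fun x : ℝ => |x| ^ r) volume (-a) 0 := by
    have := ((IntervalIntegrable.iff_comp_neg enorm_ne_top).1 h1).symm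
    simpa using this
  rw [← intervalIntegrable_iff_integrableOn_Icc_of_le (by linarith)]
  exact h2.trans h1

/-- In the fourth roots x and y of u and v the claim is x⁵y³ ≤ x⁸ + y⁸. The point is to dominate the
singularity by a product of integrable functions of one variable. -/
lemma sqrt_mul_rpow_le {u v : ℝ} (hu : 0 < u) (hv : 0 < v) :
    √u / (u ^ 2 + v ^ 2) ≤ u ^ (-(3 / 4) : ℝ) * v ^ (-(3 / 4) : ℝ) := by
  set x := u ^ (1 / 4 : ℝ) with hx
  set y := v ^ (1 / 4 : ℝ) with hy
  have hx0 : 0 < x := rpow_pos_of_pos hu _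
  have hy0 : 0 < y := rpow_pos_of_pos hv _
  have e1 : u = x ^ 4 := by
    rw [hx, ← rpow_natCast, ← rpow_mul hu.le]; norm_num
  have e2 : v = y ^ 4 := by
    rw [hy, ← rpow_natCast, ← rpow_mul hv.le]; norm_num
  have e3 : u ^ (-(3 / 4) : ℝ) = 1 / x ^ 3 := by
    rw [hx, rpow_neg hu.le, ← rpow_natCast, ← rpow_mul hu.le, one_div]; norm_num
  have e4 : v ^ (-(3 / 4) : ℝ) = 1 / y ^ 3 := by
    rw [hy, rpow_neg hv.le, ← rpow_natCast, ← rpow_mul hv.le, one_div]; norm_num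
  have e5 : √u = x ^ 2 := by
    rw [e1, show x ^ 4 = (x ^ 2) ^ 2 by ring, sqrt_sq (by positivity)]
  rw [e3, e4, e5, e1, e2, one_div_mul_one_div, div_le_div_iff₀ (by positivity) (by positivity),
    one_mul]
  rcases le_total x y with h | h
  · have : x ^ 5 * y ^ 3 ≤ y ^ 5 * y ^ 3 := by gcongr
    nlinarith [pow_pos hx0 8]
  · have : x ^ 5 * y ^ 3 ≤ x ^ 5 * x ^ 3 := by gcongr
    nlinarith [pow_pos hy0 8]

lemma ae_fst_ne_zero_and : ∀ᵐ p : ℝ × ℝ, p.1 ≠ 0 ∧ p.2 ≠ 0 := by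
  have h : ∀ᵐ x : ℝ, x ≠ 0 := Measure.ae_ne volume 0
  exact (Measure.quasiMeasurePreserving_fst.ae h).and (Measure.quasiMeasurePreserving_snd.ae h)

lemma integrableOn_ker_mul_sub {V : ℝ × ℝ → ℝ} (hV : Measurable V) {w C : ℝ}
    (h : ∀ p, |V p - w| ≤ C * (√|p.1| + √|p.2|)) (a : ℝ) :
    IntegrableOn (fun p => ker p.1 p.2 * (V p - w)) (sq a) := by
  have hr := integrableOn_abs_rpow a (r := -(3 / 4)) (by norm_num)
  have h1 : IntegrableOn (fun p : ℝ × ℝ => |p.1| ^ (-(3 / 4) : ℝ) * |p.2| ^ (-(3 / 4) : ℝ)) (sq a) := by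
    have := hr.mul_prod (μ := volume.restrict (Icc (-a) a)) hr
    rw [Measure.prod_restrict] at this
    exact this
  refine (h1.const_mul (2 * C)).mono' (measurable_ker.mul (hV.sub_const w)).aestronglyMeasurable ?_
  filter_upwards [ae_restrict_of_ae ae_fst_ne_zero_and] with p hp
  have hC : 0 ≤ C := by
    have := (abs_nonneg _).trans (h p)
    have h2 : 0 < √|p.1| + √|p.2| := by
      have := abs_pos.2 hp.1
      positivity
    exact nonneg_of_mul_nonneg_left this h2
  have h3 := sqrt_mul_rpow_le (abs_pos.2 hp.1) (abs_pos.2 hp.2)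
  have h4 := sqrt_mul_rpow_le (abs_pos.2 hp.2) (abs_pos.2 hp.1)
  rw [sq_abs, sq_abs] at h3 h4
  rw [norm_mul]
  calc |ker p.1 p.2| * |V p - w| ≤ 1 / (p.1 ^ 2 + p.2 ^ 2) * (C * (√|p.1| + √|p.2|)) :=
        mul_le_mul (abs_ker_le _ _) (h p) (abs_nonneg _) (by positivity)
    _ = C * (√|p.1| / (p.1 ^ 2 + p.2 ^ 2) + √|p.2| / (p.2 ^ 2 + p.1 ^ 2)) := by
        rw [add_comm (p.2 ^ 2)]; ring
    _ ≤ C * (|p.1| ^ (-(3 / 4) : ℝ) * |p.2| ^ (-(3 / 4) : ℝ) +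
        |p.2| ^ (-(3 / 4) : ℝ) * |p.1| ^ (-(3 / 4) : ℝ)) := by gcongr
    _ = _ := by ring

/-- A constant may be subtracted from V without changing the truncated integrals, because the kernel
has mean zero on them; what remains is absolutely integrable up to the singularity. -/
lemma tendsto_setIntegral_ker {V : ℝ × ℝ → ℝ} (hV : Measurable V) {w C : ℝ}
    (h : ∀ p, |V p - w| ≤ C * (√|p.1| + √|p.2|)) (a : ℝ) :
    Tendsto (fun ε => ∫ p in sq a \ sq ε, ker p.1 p.2 * V p) (𝓝[>] 0)
      (𝓝 (∫ p in sq a, ker p.1 p.2 * (V p - w))) := by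
  have hi := integrableOn_ker_mul_sub hV h a
  have hbd : ∀ p ∈ sq a, |V p| ≤ |w| + |C| * (√a + √a) := by
    intro p hp
    rw [mem_sq] at hp
    have h1 : |V p| ≤ |w| + |V p - w| := by
      have := abs_add_le w (V p - w)
      rwa [add_sub_cancel] at this
    refine h1.trans (add_le_add_right ((h p).trans ?_) _)
    calc C * (√|p.1| + √|p.2|) ≤ |C| * (√|p.1| + √|p.2|) := by gcongr; exact le_abs_self C
      _ ≤ _ := by gcongr <;> tauto
  have h1 : ∀ᶠ ε : ℝ in 𝓝[>] 0, ∫ p in sq a \ sq ε, ker p.1 p.2 * (V p - w) =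
      ∫ p in sq a \ sq ε, ker p.1 p.2 * V p := by
    filter_upwards [self_mem_nhdsWithin] with ε hε
    have e : ∀ p : ℝ × ℝ, ker p.1 p.2 * (V p - w) = ker p.1 p.2 * V p - ker p.1 p.2 * w :=
      fun p => by ring
    simp_rw [e]
    rw [integral_sub (integrableOn_ker_mul hV hε hbd)
      (integrableOn_ker_mul measurable_const hε (C := |w|) fun _ _ => le_rfl),
      integral_mul_const, setIntegral_ker_eq_zero, zero_mul, sub_zero]
  refine Tendsto.congr' h1 ?_
  simp_rw [← integral_indicator ((measurableSet_sq a).diff (measurableSet_sq _)),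
    ← integral_indicator (measurableSet_sq a)]
  refine tendsto_integral_filter_of_dominated_convergence
    (fun p => ‖(sq a).indicator (fun p => ker p.1 p.2 * (V p - w)) p‖) ?_ ?_
    ((integrable_indicator_iff (measurableSet_sq a)).2 hi).norm ?_
  · refine Eventually.of_forall fun ε => ?_
    exact ((measurable_ker.mul (hV.sub_const w)).indicator
      ((measurableSet_sq a).diff (measurableSet_sq ε))).aestronglyMeasurable
  · refine Eventually.of_forall fun ε => Eventually.of_forall fun p => ?_
    rw [norm_indicator_eq_indicator_norm, norm_indicator_eq_indicator_norm]
    exact indicator_le_indicator_of_subset sdiff_subset (fun _ => norm_nonneg _) p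
  · filter_upwards [ae_fst_ne_zero_and] with p hp
    refine tendsto_const_nhds.congr' ?_
    have : ∀ᶠ ε : ℝ in 𝓝[>] 0, ε < |p.1| :=
      nhdsWithin_le_nhds (gt_mem_nhds (abs_pos.2 hp.1))
    filter_upwards [this] with ε hε
    have hn : p ∉ sq ε := fun h => by rw [mem_sq] at h; linarith [h.1]
    by_cases hp' : p ∈ sq a
    · rw [Set.indicator_of_mem hp', Set.indicator_of_mem (show p ∈ sq a \ sq ε from ⟨hp', hn⟩)]
    · rw [Set.indicator_of_notMem hp', Set.indicator_of_notMem fun h => hp' h.1]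

/-! ### Functions Hölder continuous in each variable, and their odd extensions. -/

/-- `ω` is `1/2`-Hölder continuous with constant `M` on horizontal and `N` on vertical lines. -/
structure IsHolderPair (ω : ℝ × ℝ → ℝ) (M N : ℝ) : Prop where
  horiz : ∀ u v y, |ω (u, y) - ω (v, y)| ≤ M * √|u - v|
  vert : ∀ u y y', |ω (u, y) - ω (u, y')| ≤ N * √|y - y'|

namespace IsHolderPair

variable {ω : ℝ × ℝ → ℝ} {M N : ℝ}

lemma nonneg (h : IsHolderPair ω M N) : 0 ≤ M ∧ 0 ≤ N := by
  constructor
  · simpa using (abs_nonneg _).trans (h.horiz 1 0 0)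
  · simpa using (abs_nonneg _).trans (h.vert 0 1 0)

lemma neg (h : IsHolderPair ω M N) : IsHolderPair (fun p => -ω p) M N :=
  ⟨fun u v y => by rw [← abs_neg]; convert h.horiz u v y using 2; ring,
    fun u y y' => by rw [← abs_neg]; convert h.vert u y y' using 2; ring⟩

lemma abs_sub_le (h : IsHolderPair ω M N) (p q : ℝ × ℝ) :
    |ω p - ω q| ≤ M * √|p.1 - q.1| + N * √|p.2 - q.2| := by
  refine (_root_.abs_sub_le _ (ω (q.1, p.2)) _).trans (add_le_add ?_ ?_)
  · exact h.horiz p.1 q.1 p.2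
  · exact h.vert q.1 p.2 q.2

lemma continuous (h : IsHolderPair ω M N) : Continuous ω := by
  rw [continuous_iff_continuousAt]
  intro q
  rw [ContinuousAt, tendsto_iff_norm_sub_tendsto_zero]
  refine squeeze_zero (fun _ => norm_nonneg _) (fun p => h.abs_sub_le p q) ?_
  have : Continuous fun p : ℝ × ℝ => M * √|p.1 - q.1| + N * √|p.2 - q.2| := by fun_prop
  simpa using this.tendsto q

lemma measurable_oddExt (h : IsHolderPair ω M N) : Measurable (oddExt ω) := by
  refine Measurable.ite (measurableSet_le measurable_const measurable_snd) h.continuous.measurable ?_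
  have : Continuous fun y : ℝ × ℝ => -ω (y.1, -y.2) := by
    have := h.continuous
    fun_prop
  exact this.measurable

/-- The odd extension may jump by about 2|ω x|, but only across the axis, hence at vertical distance
more than x₂. There √|p₂| ≥ √x₂ absorbs the jump, at the price of a constant that blows up at the
boundary. -/
lemma abs_oddExt_sub_le (h : IsHolderPair ω M N) {x : ℝ × ℝ} (hx : 0 < x.2) (p : ℝ × ℝ) :
    |oddExt ω (x + p) - ω x| ≤ (M + N + 2 * |ω x| / √x.2) * (√|p.1| + √|p.2|) := by
  obtain ⟨hM, hN⟩ := h.nonneg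
  have h0 : 0 ≤ 2 * |ω x| / √x.2 := by positivity
  have hs1 := sqrt_nonneg |p.1|
  have hs2 := sqrt_nonneg |p.2|
  unfold oddExt
  split_ifs with hp
  · have := h.abs_sub_le (x + p) x
    simp only [Prod.fst_add, Prod.snd_add, add_sub_cancel_left] at this
    nlinarith [mul_nonneg hM hs2, mul_nonneg hN hs1, mul_nonneg h0 hs1, mul_nonneg h0 hs2]
  · rw [not_le, Prod.snd_add] at hp
    have h1 := h.abs_sub_le ((x + p).1, -(x + p).2) x
    simp only [Prod.fst_add, Prod.snd_add, add_sub_cancel_left] at h1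
    have h2 : √|-(x.2 + p.2) - x.2| ≤ √|p.2| := by
      apply sqrt_le_sqrt
      rw [abs_of_neg (show p.2 < 0 by linarith), abs_le]
      constructor <;> linarith
    have h3 : 2 * |ω x| ≤ 2 * |ω x| / √x.2 * √|p.2| := by
      have : √x.2 ≤ √|p.2| := by
        apply sqrt_le_sqrt
        rw [abs_of_neg (show p.2 < 0 by linarith)]
        linarith
      have hx0 : 0 < √x.2 := sqrt_pos.2 hx
      calc 2 * |ω x| = 2 * |ω x| / √x.2 * √x.2 := by field_simp
        _ ≤ _ := by gcongr
    have h4 : |-ω ((x + p).1, -(x + p).2) - ω x| ≤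
        |ω (x.1 + p.1, -(x.2 + p.2)) - ω x| + 2 * |ω x| := by
      rw [abs_le]
      simp only [Prod.fst_add, Prod.snd_add]
      have h5 := abs_le.1 (le_refl |ω (x.1 + p.1, -(x.2 + p.2)) - ω x|)
      have h6 := abs_le.1 (le_refl |ω x|)
      constructor <;> linarith [h5.1, h5.2, h6.1, h6.2]
    have h7 := mul_le_mul_of_nonneg_left h2 hN
    refine h4.trans ?_
    nlinarith [mul_nonneg hM hs2, mul_nonneg hN hs1, mul_nonneg h0 hs1]

lemma abs_oddExt_le (h : IsHolderPair ω M N) (x : ℝ × ℝ) (a : ℝ) :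
    ∃ C, ∀ p ∈ sq a, |oddExt ω (x + p)| ≤ C := by
  have hc := h.continuous
  have hK : IsCompact ((fun p => x + p) '' sq a) :=
    (isCompact_Icc.prod isCompact_Icc).image (by fun_prop)
  obtain ⟨C1, hC1⟩ := hK.exists_bound_of_continuousOn hc.continuousOn
  have hc' : Continuous fun y : ℝ × ℝ => ω (y.1, -y.2) := by fun_prop
  obtain ⟨C2, hC2⟩ := hK.exists_bound_of_continuousOn hc'.continuousOn
  refine ⟨max C1 C2, fun p hp => ?_⟩
  unfold oddExt
  split_ifs
  · exact (hC1 _ (mem_image_of_mem _ hp)).trans (le_max_left _ _)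
  · rw [abs_neg]; exact (hC2 _ (mem_image_of_mem _ hp)).trans (le_max_right _ _)

end IsHolderPair

/-- The regularized singular integral over the square of half side `a` about `x`. -/
def regInt (ω : ℝ × ℝ → ℝ) (x : ℝ × ℝ) (a : ℝ) : ℝ :=
  ∫ p in sq a, ker p.1 p.2 * (oddExt ω (x + p) - ω x)

lemma integrand_add (ω : ℝ × ℝ → ℝ) (x p : ℝ × ℝ) :
    integrand ω x (x + p) = ker p.1 p.2 * oddExt ω (x + p) := by
  unfold integrand ker
  simp

lemma preimage_add_box (x : ℝ × ℝ) (a : ℝ) : (fun p => x + p) ⁻¹' box a x = sq a := by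
  ext p
  simp only [box, sq, mem_preimage, mem_prod, mem_Icc, Prod.fst_add, Prod.snd_add]
  constructor <;> rintro ⟨⟨_, _⟩, _, _⟩ <;> refine ⟨⟨?_, ?_⟩, ?_, ?_⟩ <;> linarith

lemma truncIntegral_integrand (ω : ℝ × ℝ → ℝ) (x : ℝ × ℝ) (a ε : ℝ) :
    truncIntegral (integrand ω x) (box a x) x ε =
      ∫ p in sq a \ sq ε, ker p.1 p.2 * oddExt ω (x + p) := by
  have h := (measurePreserving_add_left (volume : Measure (ℝ × ℝ)) x).setIntegral_preimage_emb
    (measurableEmbedding_addLeft x) (integrand ω x) (box a x \ box ε x)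
  rw [preimage_sdiff, preimage_add_box, preimage_add_box] at h
  rw [truncIntegral, ← h]
  simp_rw [integrand_add]

lemma integrableOn_integrand_iff (ω : ℝ × ℝ → ℝ) (x : ℝ × ℝ) (a ε : ℝ) :
    IntegrableOn (integrand ω x) (box a x \ box ε x) ↔
      IntegrableOn (fun p => ker p.1 p.2 * oddExt ω (x + p)) (sq a \ sq ε) := by
  have h := (measurePreserving_add_left (volume : Measure (ℝ × ℝ)) x).integrableOn_comp_preimage
    (measurableEmbedding_addLeft x) (f := integrand ω x) (s := box a x \ box ε x)
  rw [preimage_sdiff, preimage_add_box, preimage_add_box] at h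
  rw [← h]
  simp_rw [Function.comp_def, integrand_add]

lemma IsHolderPair.pv {ω : ℝ × ℝ → ℝ} {M N : ℝ} (h : IsHolderPair ω M N) {x : ℝ × ℝ}
    (hx : 0 < x.2) (a : ℝ) :
    PVExists (integrand ω x) (box a x) x ∧ pvIntegral (integrand ω x) (box a x) x = regInt ω x a := by
  have hV : Measurable fun p => oddExt ω (x + p) := h.measurable_oddExt.comp (measurable_const_add x)
  have ht := tendsto_setIntegral_ker hV (h.abs_oddExt_sub_le hx) a
  have ht' : Tendsto (truncIntegral (integrand ω x) (box a x) x) (𝓝[>] 0) (𝓝 (regInt ω x a)) := by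
    refine ht.congr fun ε => ?_
    rw [truncIntegral_integrand]
  obtain ⟨C, hC⟩ := h.abs_oddExt_le x a
  refine ⟨⟨fun ε hε => ?_, _, ht'⟩, ht'.limUnder_eq⟩
  rw [integrableOn_integrand_iff]
  exact integrableOn_ker_mul hV hε hC

/-- For x on the axis the kernel is even and the extension odd in the vertical variable, off a null
line, so every truncated integral vanishes. This separate argument is needed because the
regularization degenerates at x₂ = 0. -/
lemma IsHolderPair.pv_of_boundary {ω : ℝ × ℝ → ℝ} {M N : ℝ} (h : IsHolderPair ω M N) {x : ℝ × ℝ}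
    (hx : x.2 = 0) (a : ℝ) :
    PVExists (integrand ω x) (box a x) x ∧ pvIntegral (integrand ω x) (box a x) x = 0 := by
  have hV : Measurable fun p => oddExt ω (x + p) := h.measurable_oddExt.comp (measurable_const_add x)
  have h0 : ∀ ε, truncIntegral (integrand ω x) (box a x) x ε = 0 := by
    intro ε
    rw [truncIntegral_integrand]
    have hmp : MeasurePreserving (Prod.map id Neg.neg : ℝ × ℝ → ℝ × ℝ) volume volume :=
      (MeasurePreserving.id volume).prod (Measure.measurePreserving_neg volume)
    have hemb : MeasurableEmbedding (Prod.map id Neg.neg : ℝ × ℝ → ℝ × ℝ) :=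
      ((MeasurableEquiv.refl ℝ).prodCongr (MeasurableEquiv.neg ℝ)).measurableEmbedding
    have hpre : (Prod.map id Neg.neg : ℝ × ℝ → ℝ × ℝ) ⁻¹' (sq a \ sq ε) = sq a \ sq ε := by
      ext p
      simp only [mem_preimage, Set.mem_sdiff, mem_sq, Prod.map_fst, Prod.map_snd, abs_neg, id]
    have h2 := hmp.setIntegral_preimage_emb hemb
      (fun p => ker p.1 p.2 * oddExt ω (x + p)) (sq a \ sq ε)
    rw [hpre] at h2
    have h3 : ∫ p in sq a \ sq ε, (fun p => ker p.1 p.2 * oddExt ω (x + p))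
        (Prod.map id Neg.neg p) = ∫ p in sq a \ sq ε, -(ker p.1 p.2 * oddExt ω (x + p)) := by
      refine integral_congr_ae (ae_restrict_of_ae ?_)
      filter_upwards [ae_fst_ne_zero_and] with p hp
      simp only [Prod.map_fst, Prod.map_snd, id, ker_neg_right, oddExt, Prod.snd_add, hx, zero_add,
        Prod.fst_add, Left.nonneg_neg_iff, neg_neg]
      rcases lt_or_gt_of_ne hp.2 with h | h
      · rw [if_pos h.le, if_neg (by linarith)]
        simp only [mul_neg, neg_neg]
        congr 2
        ext <;> simp [hx]
      · rw [if_neg (by linarith), if_pos h.le, mul_neg]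
        congr 3
        ext <;> simp [hx]
    rw [integral_neg] at h3
    rw [h3] at h2
    linarith
  obtain ⟨C, hC⟩ := h.abs_oddExt_le x a
  have ht : Tendsto (truncIntegral (integrand ω x) (box a x) x) (𝓝[>] 0) (𝓝 0) :=
    tendsto_const_nhds.congr fun ε => (h0 ε).symm
  refine ⟨⟨fun ε hε => ?_, _, ht⟩, ht.limUnder_eq⟩
  rw [integrableOn_integrand_iff]
  exact integrableOn_ker_mul hV hε hC

/-! ### Integration by columns and reduction to odd parts. -/

/-- The integral of the kernel against the column of the odd extension at abscissa `s`. -/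
def colInt (ω : ℝ × ℝ → ℝ) (b a σ s : ℝ) : ℝ :=
  ∫ t in (-a)..a, ker σ t * oddExt ω (s, b + t)

lemma hasDerivAt_div_add_sq {σ : ℝ} (hσ : σ ≠ 0) (t : ℝ) :
    HasDerivAt (fun t => t / (σ ^ 2 + t ^ 2)) (ker σ t) t := by
  have h2 : HasDerivAt (fun t : ℝ => t ^ 2) (2 * t) t := by simpa using hasDerivAt_pow 2 t
  have h0 : σ ^ 2 + t ^ 2 ≠ 0 := by positivity
  refine ((hasDerivAt_id' t).div (h2.const_add (σ ^ 2)) h0).congr_deriv ?_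
  unfold ker
  congr 1
  ring

lemma continuous_ker_right {σ : ℝ} (hσ : σ ≠ 0) : Continuous (ker σ) := by
  unfold ker
  exact Continuous.div (by fun_prop) (by fun_prop) fun t => by positivity

lemma integral_ker_col {σ : ℝ} (hσ : σ ≠ 0) (a : ℝ) :
    ∫ t in (-a)..a, ker σ t = 2 * a / (σ ^ 2 + a ^ 2) := by
  rw [intervalIntegral.integral_eq_sub_of_hasDerivAt (fun t _ => hasDerivAt_div_add_sq hσ t)
    (continuous_ker_right hσ).continuousOn.intervalIntegrable]
  ring

/-- This π is the discrepancy between the vertical-first iterated integral of the kernel and its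
principal value 0. It decides the different constants for u_y and v_x. -/
lemma integral_two_mul_div {a : ℝ} (ha : 0 < a) :
    IntervalIntegrable (fun σ : ℝ => 2 * a / (σ ^ 2 + a ^ 2)) volume (-a) a ∧
      ∫ σ in (-a)..a, 2 * a / (σ ^ 2 + a ^ 2) = π := by
  have hc : Continuous fun σ : ℝ => 2 * a / (σ ^ 2 + a ^ 2) :=
    Continuous.div (by fun_prop) (by fun_prop) fun t => by positivity
  refine ⟨hc.continuousOn.intervalIntegrable, ?_⟩
  have hd : ∀ σ ∈ uIcc (-a) a, HasDerivAt (fun σ => 2 * arctan (σ / a))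
      (2 * a / (σ ^ 2 + a ^ 2)) σ := by
    intro σ _
    refine ((((hasDerivAt_id' σ).div_const a).arctan).const_mul 2).congr_deriv ?_
    field_simp
    ring
  rw [intervalIntegral.integral_eq_sub_of_hasDerivAt hd hc.continuousOn.intervalIntegrable,
    neg_div, div_self ha.ne', arctan_neg, arctan_one]
  ring

/-- The regularized integral as an integral over columns. -/
lemma IsHolderPair.regInt_eq {ω : ℝ × ℝ → ℝ} {M N : ℝ} (h : IsHolderPair ω M N) {x : ℝ × ℝ}
    (hx : 0 < x.2) {a : ℝ} (ha : 0 < a) :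
    IntervalIntegrable (fun σ => colInt ω x.2 a σ (x.1 + σ)) volume (-a) a ∧
      regInt ω x a = (∫ σ in (-a)..a, colInt ω x.2 a σ (x.1 + σ)) - π * ω x := by
  have hV : Measurable fun p => oddExt ω (x + p) := h.measurable_oddExt.comp (measurable_const_add x)
  have hi := integrableOn_ker_mul_sub hV (h.abs_oddExt_sub_le hx) a
  obtain ⟨C, hC⟩ := h.abs_oddExt_le x a
  have haa : -a ≤ a := by linarith
  have hi' : Integrable (fun p : ℝ × ℝ => ker p.1 p.2 * (oddExt ω (x + p) - ω x))
      ((volume.restrict (Icc (-a) a)).prod (volume.restrict (Icc (-a) a))) := by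
    rw [Measure.prod_restrict]; exact hi
  have h1 : ∀ᵐ σ : ℝ ∂(volume.restrict (Icc (-a) a)),
      ∫ t in Icc (-a) a, ker σ t * (oddExt ω (x + (σ, t)) - ω x) =
        colInt ω x.2 a σ (x.1 + σ) - ω x * (2 * a / (σ ^ 2 + a ^ 2)) := by
    filter_upwards [ae_restrict_of_ae (Measure.ae_ne volume 0), ae_restrict_mem measurableSet_Icc]
      with σ hσ hσa
    have hk := continuous_ker_right hσ
    have hb : IntervalIntegrable (fun t => ker σ t * oddExt ω (x + (σ, t))) volume (-a) a := by
      rw [intervalIntegrable_iff_integrableOn_Icc_of_le haa]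
      have h2 : IntegrableOn (fun t => oddExt ω (x + (σ, t))) (Icc (-a) a) := by
        refine Measure.integrableOn_of_bounded (M := C) (by simp)
          (hV.comp (measurable_const.prodMk measurable_id)).aestronglyMeasurable ?_
        refine (ae_restrict_iff' measurableSet_Icc).2 (Eventually.of_forall fun t ht => ?_)
        exact hC (σ, t) ⟨hσa, ht⟩
      exact h2.continuousOn_mul hk.continuousOn isCompact_Icc
    rw [integral_Icc_eq_integral_Ioc, ← intervalIntegral.integral_of_le haa]
    have e : ∀ t, ker σ t * (oddExt ω (x + (σ, t)) - ω x) =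
      ker σ t * oddExt ω (x + (σ, t)) - ω x * ker σ t := fun t => by ring
    simp_rw [e]
    rw [intervalIntegral.integral_sub hb
      ((hk.const_mul _).continuousOn.intervalIntegrable), intervalIntegral.integral_const_mul,
      integral_ker_col hσ]
    rfl
  have h2 : Integrable (fun σ => colInt ω x.2 a σ (x.1 + σ) - ω x * (2 * a / (σ ^ 2 + a ^ 2)))
      (volume.restrict (Icc (-a) a)) := hi'.integral_prod_left.congr h1
  obtain ⟨h3, h4⟩ := integral_two_mul_div ha
  have h3' : Integrable (fun σ : ℝ => ω x * (2 * a / (σ ^ 2 + a ^ 2)))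
      (volume.restrict (Icc (-a) a)) :=
    ((intervalIntegrable_iff_integrableOn_Icc_of_le haa).1 h3).const_mul _
  have h5 : Integrable (fun σ => colInt ω x.2 a σ (x.1 + σ)) (volume.restrict (Icc (-a) a)) := by
    exact (h2.add h3').congr (Eventually.of_forall fun σ => by simp)
  refine ⟨(intervalIntegrable_iff_integrableOn_Icc_of_le haa).2 h5, ?_⟩
  calc regInt ω x a = ∫ σ in Icc (-a) a, ∫ t in Icc (-a) a,
        ker σ t * (oddExt ω (x + (σ, t)) - ω x) := setIntegral_prod _ hi
    _ = ∫ σ in Icc (-a) a, (colInt ω x.2 a σ (x.1 + σ) - ω x * (2 * a / (σ ^ 2 + a ^ 2))) :=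
        integral_congr_ae h1
    _ = _ := by
        rw [integral_sub h5 h3', integral_const_mul, integral_Icc_eq_integral_Ioc,
          integral_Icc_eq_integral_Ioc, ← intervalIntegral.integral_of_le haa,
          ← intervalIntegral.integral_of_le haa, h4]
        ring

lemma measurable_colCost (τ H : ℝ) : Measurable fun s => colCost τ s H := by
  have hD := measurable_diffKer
  have hDn : Measurable (fun p : ℝ × ℝ => -diffKer p.1 p.2) := hD.neg
  have hn : Measurable (fun p : ℝ × ℝ => -diffKer p.1 p.2 * nest p.1 p.2) :=
    hD.neg.mul measurable_nest
  have hsq : Measurable fun p : ℝ × ℝ => ENNReal.ofReal √p.2 := by fun_prop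
  have h1 : ∀ S : Set ℝ, Measurable fun s => ∫⁻ t in S, ENNReal.ofReal √t *
      ENNReal.ofReal (-diffKer s t * nest s t) := fun S =>
    (hsq.mul hn.ennreal_ofReal).lintegral_prod_right'
  have h2 : ∀ S : Set ℝ, Measurable fun s => ∫⁻ t in S, ENNReal.ofReal (-diffKer s t) := fun S =>
    hDn.ennreal_ofReal.lintegral_prod_right'
  have h3 : ∀ S : Set ℝ, Measurable fun s => ∫⁻ t in S, ENNReal.ofReal (diffKer s t) := fun S =>
    hD.ennreal_ofReal.lintegral_prod_right'
  have h4 : Measurable fun s : ℝ => ENNReal.ofReal (√(2 * s) * gap s H) := by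
    have : Measurable fun s : ℝ => gap s H :=
      measurable_gap.comp (measurable_id.prodMk measurable_const)
    fun_prop
  exact h4.add ((((h1 _).const_mul 2).add ((h1 _).add (((h2 _).const_mul _).add
    ((h3 _).const_mul _)))).const_mul _)

lemma intervalIntegrable_mul_bounded {f g : ℝ → ℝ} {a C : ℝ} (ha : 0 < a) (hf : Continuous f)
    (hg : Measurable g) (hC : ∀ t ∈ Icc (-a) a, |g t| ≤ C) :
    IntervalIntegrable (fun t => f t * g t) volume (-a) a := by
  rw [intervalIntegrable_iff_integrableOn_Icc_of_le (by linarith)]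
  have h2 : IntegrableOn g (Icc (-a) a) := by
    refine Measure.integrableOn_of_bounded (M := C) (by simp) hg.aestronglyMeasurable ?_
    exact (ae_restrict_iff' measurableSet_Icc).2 (Eventually.of_forall hC)
  exact h2.continuousOn_mul hf.continuousOn isCompact_Icc

/-- The odd part in `s` of `ω (s, y)`. -/
def halfDiff (ω : ℝ × ℝ → ℝ) (s y : ℝ) : ℝ := (ω (s, y) - ω (-s, y)) / 2

lemma oddExt_sub_oddExt (ω : ℝ × ℝ → ℝ) (s y : ℝ) :
    oddExt ω (s, y) - oddExt ω (-s, y) = 2 * oddCol (halfDiff ω s) y := by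
  unfold oddExt oddCol halfDiff
  split_ifs <;> ring

lemma halfDiff_neg (ω : ℝ × ℝ → ℝ) (s y : ℝ) : halfDiff ω (-s) y = -halfDiff ω s y := by
  unfold halfDiff; rw [neg_neg]; ring

lemma oddCol_halfDiff_neg (ω : ℝ × ℝ → ℝ) (s y : ℝ) :
    oddCol (halfDiff ω (-s)) y = -oddCol (halfDiff ω s) y := by
  unfold oddCol; split_ifs <;> rw [halfDiff_neg]

/-- The integral of the kernel against the odd part of the column at abscissa `s`. -/
def colOdd (ω : ℝ × ℝ → ℝ) (b a σ s : ℝ) : ℝ :=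
  ∫ t in (-a)..a, ker σ t * oddCol (halfDiff ω s) (b + t)

lemma colOdd_neg_left (ω : ℝ × ℝ → ℝ) (b a σ s : ℝ) : colOdd ω b a (-σ) s = colOdd ω b a σ s := by
  simp only [colOdd, ker_neg_left]

lemma colOdd_neg_right (ω : ℝ × ℝ → ℝ) (b a σ s : ℝ) : colOdd ω b a σ (-s) = -colOdd ω b a σ s := by
  simp only [colOdd, oddCol_halfDiff_neg, mul_neg, intervalIntegral.integral_neg]

namespace IsHolderPair

variable {ω : ℝ × ℝ → ℝ} {N : ℝ}

lemma isColumn (h : IsHolderPair ω 1 N) {s : ℝ} (hs : 0 ≤ s) :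
    IsColumn (halfDiff ω s) (√(2 * s) / 2) N := by
  constructor
  · intro y
    have := h.horiz s (-s) y
    rw [sub_neg_eq_add, ← two_mul, abs_of_nonneg (by positivity : 0 ≤ 2 * s)] at this
    rw [halfDiff, abs_div, abs_two]
    linarith
  · intro y y'
    have h1 := h.vert s y y'
    have h2 := h.vert (-s) y y'
    have e : halfDiff ω s y - halfDiff ω s y' =
        ((ω (s, y) - ω (s, y')) - (ω (-s, y) - ω (-s, y'))) / 2 := by unfold halfDiff; ring
    rw [e, abs_div, abs_two]
    have := abs_sub (ω (s, y) - ω (s, y')) (ω (-s, y) - ω (-s, y'))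
    linarith

lemma colInt_sub_colInt (h : IsHolderPair ω 1 N) {a σ : ℝ} (ha : 0 < a) (hσ : σ ≠ 0) (b s : ℝ) :
    colInt ω b a σ s - colInt ω b a σ (-s) = 2 * colOdd ω b a σ s := by
  have hi : ∀ s, IntervalIntegrable (fun t => ker σ t * oddExt ω (s, b + t)) volume (-a) a := by
    intro s
    obtain ⟨C, hC⟩ := h.abs_oddExt_le (s, b) a
    refine intervalIntegrable_mul_bounded (C := C) ha (continuous_ker_right hσ)
      (h.measurable_oddExt.comp (measurable_const.prodMk (measurable_const_add b))) fun t ht => ?_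
    have := hC (0, t) ⟨⟨by linarith, ha.le⟩, ht⟩
    simpa using this
  rw [colInt, colInt, colOdd, ← intervalIntegral.integral_sub (hi s) (hi (-s)),
    ← intervalIntegral.integral_const_mul]
  refine intervalIntegral.integral_congr fun t _ => ?_
  rw [← mul_sub, oddExt_sub_oddExt]
  ring

/-- The decay in σ makes the remainder of the telescoping sum in `ofReal_colOdd_le` vanish. -/
lemma abs_colOdd_le (h : IsHolderPair ω 1 N) {a σ s : ℝ} (ha : 0 < a) (hσ : σ ≠ 0) (hs : 0 ≤ s)
    (b : ℝ) : |colOdd ω b a σ s| ≤ a * √(2 * s) / σ ^ 2 := by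
  have hcol := h.isColumn hs
  have h1 := intervalIntegral.norm_integral_le_of_norm_le_const (a := -a) (b := a)
    (f := fun t => ker σ t * oddCol (halfDiff ω s) (b + t)) (C := 1 / σ ^ 2 * (√(2 * s) / 2)) (by
      intro t _
      rw [norm_mul]
      refine mul_le_mul ((abs_ker_le σ t).trans ?_) (hcol.abs_oddCol_le _) (abs_nonneg _)
        (by positivity)
      gcongr
      nlinarith [sq_nonneg t])
  refine h1.trans (le_of_eq ?_)
  rw [sub_neg_eq_add, abs_of_pos (by linarith)]
  ring

/-- The abscissa s of the data and s' of the kernel are kept independent: they agree for reflected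
pairs, but differ by integers in the telescoping over the unpaired strip. Folding at b uses that the
kernel is even in t. -/
lemma colOdd_sub_colOdd (h : IsHolderPair ω 1 N) {a s s' : ℝ} (ha : 0 < a) (hs : 0 ≤ s)
    (hs' : 0 < s') (hs1 : s' ≠ 1 / 2) (b : ℝ) :
    colOdd ω b a (s' - 1 / 2) s - colOdd ω b a (s' + 1 / 2) s =
      ∫ t in Ioi 0, diffKer s' t * foldCol (halfDiff ω s) b a t := by
  have hcol := h.isColumn hs
  set φ := halfDiff ω s
  have hne1 : s' - 1 / 2 ≠ 0 := sub_ne_zero.2 hs1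
  have hne2 : s' + 1 / 2 ≠ 0 := by positivity
  have hm : Measurable fun t => oddCol φ (b + t) :=
    hcol.measurable_oddCol.comp (measurable_const_add b)
  have hi : ∀ {f : ℝ → ℝ}, Continuous f →
      IntervalIntegrable (fun t => f t * oddCol φ (b + t)) volume (-a) a := fun hf =>
    intervalIntegrable_mul_bounded ha hf hm fun t _ => hcol.abs_oddCol_le _
  have hDc : Continuous (diffKer s') := by
    unfold diffKer
    exact Continuous.div (by fun_prop) (by unfold quart; fun_prop)
      fun t => pow_ne_zero 2 (quart_pos_of_half hs' hs1).ne'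
  have hDe : ∀ t, diffKer s' (-t) = diffKer s' t := fun t => by unfold diffKer quart; simp
  have h1 : colOdd ω b a (s' - 1 / 2) s - colOdd ω b a (s' + 1 / 2) s =
      ∫ t in (-a)..a, diffKer s' t * oddCol φ (b + t) := by
    rw [colOdd, colOdd, ← intervalIntegral.integral_sub (hi (continuous_ker_right hne1))
      (hi (continuous_ker_right hne2))]
    refine intervalIntegral.integral_congr fun t _ => ?_
    rw [diffKer_eq_ker (quart_pos_of_half hs' hs1).ne']
    ring
  have hsub : uIcc (-a) 0 ⊆ uIcc (-a) a := by
    rw [uIcc_of_le (by linarith), uIcc_of_le (by linarith)]; exact Icc_subset_Icc_right ha.le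
  have hsub' : uIcc 0 a ⊆ uIcc (-a) a := by
    rw [uIcc_of_le (by linarith), uIcc_of_le (by linarith)]; exact Icc_subset_Icc_left (by linarith)
  have hia := (hi hDc).mono_set hsub
  have hib := (hi hDc).mono_set hsub'
  have hia' : IntervalIntegrable (fun t => diffKer s' t * oddCol φ (b - t)) volume 0 a := by
    have := ((IntervalIntegrable.iff_comp_neg enorm_ne_top).1 hia).symm
    simpa [hDe, sub_eq_add_neg] using this
  have h2 : ∫ t in (-a)..0, diffKer s' t * oddCol φ (b + t) =
      ∫ t in (0)..a, diffKer s' t * oddCol φ (b - t) := by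
    have := intervalIntegral.integral_comp_neg (a := 0) (b := a)
      (fun t => diffKer s' t * oddCol φ (b + t))
    rw [neg_zero] at this
    rw [← this]
    simp only [hDe, sub_eq_add_neg]
  rw [h1, ← intervalIntegral.integral_add_adjacent_intervals hia hib, h2,
    ← intervalIntegral.integral_add hia' hib, intervalIntegral.integral_of_le ha.le,
    integral_Ioc_eq_integral_Ioo, ← Ioi_inter_Iio, ← setIntegral_indicator measurableSet_Iio]
  refine integral_congr_ae (Eventually.of_forall fun t => ?_)
  simp only [foldCol]
  by_cases hta : t < a
  · rw [Set.indicator_of_mem (show t ∈ Iio a from hta), if_pos hta]; ring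
  · rw [Set.indicator_of_notMem (show t ∉ Iio a from hta), if_neg hta, mul_zero]

/-- The difference of the column integrals about the two centres, in terms of odd parts. -/
lemma integral_colOdd (h : IsHolderPair ω 1 N) {a b : ℝ} (ha : 0 < a) (hb : 0 < b) :
    IntervalIntegrable (fun s => colOdd ω b a (s - 1 / 2) s) volume (1 / 2 - a) (1 / 2 + a) ∧
    (∫ σ in (-a)..a, colInt ω b a σ (1 / 2 + σ)) - (∫ σ in (-a)..a, colInt ω b a σ (-(1 / 2) + σ)) =
      2 * ∫ s in (1 / 2 - a)..(1 / 2 + a), colOdd ω b a (s - 1 / 2) s := by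
  have h1 := (h.regInt_eq (x := (1 / 2, b)) hb ha).1
  have h2 := (h.regInt_eq (x := (-(1 / 2), b)) hb ha).1
  simp only at h1 h2
  have i1 : IntervalIntegrable (fun s => colInt ω b a (s - 1 / 2) s) volume (1 / 2 - a)
      (1 / 2 + a) := by
    have := h1.comp_sub_right (1 / 2)
    simpa [add_comm, sub_eq_add_neg] using this
  -- The square about -1/2 is reflected by s ↦ -s, so that both integrals run over the same interval
  -- with the same kernel.
  have i2 : IntervalIntegrable (fun s => colInt ω b a (s - 1 / 2) (-s)) volume (1 / 2 - a)
      (1 / 2 + a) := by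
    have := (h2.comp_sub_left (1 / 2)).symm
    rw [sub_neg_eq_add] at this
    refine this.congr fun s _ => ?_
    simp only [colInt]
    refine intervalIntegral.integral_congr fun t _ => ?_
    rw [← ker_neg_left, neg_sub, show -(1 / 2 : ℝ) + (1 / 2 - s) = -s by ring]
  have e1 : ∫ σ in (-a)..a, colInt ω b a σ (1 / 2 + σ) =
      ∫ s in (1 / 2 - a)..(1 / 2 + a), colInt ω b a (s - 1 / 2) s := by
    have := intervalIntegral.integral_comp_sub_right (a := 1 / 2 - a) (b := 1 / 2 + a)
      (fun σ => colInt ω b a σ (1 / 2 + σ)) (1 / 2)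
    rw [show 1 / 2 - a - 1 / 2 = -a by ring, show 1 / 2 + a - 1 / 2 = a by ring] at this
    rw [← this]
    simp
  have e2 : ∫ σ in (-a)..a, colInt ω b a σ (-(1 / 2) + σ) =
      ∫ s in (1 / 2 - a)..(1 / 2 + a), colInt ω b a (s - 1 / 2) (-s) := by
    have := intervalIntegral.integral_comp_sub_left (a := 1 / 2 - a) (b := 1 / 2 + a)
      (fun σ => colInt ω b a σ (-(1 / 2) + σ)) (1 / 2)
    rw [show 1 / 2 - (1 / 2 + a) = -a by ring, show 1 / 2 - (1 / 2 - a) = a by ring] at this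
    rw [← this]
    refine intervalIntegral.integral_congr fun s _ => ?_
    simp only [colInt]
    refine intervalIntegral.integral_congr fun t _ => ?_
    rw [← ker_neg_left, neg_sub, show -(1 / 2 : ℝ) + (1 / 2 - s) = -s by ring]
  have hae : ∀ᵐ s : ℝ, colInt ω b a (s - 1 / 2) s - colInt ω b a (s - 1 / 2) (-s) =
      2 * colOdd ω b a (s - 1 / 2) s := by
    filter_upwards [Measure.ae_ne volume (1 / 2 : ℝ)] with s hs
    exact h.colInt_sub_colInt ha (sub_ne_zero.2 hs) b s
  have i3 : IntervalIntegrable (fun s => 2 * colOdd ω b a (s - 1 / 2) s) volume (1 / 2 - a)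
      (1 / 2 + a) := (i1.sub i2).congr_ae (ae_restrict_of_ae hae)
  constructor
  · have := i3.const_mul (1 / 2)
    refine this.congr fun s _ => ?_
    ring
  · rw [e1, e2, ← intervalIntegral.integral_sub i1 i2, ← intervalIntegral.integral_const_mul]
    exact intervalIntegral.integral_congr_ae (hae.mono fun s hs _ => hs)

end IsHolderPair

/-! ### The estimate in normalized coordinates. -/

/-- Half the difference of the two column integrals, by odd parts of columns. -/
def oddTotal (ω : ℝ × ℝ → ℝ) (b a : ℝ) : ℝ :=
  ∫ s in (1 / 2 - a)..(1 / 2 + a), colOdd ω b a (s - 1 / 2) s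

lemma sum_lintegral_shift (f : ℝ → ENNReal) (c : ℝ) (n : ℕ) :
    ∑ k ∈ Finset.range n, ∫⁻ s in Ioc c (c + 1), f (s + k) = ∫⁻ s in Ioc c (c + n), f s := by
  induction n with
  | zero => simp
  | succ n ih =>
    rw [Finset.sum_range_succ, ih]
    have h1 : ∫⁻ s in Ioc c (c + 1), f (s + n) = ∫⁻ s in Ioc (c + n) (c + (n + 1 : ℕ)), f s := by
      have h2 := (measurePreserving_add_right (volume : Measure ℝ)
        (n : ℝ)).setLIntegral_comp_preimage_emb (measurableEmbedding_addRight (n : ℝ)) f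
        (Ioc (c + n) (c + (n + 1 : ℕ)))
      have h3 : (fun s : ℝ => s + n) ⁻¹' Ioc (c + n) (c + (n + 1 : ℕ)) = Ioc c (c + 1) := by
        ext s
        simp only [mem_Ioc, mem_preimage]
        push_cast
        constructor <;> rintro ⟨_, _⟩ <;> constructor <;> linarith
      rwa [h3] at h2
    have hn : (0 : ℝ) ≤ n := Nat.cast_nonneg n
    rw [h1, ← lintegral_union measurableSet_Ioc (by
      rw [Set.disjoint_left]; intro x hx hx'; exact absurd hx.2 (not_le.2 hx'.1)),
      Ioc_union_Ioc_eq_Ioc (by linarith) (by push_cast; linarith)]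

namespace IsHolderPair

variable {ω : ℝ × ℝ → ℝ}

/-- Columns near the edge of the square have no reflected partner. Telescoping over shifts of the
kernel by 1 writes such a column as a sum of differences, the k-th one priced by the column cost at
s + k: the bound √(2s) is smaller than √(2(s + k)). -/
lemma ofReal_colOdd_le (h : IsHolderPair ω 1 0.582) {a b s : ℝ} (ha : 0 < a) (hb : 0 < b)
    (hs : 1 / 2 < s) (n : ℕ) :
    ENNReal.ofReal (colOdd ω b a (s - 1 / 2) s) ≤
      (∑ k ∈ Finset.range n, colCost 0.582 (s + k) (min b a)) +
        ENNReal.ofReal (colOdd ω b a (s + n - 1 / 2) s) := by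
  induction n with
  | zero => simp
  | succ n ih =>
    refine ih.trans ?_
    rw [Finset.sum_range_succ, add_assoc]
    gcongr
    have hn : (0 : ℝ) ≤ n := Nat.cast_nonneg n
    have h1 := h.colOdd_sub_colOdd (s := s) (s' := s + n) ha (by linarith) (by linarith)
      (by linarith) b
    have h2 := col_le (h.isColumn (s := s) (by linarith)) (s := s + n) (b := b) (a := a)
      (by linarith) (by linarith) (by
        rw [mul_div_cancel₀ _ (two_ne_zero)]; apply sqrt_le_sqrt; linarith) (by norm_num) hb ha
    rw [← h1] at h2
    have e : colOdd ω b a (s + n - 1 / 2) s = (colOdd ω b a (s + n - 1 / 2) s -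
      colOdd ω b a (s + n + 1 / 2) s) + colOdd ω b a (s + (n + 1 : ℕ) - 1 / 2) s := by
      rw [show s + ((n + 1 : ℕ) : ℝ) - 1 / 2 = s + n + 1 / 2 by push_cast; ring]
      ring
    rw [e]
    exact ENNReal.ofReal_add_le.trans (add_le_add_left h2 _)

/-- The strip has width 1, so the shifted costs tile (a - 1/2, ∞) exactly; the remainder is O(1/n).
Since a ≥ 2, the strip stays away from the kernel's singularity. -/
lemma ofReal_integral_strip_le (h : IsHolderPair ω 1 0.582) {a b : ℝ} (ha : 2 ≤ a) (hb : 0 < b)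
    (hi : IntervalIntegrable (fun s => colOdd ω b a (s - 1 / 2) s) volume (a - 1 / 2) (a + 1 / 2)) :
    ENNReal.ofReal (∫ s in (a - 1 / 2)..(a + 1 / 2), colOdd ω b a (s - 1 / 2) s) ≤
      ∫⁻ s in Ioi (a - 1 / 2), colCost 0.582 s (min b a) := by
  have ha0 : 0 < a := by linarith
  have hle : a - 1 / 2 ≤ a + 1 / 2 := by linarith
  set K := a * √(2 * a + 1) with hK
  have hK0 : 0 ≤ K := by positivity
  have hN : ∀ n : ℕ, ENNReal.ofReal (∫ s in (a - 1 / 2)..(a + 1 / 2), colOdd ω b a (s - 1 / 2) s) ≤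
      (∫⁻ s in Ioi (a - 1 / 2), colCost 0.582 s (min b a)) + ENNReal.ofReal (K / (n + 1 : ℝ)) := by
    intro n
    rw [intervalIntegral.integral_of_le hle]
    refine (ofReal_integral_le ((intervalIntegrable_iff_integrableOn_Ioc_of_le hle).1 hi)).trans ?_
    calc ∫⁻ s in Ioc (a - 1 / 2) (a + 1 / 2), ENNReal.ofReal (colOdd ω b a (s - 1 / 2) s)
        ≤ ∫⁻ s in Ioc (a - 1 / 2) (a + 1 / 2),
          ((∑ k ∈ Finset.range n, colCost 0.582 (s + k) (min b a)) +
            ENNReal.ofReal (K / (n + 1 : ℝ))) := by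
          refine setLIntegral_mono' measurableSet_Ioc fun s hs => ?_
          refine (h.ofReal_colOdd_le ha0 hb (by linarith [hs.1]) n).trans ?_
          gcongr
          have hn : (0 : ℝ) ≤ n := Nat.cast_nonneg n
          have hd : (n + 1 : ℝ) ≤ s + n - 1 / 2 := by linarith [hs.1]
          refine (le_abs_self _).trans ((h.abs_colOdd_le ha0 (by linarith) (by linarith [hs.1])
            b).trans ?_)
          have h1 : (n + 1 : ℝ) ≤ (s + n - 1 / 2) ^ 2 := by nlinarith
          have h2 : a * √(2 * s) ≤ K := by
            rw [hK]
            gcongr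
            linarith [hs.2]
          gcongr
      _ = (∑ k ∈ Finset.range n, ∫⁻ s in Ioc (a - 1 / 2) (a - 1 / 2 + 1),
            colCost 0.582 (s + k) (min b a)) + ENNReal.ofReal (K / (n + 1 : ℝ)) := by
          have hm : ∀ k : ℕ, Measurable fun s => colCost 0.582 (s + k) (min b a) := fun k =>
            (measurable_colCost 0.582 (min b a)).comp (measurable_add_const (k : ℝ))
          rw [lintegral_add_right _ measurable_const, lintegral_finsetSum _ fun k _ => hm k, setLIntegral_const,
            Real.volume_Ioc, show a + 1 / 2 - (a - 1 / 2) = 1 by ring,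
            show a + 1 / 2 = a - 1 / 2 + 1 by ring, ENNReal.ofReal_one, mul_one]
      _ ≤ _ := by
          rw [sum_lintegral_shift (fun s => colCost 0.582 s (min b a))]
          gcongr
          exact Ioc_subset_Ioi_self
  have ht : Tendsto (fun n : ℕ => (∫⁻ s in Ioi (a - 1 / 2), colCost 0.582 s (min b a)) +
      ENNReal.ofReal (K / (n + 1 : ℝ))) atTop
      (𝓝 ((∫⁻ s in Ioi (a - 1 / 2), colCost 0.582 s (min b a)) + 0)) := by
    refine Tendsto.const_add _ ?_
    have h1 : Tendsto (fun n : ℕ => K / (n + 1 : ℝ)) atTop (𝓝 0) :=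
      tendsto_const_nhds.div_atTop (tendsto_natCast_atTop_atTop.atTop_add tendsto_const_nhds)
    simpa using ENNReal.tendsto_ofReal h1
  rw [add_zero] at ht
  exact ge_of_tendsto' ht hN

/-- On (1/2 - a, a - 1/2) the columns s and -s combine into one difference-kernel integral. The
leftover strip costs no more than the columns beyond a - 1/2, so the total is bounded by the
integral of the column cost over all of (0, ∞). The function g carries a saving that may be
available on some columns. -/
lemma oddTotal_add_le (h : IsHolderPair ω 1 0.582) {a b : ℝ} (ha : 2 ≤ a) (hb : 0 < b)
    {g : ℝ → ENNReal}
    (hg : ∀ s ∈ Ioc 0 (a - 1 / 2), s ≠ 1 / 2 →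
      ENNReal.ofReal (∫ t in Ioi 0, diffKer s t * foldCol (halfDiff ω s) b a t) + g s ≤
        colCost 0.582 s (min b a)) :
    ENNReal.ofReal (oddTotal ω b a) + ∫⁻ s in Ioc 0 (a - 1 / 2), g s ≤ totalCost (min b a) := by
  have ha0 : 0 < a := by linarith
  have hi := (h.integral_colOdd ha0 hb).1
  have hc0 : 0 ≤ a - 1 / 2 := by linarith
  have hmono : ∀ {u v : ℝ}, 1 / 2 - a ≤ u → u ≤ v → v ≤ 1 / 2 + a →
      IntervalIntegrable (fun s => colOdd ω b a (s - 1 / 2) s) volume u v := by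
    intro u v hu huv hv
    refine hi.mono_set ?_
    rw [uIcc_of_le huv, uIcc_of_le (by linarith)]
    exact Icc_subset_Icc hu hv
  have i1 := hmono (u := 1 / 2 - a) (v := 0) le_rfl (by linarith) (by linarith)
  have i2 := hmono (u := 0) (v := a - 1 / 2) (by linarith) (by linarith) (by linarith)
  have i3 := hmono (u := a - 1 / 2) (v := a + 1 / 2) (by linarith) (by linarith) (by linarith)
  have i1' : IntervalIntegrable (fun s => colOdd ω b a (-s - 1 / 2) (-s)) volume 0 (a - 1 / 2) := by
    have := ((IntervalIntegrable.iff_comp_neg enorm_ne_top).1 i1).symm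
    simpa using this
  have e1 : ∫ s in (1 / 2 - a)..0, colOdd ω b a (s - 1 / 2) s =
      ∫ s in (0)..(a - 1 / 2), colOdd ω b a (-s - 1 / 2) (-s) := by
    have := intervalIntegral.integral_comp_neg (a := 0) (b := a - 1 / 2)
      (fun s => colOdd ω b a (s - 1 / 2) s)
    rw [this, neg_zero, neg_sub]
  have e2 : oddTotal ω b a = (∫ s in (0)..(a - 1 / 2), (colOdd ω b a (s - 1 / 2) s +
      colOdd ω b a (-s - 1 / 2) (-s))) + ∫ s in (a - 1 / 2)..(a + 1 / 2),
        colOdd ω b a (s - 1 / 2) s := by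
    rw [oddTotal, intervalIntegral.integral_add i2 i1', ← e1, add_comm (1 / 2) a,
      ← intervalIntegral.integral_add_adjacent_intervals (i1.trans i2) i3,
      ← intervalIntegral.integral_add_adjacent_intervals i1 i2]
    ring
  have i4 := i2.add i1'
  have h1 : ENNReal.ofReal (∫ s in (0)..(a - 1 / 2), (colOdd ω b a (s - 1 / 2) s +
      colOdd ω b a (-s - 1 / 2) (-s))) + ∫⁻ s in Ioc 0 (a - 1 / 2), g s ≤
      ∫⁻ s in Ioc 0 (a - 1 / 2), colCost 0.582 s (min b a) := by
    rw [intervalIntegral.integral_of_le hc0]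
    refine (add_le_add_left (ofReal_integral_le
      ((intervalIntegrable_iff_integrableOn_Ioc_of_le hc0).1 i4)) _).trans ?_
    refine (le_lintegral_add _ _).trans (lintegral_mono_ae ?_)
    filter_upwards [ae_restrict_of_ae (Measure.ae_ne volume (1 / 2 : ℝ)),
      ae_restrict_mem measurableSet_Ioc] with s hs hsm
    have e : colOdd ω b a (s - 1 / 2) s + colOdd ω b a (-s - 1 / 2) (-s) =
        ∫ t in Ioi 0, diffKer s t * foldCol (halfDiff ω s) b a t := by
      rw [← h.colOdd_sub_colOdd ha0 hsm.1.le hsm.1 hs b, colOdd_neg_right,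
        show -s - 1 / 2 = -(s + 1 / 2) by ring, colOdd_neg_left]
      ring
    rw [e]
    exact hg s hsm hs
  have h2 := h.ofReal_integral_strip_le ha hb i3
  refine le_trans ?_ (lintegral_colCost_le (lt_min hb ha0))
  rw [← Ioc_union_Ioi_eq_Ioi hc0, lintegral_union measurableSet_Ioi (Ioc_disjoint_Ioi le_rfl), e2]
  calc _ ≤ _ := add_le_add_left ENNReal.ofReal_add_le _
    _ = _ := add_right_comm _ _ _
    _ ≤ _ := add_le_add h1 h2

lemma oddTotal_le_totalCost (h : IsHolderPair ω 1 0.582) {a b : ℝ} (ha : 2 ≤ a) (hb : 0 < b) :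
    ENNReal.ofReal (oddTotal ω b a) ≤ totalCost (min b a) := by
  have := h.oddTotal_add_le ha hb (g := fun _ => 0) (fun s hs hs' => by
    rw [add_zero]
    exact col_le (h.isColumn hs.1.le) hs.1 hs' (by rw [mul_div_cancel₀ _ (two_ne_zero)])
      (by norm_num) hb (by linarith))
  simpa using this

lemma oddTotal_le (h : IsHolderPair ω 1 0.582) {a b : ℝ} (ha : 2 ≤ a) (hb : 0 < b) :
    oddTotal ω b a ≤ 1.538 * π := by
  have h1 := (h.oddTotal_le_totalCost ha hb).trans (totalCost_le_all (lt_min hb (by linarith)))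
  exact (ENNReal.ofReal_le_ofReal_iff (by positivity)).1 h1

lemma oddTotal_sub_le (h : IsHolderPair ω 1 0.582) {a b : ℝ} (ha : 2 ≤ a) (hb : 0 < b) :
    oddTotal ω b a - π * (2 * halfDiff ω (1 / 2) b) ≤ 2.53 * π := by
  have hpi := pi_pos
  have hφ : -1 ≤ 2 * halfDiff ω (1 / 2) b := by
    have := (h.isColumn (s := 1 / 2) (by norm_num)).neg_le_bound b
    norm_num at this
    linarith
  -- Three cases: 1.53 + 1 for a wall within 1/10, then 1.538 + 0.99, and finally 1.538 + 1 with the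
  -- saving 0.0264 > 0.008π.
  rcases lt_or_ge b (1 / 10) with hb1 | hb1
  · have h1 := (h.oddTotal_le_totalCost ha hb).trans (totalCost_le_of_small
      (lt_min hb (by linarith)) ((min_le_left _ _).trans hb1.le))
    have h2 := (ENNReal.ofReal_le_ofReal_iff (by positivity)).1 h1
    nlinarith
  rcases le_or_gt (-0.495) (halfDiff ω (1 / 2) b) with hm | hm
  · have h2 := h.oddTotal_le ha hb
    nlinarith
  · have hg := h.oddTotal_add_le ha hb
      (g := (Icc 0.48 0.52).indicator fun _ => ENNReal.ofReal 0.66) (fun s hs hs' => by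
        have hβ : 2 * (√(2 * s) / 2) ≤ √(2 * s) := by rw [mul_div_cancel₀ _ (two_ne_zero)]
        by_cases hmem : s ∈ Icc (0.48 : ℝ) 0.52
        · rw [Set.indicator_of_mem hmem]
          obtain ⟨hs1, hs2⟩ := hmem
          refine col_add_gain_le (h.isColumn hs.1.le) (by rw [abs_le]; constructor <;> norm_num at * <;> linarith)
            hs' hβ hb1 (by linarith) ?_
          have h1 := abs_le.1 (h.horiz s (1 / 2) b)
          have h2 := abs_le.1 (h.horiz (-s) (-(1 / 2)) b)
          rw [show -s - -(1 / 2) = -(s - 1 / 2) by ring, abs_neg] at h2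
          unfold halfDiff at hm ⊢
          linarith [h1.2, h2.1]
        · rw [Set.indicator_of_notMem hmem, add_zero]
          exact col_le (h.isColumn hs.1.le) hs.1 hs' hβ (by norm_num) hb (by linarith))
    -- A saving of 0.66 on each column of an interval of length 0.04.
    have hI : ENNReal.ofReal 0.0264 ≤ ∫⁻ s in Ioc 0 (a - 1 / 2),
        (Icc (0.48 : ℝ) 0.52).indicator (fun _ => ENNReal.ofReal 0.66) s := by
      rw [setLIntegral_indicator measurableSet_Icc, setLIntegral_const,
        inter_eq_self_of_subset_left, Real.volume_Icc, ← ENNReal.ofReal_mul (by norm_num)]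
      · norm_num
      · intro s hs
        exact ⟨by linarith [hs.1], by linarith [hs.2]⟩
    have h1 := ((add_le_add_right hI _).trans hg).trans (totalCost_le_all (lt_min hb (by linarith)))
    have h2 : ENNReal.ofReal (oddTotal ω b a + 0.0264) ≤ ENNReal.ofReal (1.538 * π) :=
      ENNReal.ofReal_add_le.trans h1
    have h3 := (ENNReal.ofReal_le_ofReal_iff (by positivity)).1 h2
    have := pi_lt_d2
    nlinarith

lemma oddTotal_neg : oddTotal (fun p => -ω p) = fun b a => -oddTotal ω b a := by
  funext b a
  unfold oddTotal
  rw [← intervalIntegral.integral_neg]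
  refine intervalIntegral.integral_congr fun s _ => ?_
  simp only [colOdd]
  rw [← intervalIntegral.integral_neg]
  refine intervalIntegral.integral_congr fun t _ => ?_
  simp only [oddCol, halfDiff]
  split_ifs <;> ring

/-- The estimate of the difference in normalized coordinates. -/
lemma abs_regInt_sub_le (h : IsHolderPair ω 1 0.582) {a b : ℝ} (ha : 2 ≤ a) (hb : 0 < b) :
    |(regInt ω (1 / 2, b) a + π * ω (1 / 2, b)) -
        (regInt ω (-(1 / 2), b) a + π * ω (-(1 / 2), b))| ≤ 2 * (1.538 * π) ∧
      |(regInt ω (1 / 2, b) a - π * ω (1 / 2, b)) -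
        (regInt ω (-(1 / 2), b) a - π * ω (-(1 / 2), b))| ≤ 2 * (2.53 * π) := by
  have ha0 : 0 < a := by linarith
  have h1 := (h.regInt_eq (x := (1 / 2, b)) hb ha0).2
  have h2 := (h.regInt_eq (x := (-(1 / 2), b)) hb ha0).2
  have h3 := (h.integral_colOdd ha0 hb).2
  simp only at h1 h2
  have e1 : (regInt ω (1 / 2, b) a + π * ω (1 / 2, b)) -
      (regInt ω (-(1 / 2), b) a + π * ω (-(1 / 2), b)) = 2 * oddTotal ω b a := by
    rw [h1, h2, oddTotal, ← h3]; ring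
  have e2 : (regInt ω (1 / 2, b) a - π * ω (1 / 2, b)) -
      (regInt ω (-(1 / 2), b) a - π * ω (-(1 / 2), b)) =
        2 * (oddTotal ω b a - π * (2 * halfDiff ω (1 / 2) b)) := by
    have : π * (2 * halfDiff ω (1 / 2) b) = π * ω (1 / 2, b) - π * ω (-(1 / 2), b) := by
      unfold halfDiff; ring
    rw [this]
    linarith
  have hn := h.neg
  have u1 := h.oddTotal_le ha hb
  have u2 := hn.oddTotal_le ha hb
  have v1 := h.oddTotal_sub_le ha hb
  have v2 := hn.oddTotal_sub_le ha hb
  rw [oddTotal_neg] at u2 v2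
  have e3 : halfDiff (fun p => -ω p) (1 / 2) b = -halfDiff ω (1 / 2) b := by unfold halfDiff; ring
  rw [e3] at v2
  rw [e1, e2]
  constructor <;> rw [abs_le] <;> constructor <;> linarith

end IsHolderPair

/-! ### Scaling to general points. -/

lemma oddExt_rescale {h : ℝ} (hh : 0 < h) (l c : ℝ) (ω : ℝ × ℝ → ℝ) (y : ℝ × ℝ) :
    oddExt (fun y => l * ω (c + h * y.1, h * y.2)) y = l * oddExt ω (c + h * y.1, h * y.2) := by
  unfold oddExt
  simp only [mul_nonneg_iff_of_pos_left hh]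
  split_ifs
  · rfl
  · simp

open Pointwise in
lemma smul_sq {h : ℝ} (hh : 0 < h) (a : ℝ) : h • sq a = sq (h * a) := by
  ext p
  rw [mem_smul_set_iff_inv_smul_mem₀ hh.ne', mem_sq, mem_sq]
  simp only [Prod.smul_fst, Prod.smul_snd, smul_eq_mul, abs_mul, abs_inv, abs_of_pos hh,
    inv_mul_le_iff₀ hh]

open Pointwise in
lemma regInt_rescale {h : ℝ} (hh : 0 < h) (l c : ℝ) (ω : ℝ × ℝ → ℝ) (x : ℝ × ℝ) (a : ℝ) :
    regInt (fun y => l * ω (c + h * y.1, h * y.2)) x a =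
      l * regInt ω (c + h * x.1, h * x.2) (h * a) := by
  set X : ℝ × ℝ := (c + h * x.1, h * x.2) with hX
  have h1 := Measure.setIntegral_comp_smul_of_pos (volume : Measure (ℝ × ℝ))
    (fun p => ker p.1 p.2 * (oddExt ω (X + p) - ω X)) (sq a) hh
  rw [smul_sq hh, show Module.finrank ℝ (ℝ × ℝ) = 2 by simp, smul_eq_mul] at h1
  have h2 : regInt ω X (h * a) = h ^ 2 * ∫ p in sq a,
      ker (h • p).1 (h • p).2 * (oddExt ω (X + h • p) - ω X) := by
    rw [h1, regInt, mul_inv_cancel_left₀ (by positivity)]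
  rw [h2, regInt, ← integral_const_mul, ← integral_const_mul]
  congr 1
  ext p
  rw [oddExt_rescale hh]
  simp only [Prod.smul_fst, Prod.smul_snd, smul_eq_mul, ker_mul hh.ne', Prod.fst_add, Prod.snd_add]
  have e : X + h • p = (c + h * (x.1 + p.1), h * (x.2 + p.2)) := by
    rw [hX]
    ext <;> simp <;> ring
  rw [e, ← hX]
  field_simp

namespace IsHolderPair

variable {ω : ℝ × ℝ → ℝ}

lemma mono {M N M' N' : ℝ} (h : IsHolderPair ω M N) (hM : M ≤ M') (hN : N ≤ N') :
    IsHolderPair ω M' N' :=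
  ⟨fun u v y => (h.horiz u v y).trans (by gcongr), fun u y y' => (h.vert u y y').trans (by gcongr)⟩

lemma rescale {M N h : ℝ} (hω : IsHolderPair ω M N) (hh : 0 < h) (l c : ℝ) :
    IsHolderPair (fun y => l * ω (c + h * y.1, h * y.2)) (|l| * M * √h) (|l| * N * √h) := by
  constructor
  · intro u v y
    have := hω.horiz (c + h * u) (c + h * v) (h * y)
    rw [show c + h * u - (c + h * v) = h * (u - v) by ring, abs_mul, abs_of_pos hh,
      sqrt_mul hh.le] at this
    rw [← mul_sub, abs_mul]
    nlinarith [mul_le_mul_of_nonneg_left this (abs_nonneg l)]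
  · intro u y y'
    have := hω.vert (c + h * u) (h * y) (h * y')
    rw [show h * y - h * y' = h * (y - y') by ring, abs_mul, abs_of_pos hh,
      sqrt_mul hh.le] at this
    rw [← mul_sub, abs_mul]
    nlinarith [mul_le_mul_of_nonneg_left this (abs_nonneg l)]

lemma exists_pv {M N : ℝ} (h : IsHolderPair ω M N) {x : ℝ × ℝ} (hx : 0 ≤ x.2) (a : ℝ) :
    PVExists (integrand ω x) (box a x) x := by
  rcases hx.eq_or_lt with hx | hx
  · exact (h.pv_of_boundary hx.symm a).1
  · exact (h.pv hx a).1

lemma abs_loc_sub_le_of_midpoint {M h a b : ℝ} (hω : IsHolderPair ω M (0.582 * M)) (hM : 0 < M)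
    (hh : 0 < h) (ha : 2 * h ≤ a) (hb : 0 ≤ b) (c : ℝ) :
    |locVx ω (c + h / 2, b) a - locVx ω (c - h / 2, b) a| ≤ 2.53 * (M * √h) ∧
      |locUy ω (c + h / 2, b) a - locUy ω (c - h / 2, b) a| ≤ 1.55 * (M * √h) := by
  have hpi := pi_pos
  have hs : 0 < √h := sqrt_pos.2 hh
  have hMs : 0 < M * √h := by positivity
  rcases hb.eq_or_lt with hb | hb
  -- On the axis the principal values vanish and only the terms ±ω/2 contribute, giving the constant
  -- 1/2.
  · have h1 := hω.horiz (c + h / 2) (c - h / 2) b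
    rw [show c + h / 2 - (c - h / 2) = h by ring, abs_of_pos hh] at h1
    unfold locVx locUy
    rw [(hω.pv_of_boundary (x := (c + h / 2, b)) hb.symm a).2,
      (hω.pv_of_boundary (x := (c - h / 2, b)) hb.symm a).2]
    obtain ⟨h2, h3⟩ := abs_le.1 h1
    constructor <;> rw [abs_le] <;> constructor <;> linarith
  -- Dividing by M√h makes the horizontal constant 1 and the vertical one 0.582 after lengths are
  -- scaled by h.
  · set l := (M * √h)⁻¹ with hl
    have hl0 : 0 < l := by positivity
    have hω' := hω.rescale hh l c
    have e1 : |l| * M * √h = 1 := by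
      rw [abs_of_pos hl0, mul_assoc, hl, inv_mul_cancel₀ hMs.ne']
    have e2 : |l| * (0.582 * M) * √h = 0.582 := by
      linear_combination (0.582 : ℝ) * e1
    rw [e1, e2] at hω'
    have ha' : 2 ≤ a / h := by rwa [le_div_iff₀ hh]
    have key := hω'.abs_regInt_sub_le ha' (b := b / h) (by positivity)
    simp only [regInt_rescale hh, mul_div_cancel₀ _ hh.ne'] at key
    rw [show c + h * (1 / 2) = c + h / 2 by ring, show c + h * -(1 / 2) = c - h / 2 by ring] at key
    have hpv1 := (hω.pv (x := (c + h / 2, b)) hb a).2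
    have hpv2 := (hω.pv (x := (c - h / 2, b)) hb a).2
    set R1 := regInt ω (c + h / 2, b) a
    set R2 := regInt ω (c - h / 2, b) a
    set w1 := ω (c + h / 2, b)
    set w2 := ω (c - h / 2, b)
    have e3 : locVx ω (c + h / 2, b) a - locVx ω (c - h / 2, b) a =
        1 / (2 * π) * (M * √h) * ((l * R1 - π * (l * w1)) - (l * R2 - π * (l * w2))) := by
      unfold locVx
      rw [hpv1, hpv2, show ω (c + h / 2, b) = w1 from rfl, show ω (c - h / 2, b) = w2 from rfl, hl]
      field_simp
    have e4 : locUy ω (c + h / 2, b) a - locUy ω (c - h / 2, b) a =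
        1 / (2 * π) * (M * √h) * ((l * R1 + π * (l * w1)) - (l * R2 + π * (l * w2))) := by
      unfold locUy
      rw [hpv1, hpv2, show ω (c + h / 2, b) = w1 from rfl, show ω (c - h / 2, b) = w2 from rfl, hl]
      field_simp
    have hc : 0 < 1 / (2 * π) * (M * √h) := by positivity
    rw [e3, e4, abs_mul (1 / (2 * π) * (M * √h)), abs_mul (1 / (2 * π) * (M * √h)), abs_of_pos hc]
    constructor
    · refine (mul_le_mul_of_nonneg_left key.2 hc.le).trans (le_of_eq ?_)
      field_simp
    · refine (mul_le_mul_of_nonneg_left key.1 hc.le).trans ?_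
      have : 1 / (2 * π) * (M * √h) * (2 * (1.538 * π)) = 1.538 * (M * √h) := by field_simp
      rw [this]
      nlinarith

lemma abs_loc_sub_le {M a : ℝ} (hω : IsHolderPair ω M (0.582 * M)) (hM : 0 < M)
    {x z : ℝ × ℝ} (hx : 0 ≤ x.2) (hxz : x.2 = z.2) (hne : x.1 ≠ z.1) (ha : 2 * |x.1 - z.1| ≤ a) :
    |locVx ω x a - locVx ω z a| ≤ 2.53 * (M * √|x.1 - z.1|) ∧
      |locUy ω x a - locUy ω z a| ≤ 1.55 * (M * √|x.1 - z.1|) := by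
  obtain ⟨x1, b⟩ := x
  obtain ⟨z1, b'⟩ := z
  simp only at hx hxz hne ha ⊢
  subst hxz
  rcases lt_or_gt_of_ne hne with h | h
  · rw [abs_sub_comm x1 z1] at ha ⊢
    rw [abs_of_pos (sub_pos.2 h)] at ha ⊢
    have := hω.abs_loc_sub_le_of_midpoint hM (sub_pos.2 h) ha hx ((x1 + z1) / 2)
    rw [show (x1 + z1) / 2 + (z1 - x1) / 2 = z1 by ring,
      show (x1 + z1) / 2 - (z1 - x1) / 2 = x1 by ring] at this
    rwa [abs_sub_comm (locVx _ _ _), abs_sub_comm (locUy _ _ _)]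
  · rw [abs_of_pos (sub_pos.2 h)] at ha ⊢
    have := hω.abs_loc_sub_le_of_midpoint hM (sub_pos.2 h) ha hx ((x1 + z1) / 2)
    rwa [show (x1 + z1) / 2 + (x1 - z1) / 2 = x1 by ring,
      show (x1 + z1) / 2 - (x1 - z1) / 2 = z1 by ring] at this

end IsHolderPair

/-! ### From the seminorms on D to functions on the plane. -/

lemma abs_sub_le_of_holderX {ω : ℝ × ℝ → ℝ} {D : Set (ℝ × ℝ)} (h : holderX (1 / 2) ω D ≠ ⊤)
    {p q : ℝ × ℝ} (hp : p ∈ D) (hq : q ∈ D) (hpq : p.2 = q.2) :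
    |ω p - ω q| ≤ (holderX (1 / 2) ω D).toReal * √|p.1 - q.1| := by
  rcases eq_or_ne p.1 q.1 with h1 | h1
  · rw [Prod.ext h1 hpq]; simp
  have h2 : ENNReal.ofReal (|ω p - ω q| / |p.1 - q.1| ^ (1 / 2 : ℝ)) ≤ holderX (1 / 2) ω D :=
    le_iSup₂_of_le p hp (le_iSup₂_of_le q hq (le_iSup_of_le hpq le_rfl))
  have h3 := (ENNReal.ofReal_le_iff_le_toReal h).1 h2
  rw [← sqrt_eq_rpow] at h3
  exact (div_le_iff₀ (sqrt_pos.2 (abs_pos.2 (sub_ne_zero.2 h1)))).1 h3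

lemma abs_sub_le_of_holderY {ω : ℝ × ℝ → ℝ} {D : Set (ℝ × ℝ)} (h : holderY (1 / 2) ω D ≠ ⊤)
    {p q : ℝ × ℝ} (hp : p ∈ D) (hq : q ∈ D) (hpq : p.1 = q.1) :
    |ω p - ω q| ≤ (holderY (1 / 2) ω D).toReal * √|p.2 - q.2| := by
  rcases eq_or_ne p.2 q.2 with h1 | h1
  · rw [Prod.ext hpq h1]; simp
  have h2 : ENNReal.ofReal (|ω p - ω q| / |p.2 - q.2| ^ (1 / 2 : ℝ)) ≤ holderY (1 / 2) ω D :=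
    le_iSup₂_of_le p hp (le_iSup₂_of_le q hq (le_iSup_of_le hpq le_rfl))
  have h3 := (ENNReal.ofReal_le_iff_le_toReal h).1 h2
  rw [← sqrt_eq_rpow] at h3
  exact (div_le_iff₀ (sqrt_pos.2 (abs_pos.2 (sub_ne_zero.2 h1)))).1 h3

lemma abs_clamp_sub_clamp_le (l u s t : ℝ) :
    |max l (min u s) - max l (min u t)| ≤ |s - t| := by
  have h1 := abs_max_sub_max_le_max l (min u s) l (min u t)
  have h2 := abs_min_sub_min_le_max u s u t
  rw [sub_self, abs_zero, max_eq_right (abs_nonneg (_ : ℝ))] at h1 h2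
  exact h1.trans h2

lemma clamp_mem_Icc {l u : ℝ} (h : l ≤ u) (t : ℝ) : max l (min u t) ∈ Icc l u :=
  ⟨le_max_left _ _, max_le h (min_le_left _ _)⟩

lemma clamp_eq_self {l u t : ℝ} (h : t ∈ Icc l u) : max l (min u t) = t := by
  rw [min_eq_right h.2, max_eq_right h.1]

/-- A function on a rectangle that is Hölder continuous in both variables extends to the plane with
the same constants. -/
lemma exists_isHolderPair_eqOn {ω : ℝ × ℝ → ℝ} {M N l u l' u' : ℝ} (hl : l ≤ u) (hl' : l' ≤ u')
    (hM : ∀ p ∈ Icc l u ×ˢ Icc l' u', ∀ q ∈ Icc l u ×ˢ Icc l' u', p.2 = q.2 →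
      |ω p - ω q| ≤ M * √|p.1 - q.1|)
    (hN : ∀ p ∈ Icc l u ×ˢ Icc l' u', ∀ q ∈ Icc l u ×ˢ Icc l' u', p.1 = q.1 →
      |ω p - ω q| ≤ N * √|p.2 - q.2|)
    (hM0 : 0 ≤ M) (hN0 : 0 ≤ N) :
    ∃ ω' : ℝ × ℝ → ℝ, IsHolderPair ω' M N ∧ EqOn ω' ω (Icc l u ×ˢ Icc l' u') := by
  have hc : ∀ s y, (max l (min u s), max l' (min u' y)) ∈ Icc l u ×ˢ Icc l' u' := fun s y =>
    ⟨clamp_mem_Icc hl s, clamp_mem_Icc hl' y⟩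
  refine ⟨fun p => ω (max l (min u p.1), max l' (min u' p.2)), ⟨fun s t y => ?_, fun s y y' => ?_⟩,
    fun p hp => ?_⟩
  · refine (hM _ (hc s y) _ (hc t y) rfl).trans ?_
    exact mul_le_mul_of_nonneg_left (sqrt_le_sqrt (abs_clamp_sub_clamp_le l u s t)) hM0
  · refine (hN _ (hc s y) _ (hc s y') rfl).trans ?_
    exact mul_le_mul_of_nonneg_left (sqrt_le_sqrt (abs_clamp_sub_clamp_le l' u' y y')) hN0
  · simp only [clamp_eq_self hp.1, clamp_eq_self hp.2]

lemma measurableSet_box (a : ℝ) (x : ℝ × ℝ) : MeasurableSet (box a x) :=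
  measurableSet_Icc.prod measurableSet_Icc

/-- The part of the square below the axis is seen only through its reflection, which lies in the
part above; agreement on the upper rectangle suffices. -/
lemma integrand_eqOn {ω ω' : ℝ × ℝ → ℝ} {x : ℝ × ℝ} {a l u : ℝ} (hx : 0 ≤ x.2)
    (h : EqOn ω' ω (Icc l u ×ˢ Icc (max 0 (x.2 - a)) (x.2 + a))) (hl : l ≤ x.1 - a)
    (hu : x.1 + a ≤ u) : EqOn (integrand ω' x) (integrand ω x) (box a x) := by
  intro y hy
  obtain ⟨⟨h1, h2⟩, h3, h4⟩ := hy
  have : oddExt ω' y = oddExt ω y := by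
    unfold oddExt
    split_ifs with h0
    · exact h ⟨⟨by linarith, by linarith⟩, max_le h0 h3, h4⟩
    · rw [not_le] at h0
      rw [h (show (y.1, -y.2) ∈ _ from ⟨⟨by simp only; linarith, by simp only; linarith⟩,
        max_le (by simp only; linarith) (by simp only; linarith), by simp only; linarith⟩)]
  rw [integrand, integrand, this]

lemma truncIntegral_congr {f g : ℝ × ℝ → ℝ} {a : ℝ} {x : ℝ × ℝ} (h : EqOn f g (box a x)) :
    truncIntegral f (box a x) x = truncIntegral g (box a x) x := by
  ext ε
  exact setIntegral_congr_fun ((measurableSet_box a x).diff (measurableSet_box ε x))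
    (h.mono sdiff_subset)

lemma PVExists.congr {f g : ℝ × ℝ → ℝ} {a : ℝ} {x : ℝ × ℝ} (h : EqOn f g (box a x))
    (hf : PVExists f (box a x) x) : PVExists g (box a x) x := by
  refine ⟨fun ε hε => (hf.1 ε hε).congr_fun (h.mono sdiff_subset)
    ((measurableSet_box a x).diff (measurableSet_box ε x)), ?_⟩
  rw [← truncIntegral_congr h]
  exact hf.2

lemma pvIntegral_congr {f g : ℝ × ℝ → ℝ} {a : ℝ} {x : ℝ × ℝ} (h : EqOn f g (box a x)) :
    pvIntegral f (box a x) x = pvIntegral g (box a x) x := by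
  rw [pvIntegral, pvIntegral, truncIntegral_congr h]

/-- The two squares overlap because |x₁ - z₁| ≤ a, so their union is a rectangle. This is what
permits extension by clamping the coordinates. -/
lemma rect_subset_boxes {x z : ℝ × ℝ} {a : ℝ} (hxz : x.2 = z.2) (ha : 2 * |x.1 - z.1| ≤ a) :
    Icc (min x.1 z.1 - a) (max x.1 z.1 + a) ×ˢ Icc (max 0 (x.2 - a)) (x.2 + a) ⊆
      (box a x ∪ box a z) ∩ upperHalf := by
  rintro p ⟨⟨h1, h2⟩, h3, h4⟩
  have h5 := (le_max_left _ _).trans h3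
  have h6 := (le_max_right _ _).trans h3
  refine ⟨?_, h5⟩
  simp only [mem_union, box, mem_prod, mem_Icc, ← hxz]
  have h7 := abs_le.1 (show |x.1 - z.1| ≤ a by linarith [abs_nonneg (x.1 - z.1)])
  rcases le_total x.1 z.1 with h | h
  · rw [min_eq_left h] at h1
    rw [max_eq_right h] at h2
    rcases le_total p.1 (x.1 + a) with h8 | h8
    · exact Or.inl ⟨⟨h1, h8⟩, h6, h4⟩
    · exact Or.inr ⟨⟨by linarith, h2⟩, h6, h4⟩
  · rw [min_eq_right h] at h1
    rw [max_eq_left h] at h2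
    rcases le_total p.1 (z.1 + a) with h8 | h8
    · exact Or.inr ⟨⟨h1, h8⟩, h6, h4⟩
    · exact Or.inl ⟨⟨by linarith, h2⟩, h6, h4⟩

lemma exists_pv_and_abs_loc_sub_le {ω : ℝ × ℝ → ℝ} {D : Set (ℝ × ℝ)} {a : ℝ} {x z : ℝ × ℝ}
    (ha0 : 0 < a) (hx : 0 ≤ x.2) (hxz : x.2 = z.2) (ha : 2 * |x.1 - z.1| ≤ a)
    (hD : (box a x ∪ box a z) ∩ upperHalf ⊆ D) (hX : holderX (1 / 2) ω D ≠ ⊤)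
    (hY : holderY (1 / 2) ω D ≠ ⊤) :
    PVExists (integrand ω x) (box a x) x ∧ PVExists (integrand ω z) (box a z) z ∧
      ∀ M > 0, (holderX (1 / 2) ω D).toReal ≤ M → (holderY (1 / 2) ω D).toReal ≤ 0.582 * M →
        x.1 ≠ z.1 →
        |locVx ω x a - locVx ω z a| ≤ 2.53 * (M * √|x.1 - z.1|) ∧
          |locUy ω x a - locUy ω z a| ≤ 1.55 * (M * √|x.1 - z.1|) := by
  have hR := (rect_subset_boxes hxz ha).trans hD
  have h1 : min x.1 z.1 ≤ max x.1 z.1 := min_le_max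
  obtain ⟨ω', hω', heq⟩ := exists_isHolderPair_eqOn (ω := ω)
    (l := min x.1 z.1 - a) (u := max x.1 z.1 + a) (l' := max 0 (x.2 - a)) (u' := x.2 + a)
    (by linarith) (max_le (by linarith) (by linarith))
    (fun p hp q hq => abs_sub_le_of_holderX hX (hR hp) (hR hq))
    (fun p hp q hq => abs_sub_le_of_holderY hY (hR hp) (hR hq))
    ENNReal.toReal_nonneg ENNReal.toReal_nonneg
  have hz : 0 ≤ z.2 := hxz ▸ hx
  have i1 : min x.1 z.1 - a ≤ x.1 - a := by linarith [min_le_left x.1 z.1]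
  have i2 : x.1 + a ≤ max x.1 z.1 + a := by linarith [le_max_left x.1 z.1]
  have i3 : min x.1 z.1 - a ≤ z.1 - a := by linarith [min_le_right x.1 z.1]
  have i4 : z.1 + a ≤ max x.1 z.1 + a := by linarith [le_max_right x.1 z.1]
  have ex := integrand_eqOn hx heq i1 i2
  have exx : ω' x = ω x :=
    heq ⟨⟨by linarith, by linarith⟩, max_le hx (by linarith), by linarith⟩
  have ezz : ω' z = ω z :=
    heq ⟨⟨by linarith, by linarith⟩, max_le hz (by linarith), by linarith⟩
  rw [hxz] at heq
  have ez := integrand_eqOn hz heq i3 i4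
  refine ⟨(hω'.exists_pv hx a).congr ex, (hω'.exists_pv hz a).congr ez, fun M hM hXM hYM hne => ?_⟩
  have key := (hω'.mono hXM hYM).abs_loc_sub_le hM hx hxz hne ha
  unfold locVx locUy at key ⊢
  rwa [pvIntegral_congr ex, pvIntegral_congr ez, exx, ezz] at key

end SharpHolder

end

theorem lemma3p3 :
    ∃ C₁ C₂ : ℝ → ℝ,
      (∀ τ : ℝ, 0 < τ → 0 < C₁ τ ∧ 0 < C₂ τ) ∧
      1 / π * C₁ 0.582 ≤ 2.53 ∧
      1 / π * C₂ 0.582 ≤ 1.55 ∧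
      ∀ (ω : ℝ × ℝ → ℝ) (D : Set (ℝ × ℝ)) (a : ℝ) (x z : ℝ × ℝ),
        0 < a → x ∈ SharpHolder.upperHalf → z ∈ SharpHolder.upperHalf → x.2 = z.2 →
        2 * |x.1 - z.1| ≤ a →
        D ⊆ SharpHolder.upperHalf →
        (SharpHolder.box a x ∪ SharpHolder.box a z) ∩ SharpHolder.upperHalf ⊆ D →
        SharpHolder.holderX (1 / 2) ω D ≠ ⊤ →
        SharpHolder.holderY (1 / 2) ω D ≠ ⊤ →
        SharpHolder.PVExists (SharpHolder.integrand ω x) (SharpHolder.box a x) x ∧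
        SharpHolder.PVExists (SharpHolder.integrand ω z) (SharpHolder.box a z) z ∧
        ∀ τ : ℝ, 0 < τ →
          |SharpHolder.locVx ω x a - SharpHolder.locVx ω z a| / |x.1 - z.1| ^ (1 / 2 : ℝ) ≤
            1 / π * C₁ τ * max (SharpHolder.holderX (1 / 2) ω D).toReal
              (τ⁻¹ * (SharpHolder.holderY (1 / 2) ω D).toReal) ∧
          |SharpHolder.locUy ω x a - SharpHolder.locUy ω z a| / |x.1 - z.1| ^ (1 / 2 : ℝ) ≤
            1 / π * C₂ τ * max (SharpHolder.holderX (1 / 2) ω D).toReal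
              (τ⁻¹ * (SharpHolder.holderY (1 / 2) ω D).toReal) := by

  have hpi := pi_pos
  -- The factor max(1, τ/0.582) equals 1 at τ = 0.582. For other τ it turns the maximum of the two
  -- seminorms into an M that satisfies the hypotheses with vertical constant 0.582 M.
  refine ⟨fun τ => 2.53 * π * max 1 (τ / 0.582), fun τ => 1.55 * π * max 1 (τ / 0.582),
    fun τ _ => ?_, ?_, ?_, ?_⟩
  · have : 0 < max 1 (τ / 0.582) := lt_max_of_lt_left one_pos
    constructor <;> positivity
  · exact le_of_eq (by norm_num; field_simp)
  · exact le_of_eq (by norm_num; field_simp)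
  intro ω D a x z ha0 hx _ hxz ha _ hD hX hY
  obtain ⟨hpx, hpz, key⟩ :=
    SharpHolder.exists_pv_and_abs_loc_sub_le ha0 hx hxz ha hD hX hY
  refine ⟨hpx, hpz, fun τ hτ => ?_⟩
  set A := (SharpHolder.holderX (1 / 2) ω D).toReal
  set B := (SharpHolder.holderY (1 / 2) ω D).toReal
  have hA : 0 ≤ A := ENNReal.toReal_nonneg
  set m := max A (τ⁻¹ * B)
  have hm : 0 ≤ m := hA.trans (le_max_left _ _)
  set k := max 1 (τ / 0.582)
  have hk1 : 1 ≤ k := le_max_left _ _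
  have hk2 : τ ≤ 0.582 * k := by
    have : τ / 0.582 ≤ k := le_max_right _ _
    rw [div_le_iff₀ (by norm_num)] at this
    linarith
  have e1 : 1 / π * (2.53 * π * k) * m = 2.53 * (k * m) := by field_simp
  have e2 : 1 / π * (1.55 * π * k) * m = 1.55 * (k * m) := by field_simp
  rw [e1, e2, ← sqrt_eq_rpow]
  have hkm : 0 ≤ k * m := by positivity
  rcases eq_or_ne x.1 z.1 with hne | hne
  -- For coinciding points the quotient is 0, since division by zero gives 0.
  · simp only [hne, sub_self, abs_zero, sqrt_zero, div_zero]
    constructor <;> positivity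
  have hs : 0 < √|x.1 - z.1| := sqrt_pos.2 (abs_pos.2 (sub_ne_zero.2 hne))
  have hAm : A ≤ k * m := (le_max_left A (τ⁻¹ * B)).trans (le_mul_of_one_le_left hm hk1)
  have hBm : B ≤ 0.582 * (k * m) := by
    have : τ⁻¹ * B ≤ m := le_max_right _ _
    rw [inv_mul_le_iff₀ hτ] at this
    nlinarith
  -- The normalized estimate needs a strictly positive M, whereas k m may vanish; hence the limit in
  -- ε.
  have hε : ∀ ε > 0, |SharpHolder.locVx ω x a - SharpHolder.locVx ω z a| / √|x.1 - z.1| ≤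
      2.53 * (k * m + ε) ∧ |SharpHolder.locUy ω x a - SharpHolder.locUy ω z a| / √|x.1 - z.1| ≤
      1.55 * (k * m + ε) := by
    intro ε hε
    have := key (k * m + ε) (by linarith) (by linarith) (by linarith) hne
    rw [div_le_iff₀ hs, div_le_iff₀ hs, mul_assoc, mul_assoc]
    exact this
  constructor <;> refine le_of_forall_pos_le_add fun ε hε0 => ?_
  · refine (hε (ε / 2.53) (by positivity)).1.trans (le_of_eq ?_)
    rw [mul_add, mul_div_cancel₀ _ (by norm_num)]
  · refine (hε (ε / 1.55) (by positivity)).2.trans (le_of_eq ?_)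
    rw [mul_add, mul_div_cancel₀ _ (by norm_num)]
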